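/- Let $\Bbbk$ be a field, let $Q_A$, $Q_B$ be finite quivers, and let $A=\Bbbk Q_A/I_A$, $B=\Bbbk Q_B/I_B$ be bound quiver algebras with admissible ideals (paths are composed from left to right; modules are finitely generated right modules, identified with representations). Let $Q_C$ be the quiver whose vertex set is the disjoint union of those of $Q_A$ and $Q_B$ and whose arrows are the arrows of $Q_A$, the arrows of $Q_B$ and finitely many new arrows $\alpha_j$ $(j\in J)$, each with source in $Q_A$ and target in $Q_B$. Let $C=\Bbbk Q_C/I_C$ with $I_C$ admissible such that $I_C\cap \Bbbk Q_A=I_A$, $I_C\cap\Bbbk Q_B=I_B$ (so that $C$ is a triangular matrix algebra with diagonal blocks $A$ and $B$, and $A$- and $B$-modules are $C$-modules by extending representations by zero) and $\alpha\alpha_j\in I_C$ for every arrow $\alpha$ of $Q_A$ and every $j\in J$. Notation, for $R$ one of these algebras. $\Omega_R(M)$ is the kernel of a projective cover of $M$; $\operatorname{add}\mathcal C$ is the class of finite direct sums of direct summands of modules of $\mathcal C$. $K_0(R)$ is the abelian group generated by the symbols $[M]$, $M\in\operatorname{mod}R$, modulo $[M]=[M']+[M'']$ if $M\cong M'\oplus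 M''$, and $[P]=0$ for $P$ projective; $\bar\Omega$ is its endomorphism $[M]\mapsto[\Omega_R M]$; $\langle\mathcal C\rangle\subseteq K_0(R)$ is the subgroup generated by the classes of the direct summands of modules of $\mathcal C$. $\phi(M)$ is the least $k\ge 0$ such that $\bar\Omega$ is injective on $\bar\Omega^m\langle\operatorname{add}M\rangle$ for all $m\ge k$. A class $\mathcal D\subseteq\operatorname{mod}R$ is a $0$-Igusa-Todorov subcategory if $\mathcal D=\operatorname{add}\mathcal D$, $\Omega_R(\mathcal D)\subseteq\mathcal D$ and $\phi(M)=0$ for all $M\in\mathcal D$. $R$ is an $(n,V,\mathcal D)$-LIT algebra if $V\in\operatorname{mod}R$, $\mathcal D$ is a $0$-Igusa-Todorov subcategory and every $M\in\operatorname{mod}R$ has an exact sequence $0\to V_1\oplus D_1\to V_0\oplus D_0\to\Omega_R^n(M)\to0$ with $V_0,V_1\in\operatorname{add}V$ and $D_0,D_1\in\mathcal D$; it is $n$-LIT if this holds for some $V$, $\mathcal D$. It is $n$-Igusa-Todorov, with $n$-Igusa-Todorov module $V$, if this holds with $\mathcal D=\{0\}$. Let $C_0$ be the direct sum of the simple $C$-modules,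 one from each isomorphism class, and let $\Pi_B(M)$ be the restriction of a representation $M$ of $Q_C$ to $Q_B$. Suppose that the subgroup $$\mathcal O=\langle \operatorname{add}\{\Omega_B^i(\Pi_B(\Omega_C(C_0))) : i\ge 0\}\rangle\subseteq K_0(C)$$ is finitely generated, that $A$ is $n$-Igusa-Todorov and that $B$ is $n$-LIT. Then $C$ is $(n+1)$-LIT. More precisely, the set $I$ of isomorphism classes of indecomposable $C$-modules $O$ with $[O]\in\mathcal O$ is finite and, whenever $W$ is an $n$-Igusa-Todorov module of $A$ and $B$ is $(n,V,\mathcal D)$-LIT, the algebra $C$ is $\bigl(n+1,\ V\oplus W\oplus A\oplus\bigoplus_{O\in I}O,\ \mathcal D\bigr)$-LIT. -/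

import Mathlib

universe u

namespace LIT

open scoped DirectSum

/-! ### Finitely generated modules over a ring

All notions are stated for left `R`-modules; right modules over an algebra `A` are left
`Aᵐᵒᵖ`-modules. Classes of modules are predicates on `ModuleCat R`. -/

section General

variable {R : Type u} [Ring R]

/-- `X` is (isomorphic to) a direct summand of `M`. -/
def IsSummand (X M : ModuleCat.{u} R) : Prop :=
  ∃ Y : ModuleCat.{u} R, Nonempty ((X × Y) ≃ₗ[R] M)

/-- `add 𝒞`: the finite direct sums of direct summands of modules of `𝒞`. -/
def addClass (𝒞 : ModuleCat.{u} R → Prop) (X : ModuleCat.{u} R) : Prop :=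
  ∃ (m : ℕ) (S : Fin m → ModuleCat.{u} R),
    (∀ i, ∃ M, 𝒞 M ∧ IsSummand (S i) M) ∧ Nonempty (X ≃ₗ[R] (∀ i, S i))

/-- `f : P → M` is a projective cover of the module `M` in `mod R`: a surjection from a
finitely generated projective module with superfluous kernel. -/
def IsProjectiveCover {P M : ModuleCat.{u} R} (f : P →ₗ[R] M) : Prop :=
  Module.Finite R P ∧ Module.Projective R P ∧ Function.Surjective f ∧
    ∀ N : Submodule R P, N ⊔ LinearMap.ker f = ⊤ → N = ⊤

/-- `K ≅ Ω(M)`: `K` is isomorphic to the kernel of a projective cover of `M`. -/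
def IsSyzygy (K M : ModuleCat.{u} R) : Prop :=
  ∃ (P : ModuleCat.{u} R) (f : P →ₗ[R] M),
    IsProjectiveCover f ∧ Nonempty (K ≃ₗ[R] LinearMap.ker f)

/-- `K ≅ Ωⁿ(M)`. -/
def IsNthSyzygy : ℕ → ModuleCat.{u} R → ModuleCat.{u} R → Prop
  | 0, K, M => Nonempty (K ≃ₗ[R] M)
  | n + 1, K, M => ∃ L, IsSyzygy L M ∧ IsNthSyzygy n K L

/-- The orbit `{Ωⁿ(M) : n ≥ 0}`, up to isomorphism. -/
def Orb (M X : ModuleCat.{u} R) : Prop := ∃ n, IsNthSyzygy n X M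

/-- `X ≅ R₀`: `X` is the direct sum of a complete irredundant system of representatives of the
isomorphism classes of simple modules. -/
def IsSumOfSimples (X : ModuleCat.{u} R) : Prop :=
  ∃ (m : ℕ) (S : Fin m → ModuleCat.{u} R),
    (∀ i, IsSimpleModule R (S i)) ∧
    (∀ i j, Nonempty (S i ≃ₗ[R] S j) → i = j) ∧
    (∀ T : ModuleCat.{u} R, IsSimpleModule R T → ∃ i, Nonempty (T ≃ₗ[R] S i)) ∧
    Nonempty (X ≃ₗ[R] (∀ i, S i))

/-! ### The group `K₀` and the Igusa-Todorov function -/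

variable (R) in
/-- The finitely generated modules, i.e. the objects of `mod R`. -/
abbrev FGMod : Type (u + 1) := {M : ModuleCat.{u} R // Module.Finite R M}

variable (R) in
/-- The relations of `K₀`: `[M] - [M'] - [M'']` if `M ≅ M' ⊕ M''`, and `[P]` for `P` projective. -/
inductive K0Rel : FreeAbelianGroup (FGMod R) → Prop
  | sum (M M' M'' : FGMod R) (e : M.1 ≃ₗ[R] (M'.1 × M''.1)) :
      K0Rel (FreeAbelianGroup.of M - FreeAbelianGroup.of M' - FreeAbelianGroup.of M'')
  | proj (P : FGMod R) (h : Module.Projective R P.1) : K0Rel (FreeAbelianGroup.of P)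

variable (R) in
/-- The group `K₀(R)`: symbols `[M]`, for `M` in `mod R`, modulo the relations `K0Rel`. -/
abbrev K0 : Type (u + 1) :=
  FreeAbelianGroup (FGMod R) ⧸ AddSubgroup.closure {x | K0Rel R x}

/-- The class `[M]` in `K₀`. -/
def K0.mk (M : ModuleCat.{u} R) (h : Module.Finite R M) : K0 R :=
  QuotientAddGroup.mk (FreeAbelianGroup.of ⟨M, h⟩)

theorem K0.mk_eq_add {M M' M'' : ModuleCat.{u} R} (h : Module.Finite R M)
    (h' : Module.Finite R M') (h'' : Module.Finite R M'') (e : M ≃ₗ[R] (M' × M'')) :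
    K0.mk M h = K0.mk M' h' + K0.mk M'' h'' := by
  have : (QuotientAddGroup.mk (FreeAbelianGroup.of (⟨M, h⟩ : FGMod R)
      - FreeAbelianGroup.of ⟨M', h'⟩ - FreeAbelianGroup.of ⟨M'', h''⟩) : K0 R) = 0 :=
    (QuotientAddGroup.eq_zero_iff _).2
      (AddSubgroup.subset_closure (K0Rel.sum ⟨M, h⟩ ⟨M', h'⟩ ⟨M'', h''⟩ e))
  rw [QuotientAddGroup.mk_sub, QuotientAddGroup.mk_sub, sub_sub, sub_eq_zero] at this
  exact this

theorem K0.mk_projective {P : ModuleCat.{u} R} (h : Module.Finite R P)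
    (hP : Module.Projective R P) : K0.mk P h = 0 :=
  (QuotientAddGroup.eq_zero_iff _).2 (AddSubgroup.subset_closure (K0Rel.proj ⟨P, h⟩ hP))

theorem K0.mk_congr {M N : ModuleCat.{u} R} (h : Module.Finite R M) (h' : Module.Finite R N)
    (e : M ≃ₗ[R] N) : K0.mk M h = K0.mk N h' := by
  have e' : M ≃ₗ[R] (N × ModuleCat.of R PUnit.{u + 1}) :=
    e.trans (LinearEquiv.prodUnique (M₂ := PUnit.{u + 1})).symm
  rw [K0.mk_eq_add h h' (inferInstanceAs (Module.Finite R PUnit.{u + 1})) e',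
    K0.mk_projective (P := ModuleCat.of R PUnit.{u + 1}) _
      (inferInstanceAs (Module.Projective R PUnit.{u + 1})), add_zero]

/-- `⟨𝒞⟩`: the subgroup of `K₀` generated by the classes of direct summands of modules
of `𝒞`. -/
def K0.span (𝒞 : ModuleCat.{u} R → Prop) : AddSubgroup (K0 R) :=
  AddSubgroup.closure {x | ∃ (X : ModuleCat.{u} R) (h : Module.Finite R X),
    (∃ M, 𝒞 M ∧ IsSummand X M) ∧ x = K0.mk X h}

/-- `⟨add M⟩`: the subgroup of `K₀` generated by the classes of the indecomposable direct
summands of `M`. -/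
def K0.addSpan (M : ModuleCat.{u} R) : AddSubgroup (K0 R) :=
  AddSubgroup.closure {x | ∃ (X : ModuleCat.{u} R) (h : Module.Finite R X),
    CategoryTheory.Indecomposable X ∧ IsSummand X M ∧ x = K0.mk X h}

section Omega

/-- The pullback of two surjections `f : P → M`, `g : Q → M` with `Q` projective is
`ker f ⊕ Q`. -/
theorem pullback_equiv {P Q M : Type u} [AddCommGroup P] [AddCommGroup Q] [AddCommGroup M]
    [Module R P] [Module R Q] [Module R M] (f : P →ₗ[R] M) (g : Q →ₗ[R] M)
    (hf : Function.Surjective f) [Module.Projective R Q] :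
    Nonempty (LinearMap.eqLocus (f ∘ₗ LinearMap.fst R P Q) (g ∘ₗ LinearMap.snd R P Q) ≃ₗ[R]
      (LinearMap.ker f × Q)) := by
  obtain ⟨s, hs⟩ := Module.projective_lifting_property f g hf
  have hs' : ∀ q, f (s q) = g q := fun q => LinearMap.congr_fun hs q
  refine ⟨
    { toFun := fun x => (⟨x.1.1 - s x.1.2, by
          have := x.2
          simp only [LinearMap.mem_eqLocus, LinearMap.comp_apply, LinearMap.fst_apply,
            LinearMap.snd_apply] at this
          simp [hs', this]⟩, x.1.2)
      map_add' := fun x y => by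
        ext <;> simp; abel
      map_smul' := fun r x => by
        ext <;> simp [smul_sub]
      invFun := fun y => ⟨(y.1.1 + s y.2, y.2), by
          have := y.1.2
          simp only [LinearMap.mem_ker] at this
          simp [hs', this]⟩
      left_inv := fun x => by ext <;> simp
      right_inv := fun y => by ext <;> simp }⟩

/-- Schanuel's lemma in `K₀`: the kernels of two presentations of `M` have the same class. -/
theorem K0.schanuel {P Q M : ModuleCat.{u} R} (f : P →ₗ[R] M) (g : Q →ₗ[R] M)
    (hf : Function.Surjective f) (hg : Function.Surjective g)
    (hP : Module.Finite R P) (hQ : Module.Finite R Q)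
    (pP : Module.Projective R P) (pQ : Module.Projective R Q)
    (kf : Module.Finite R (LinearMap.ker f)) (kg : Module.Finite R (LinearMap.ker g)) :
    K0.mk (ModuleCat.of R (LinearMap.ker f)) kf = K0.mk (ModuleCat.of R (LinearMap.ker g)) kg := by
  obtain ⟨e₁⟩ := pullback_equiv f g hf
  obtain ⟨e₂⟩ := pullback_equiv g f hg
  let X := LinearMap.eqLocus (f ∘ₗ LinearMap.fst R P Q) (g ∘ₗ LinearMap.snd R P Q)
  let Y := LinearMap.eqLocus (g ∘ₗ LinearMap.fst R Q P) (f ∘ₗ LinearMap.snd R Q P)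
  have hY : ∀ y : Q × P, y ∈ Y ↔ g y.1 = f y.2 := fun y => by
    simp [Y, LinearMap.mem_eqLocus]
  have hX : ∀ y : P × Q, y ∈ X ↔ f y.1 = g y.2 := fun y => by
    simp [X, LinearMap.mem_eqLocus]
  have e₃ : X ≃ₗ[R] Y :=
    { toFun := fun x => ⟨(x.1.2, x.1.1), (hY _).2 ((hX _).1 x.2).symm⟩
      map_add' := fun _ _ => rfl
      map_smul' := fun _ _ => rfl
      invFun := fun y => ⟨(y.1.2, y.1.1), (hX _).2 ((hY _).1 y.2).symm⟩
      left_inv := fun _ => rfl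
      right_inv := fun _ => rfl }
  have fX : Module.Finite R X := Module.Finite.equiv e₁.symm
  have h₁ := K0.mk_eq_add (M := ModuleCat.of R X) (M' := ModuleCat.of R (LinearMap.ker f))
    (M'' := Q) fX kf hQ e₁
  have h₂ := K0.mk_eq_add (M := ModuleCat.of R X) (M' := ModuleCat.of R (LinearMap.ker g))
    (M'' := P) fX kg hP (e₃.trans e₂)
  rw [K0.mk_projective hQ pQ, add_zero] at h₁
  rw [K0.mk_projective hP pP, add_zero] at h₂
  exact h₁.symm.trans h₂

variable [IsNoetherianRing R]

theorem finite_ker {P M : ModuleCat.{u} R} (f : P →ₗ[R] M) (hP : Module.Finite R P) :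
    Module.Finite R (LinearMap.ker f) :=
  have := isNoetherian_of_isNoetherianRing_of_finite R P
  inferInstance

/-- The class in `K₀` of the kernel of a chosen surjection `Rᵐ → M`. -/
noncomputable def omegaGen (M : FGMod R) : K0 R :=
  have := M.2
  K0.mk (ModuleCat.of R (LinearMap.ker (Module.Finite.exists_fin' R M.1).choose_spec.choose))
    (finite_ker (P := ModuleCat.of R (Fin (Module.Finite.exists_fin' R M.1).choose → R))
      (M := M.1) _ (inferInstanceAs (Module.Finite R (Fin _ → R))))

/-- `omegaGen` is the class of the kernel of any surjection from a finitely generated projective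
module. -/
theorem omegaGen_eq (M : FGMod R) {P : ModuleCat.{u} R} (f : P →ₗ[R] M.1)
    (hf : Function.Surjective f) (hP : Module.Finite R P) (pP : Module.Projective R P) :
    omegaGen M = K0.mk (ModuleCat.of R (LinearMap.ker f)) (finite_ker f hP) := by
  have := M.2
  exact K0.schanuel (P := ModuleCat.of R (Fin (Module.Finite.exists_fin' R M.1).choose → R))
    (M := M.1) _ f (Module.Finite.exists_fin' R M.1).choose_spec.choose_spec hf
    (inferInstanceAs (Module.Finite R (Fin _ → R))) hP
    (inferInstanceAs (Module.Projective R (Fin _ → R))) pP _ _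

theorem omegaGen_rel {x : FreeAbelianGroup (FGMod R)} (hx : K0Rel R x) :
    FreeAbelianGroup.lift omegaGen x = 0 := by
  cases hx with
  | proj P h =>
    rw [FreeAbelianGroup.lift_apply_of, omegaGen_eq P (P := P.1) LinearMap.id
      Function.surjective_id P.2 h]
    refine K0.mk_projective _ ?_
    have : Subsingleton (LinearMap.ker (LinearMap.id : P.1 →ₗ[R] P.1)) :=
      ⟨fun a b => by
        have ha := a.2
        have hb := b.2
        simp only [LinearMap.mem_ker, LinearMap.id_apply] at ha hb
        exact Subtype.ext (ha.trans hb.symm)⟩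
    exact inferInstanceAs (Module.Projective R (LinearMap.ker (LinearMap.id : P.1 →ₗ[R] P.1)))
  | sum M M' M'' e =>
    have := M'.2
    have := M''.2
    obtain ⟨m, f, hf⟩ := Module.Finite.exists_fin' R M'.1
    obtain ⟨n, g, hg⟩ := Module.Finite.exists_fin' R M''.1
    let P := ModuleCat.of R (Fin m → R)
    let Q := ModuleCat.of R (Fin n → R)
    have fP : Module.Finite R P := inferInstanceAs (Module.Finite R (Fin m → R))
    have fQ : Module.Finite R Q := inferInstanceAs (Module.Finite R (Fin n → R))
    have pP : Module.Projective R P := inferInstanceAs (Module.Projective R (Fin m → R))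
    have pQ : Module.Projective R Q := inferInstanceAs (Module.Projective R (Fin n → R))
    let F : P →ₗ[R] M'.1 := f
    let G : Q →ₗ[R] M''.1 := g
    let H : (P × Q) →ₗ[R] M.1 := e.symm.toLinearMap ∘ₗ (F.prodMap G)
    have hH : Function.Surjective H := by
      intro y
      obtain ⟨p, hp⟩ := hf (e y).1
      obtain ⟨q, hq⟩ := hg (e y).2
      refine ⟨(p, q), ?_⟩
      have : e.symm (F p, G q) = y := by
        rw [show F p = (e y).1 from hp, show G q = (e y).2 from hq]
        exact e.symm_apply_apply y
      exact this
    have hker : ∀ x : P × Q, x ∈ LinearMap.ker H ↔ F x.1 = 0 ∧ G x.2 = 0 := by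
      intro x
      have : H x = e.symm (F x.1, G x.2) := rfl
      rw [LinearMap.mem_ker, this, LinearEquiv.map_eq_zero_iff, Prod.mk_eq_zero]
    let E : LinearMap.ker H ≃ₗ[R] (LinearMap.ker F × LinearMap.ker G) :=
      { toFun := fun x => (⟨x.1.1, ((hker _).1 x.2).1⟩, ⟨x.1.2, ((hker _).1 x.2).2⟩)
        map_add' := fun _ _ => rfl
        map_smul' := fun _ _ => rfl
        invFun := fun y => ⟨(y.1.1, y.2.1), (hker _).2 ⟨y.1.2, y.2.2⟩⟩
        left_inv := fun _ => rfl
        right_inv := fun _ => rfl }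
    simp only [map_sub, FreeAbelianGroup.lift_apply_of]
    rw [omegaGen_eq M' F hf fP pP, omegaGen_eq M'' G hg fQ pQ,
      omegaGen_eq M (P := ModuleCat.of R (P × Q)) H hH
        (inferInstanceAs (Module.Finite R (P × Q))) (inferInstanceAs (Module.Projective R (P × Q))),
      sub_sub, sub_eq_zero]
    exact K0.mk_eq_add _ _ _ E

variable (R) in
/-- The endomorphism `Ω̄` of `K₀` with `Ω̄[M] = [Ω M]`, see `omegaBar_of_isSyzygy`. (By Schanuel's
lemma `[Ω M]` is the class of the kernel of any presentation of `M`.) -/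
noncomputable def omegaBar : K0 R →+ K0 R :=
  QuotientAddGroup.lift _ (FreeAbelianGroup.lift omegaGen) (by
    rw [AddSubgroup.closure_le]
    intro x hx
    exact omegaGen_rel hx)

theorem omegaBar_of_isSyzygy {K M : ModuleCat.{u} R} (hM : Module.Finite R M)
    (hK : Module.Finite R K) (h : IsSyzygy K M) :
    omegaBar R (K0.mk M hM) = K0.mk K hK := by
  obtain ⟨P, f, ⟨hP, pP, hf, -⟩, ⟨e⟩⟩ := h
  have h₁ : omegaBar R (K0.mk M hM) = omegaGen ⟨M, hM⟩ := by
    show FreeAbelianGroup.lift omegaGen (FreeAbelianGroup.of (⟨M, hM⟩ : FGMod R)) = _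
    rw [FreeAbelianGroup.lift_apply_of]
  rw [h₁, omegaGen_eq ⟨M, hM⟩ f hf hP pP]
  exact (K0.mk_congr hK (finite_ker f hP) e).symm

/-- The Igusa-Todorov function: `φ(M)` is the least `k` such that `Ω̄` is injective on
`Ω̄ᵐ⟨add M⟩` for all `m ≥ k` (and `∞` if there is no such `k`). -/
noncomputable def phi (M : ModuleCat.{u} R) : ℕ∞ :=
  sInf {d : ℕ∞ | ∃ k : ℕ, d = k ∧ ∀ m : ℕ, k ≤ m →
    Set.InjOn (omegaBar R) ((omegaBar R)^[m] '' (K0.addSpan M : Set (K0 R)))}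

/-- `φdim(𝒞)`, the supremum of `φ` on `𝒞`. -/
noncomputable def phiDim (𝒞 : ModuleCat.{u} R → Prop) : ℕ∞ := ⨆ (M : ModuleCat.{u} R) (_ : 𝒞 M), phi M

/-! ### LIT and Igusa-Todorov algebras -/

/-- `𝒟 ⊆ mod R` is a `0`-Igusa-Todorov subcategory. -/
structure IsZeroIT (𝒟 : ModuleCat.{u} R → Prop) : Prop where
  finite : ∀ X, 𝒟 X → Module.Finite R X
  add_eq : ∀ X, 𝒟 X ↔ addClass 𝒟 X
  syzygy : ∀ X K, 𝒟 X → IsSyzygy K X → 𝒟 K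
  phiDim_eq : phiDim 𝒟 = 0

/-- `mod R` is `(n, V, 𝒟)`-Lat-Igusa-Todorov: `𝒟` is a `0`-Igusa-Todorov subcategory and every
finitely generated `M` has an exact sequence `0 → V₁ ⊕ D₁ → V₀ ⊕ D₀ → Ωⁿ(M) → 0` with
`V₀, V₁ ∈ add V` and `D₀, D₁ ∈ 𝒟`. -/
structure IsLIT (n : ℕ) (V : ModuleCat.{u} R) (𝒟 : ModuleCat.{u} R → Prop) : Prop where
  finite : Module.Finite R V
  zeroIT : IsZeroIT 𝒟
  exact_seq : ∀ M : ModuleCat.{u} R, Module.Finite R M →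
    ∃ K V₀ V₁ D₀ D₁ : ModuleCat.{u} R, IsNthSyzygy n K M ∧
      addClass (· = V) V₀ ∧ addClass (· = V) V₁ ∧ 𝒟 D₀ ∧ 𝒟 D₁ ∧
      ∃ (f : (V₁ × D₁) →ₗ[R] (V₀ × D₀)) (g : (V₀ × D₀) →ₗ[R] K),
        Function.Injective f ∧ Function.Exact f g ∧ Function.Surjective g

/-- `V` is an `n`-Igusa-Todorov module of `R`: the case `𝒟 = {0}`. -/
def IsITModule (n : ℕ) (V : ModuleCat.{u} R) : Prop :=
  IsLIT n V (fun D => Subsingleton D)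

variable (R) in
/-- `R` is an `n`-Igusa-Todorov algebra. -/
def IsITAlgebra (n : ℕ) : Prop := ∃ V : ModuleCat.{u} R, IsITModule n V

variable (R) in
/-- `R` is an `n`-LIT algebra. -/
def IsLITAlgebra (n : ℕ) : Prop :=
  ∃ (V : ModuleCat.{u} R) (𝒟 : ModuleCat.{u} R → Prop), IsLIT n V 𝒟

end Omega

end General


/-! ### Path algebras and bound quiver algebras -/

section PathAlg

open Quiver

/-- The paths of a quiver. -/
abbrev QPath (V : Type u) [Quiver.{u} V] : Type u := Σ a b : V, Path a b

/-- The path algebra `kQ`: the vector space with basis the paths of `Q`. -/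
def PathAlgebra (k : Type u) [Field k] (V : Type u) [Quiver.{u} V] : Type u := QPath V →₀ k

namespace PathAlgebra

variable {k : Type u} [Field k] {V : Type u} [Quiver.{u} V]

noncomputable instance : AddCommGroup (PathAlgebra k V) :=
  inferInstanceAs (AddCommGroup (QPath V →₀ k))

noncomputable instance : Module k (PathAlgebra k V) := inferInstanceAs (Module k (QPath V →₀ k))

/-- The coefficient of a path. -/
def coeff (x : PathAlgebra k V) (p : QPath V) : k := (show QPath V →₀ k from x) p

/-- The basis element of the path algebra given by a path. -/
noncomputable def ofPath (k : Type u) [Field k] {V : Type u} [Quiver.{u} V] {a b : V}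
    (p : Path a b) : PathAlgebra k V :=
  (Finsupp.single (⟨a, b, p⟩ : QPath V) (1 : k) : QPath V →₀ k)

/-- The trivial path at a vertex. -/
noncomputable def vertex (k : Type u) [Field k] {V : Type u} [Quiver.{u} V] (a : V) :
    PathAlgebra k V := ofPath k (Path.nil : Path a a)

/-- An arrow as an element of the path algebra. -/
noncomputable def arrow (k : Type u) [Field k] {V : Type u} [Quiver.{u} V] {a b : V} (f : a ⟶ b) :
    PathAlgebra k V := ofPath k f.toPath

/-- Linear extension of a map on paths. -/
noncomputable def extend {W : Type u} [AddCommGroup W] [Module k W]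
    (φ : ∀ a b : V, Path a b → W) : PathAlgebra k V →ₗ[k] W :=
  Finsupp.lift W k (QPath V) (fun p => φ p.1 p.2.1 p.2.2)

@[simp] theorem extend_ofPath {W : Type u} [AddCommGroup W] [Module k W]
    (φ : ∀ a b : V, Path a b → W) {a b : V} (p : Path a b) : extend φ (ofPath k p) = φ a b p := by
  show Finsupp.lift W k (QPath V) _ (Finsupp.single _ _) = _
  simp

theorem hom_ext {W : Type u} [AddCommGroup W] [Module k W] {f g : PathAlgebra k V →ₗ[k] W}
    (h : ∀ (a b : V) (p : Path a b), f (ofPath k p) = g (ofPath k p)) : f = g := by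
  refine Finsupp.lhom_ext' (fun p => ?_)
  obtain ⟨a, b, p⟩ := p
  ext
  exact h a b p

open Classical in
/-- The product of two paths: their composition (from left to right) if the first ends where the
second starts, and `0` otherwise. -/
noncomputable def mulPath {a b c d : V} (p : Path a b) (q : Path c d) : PathAlgebra k V :=
  if h : c = b then ofPath k (p.comp (q.cast h rfl)) else 0

/-- The multiplication of the path algebra. -/
noncomputable def mulHom : PathAlgebra k V →ₗ[k] PathAlgebra k V →ₗ[k] PathAlgebra k V :=
  extend (fun _ _ p => extend (fun _ _ q => mulPath p q))

noncomputable instance : Mul (PathAlgebra k V) := ⟨fun x y => mulHom x y⟩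

theorem mul_def (x y : PathAlgebra k V) : x * y = mulHom x y := rfl

theorem ofPath_mul_ofPath {a b c : V} (p : Path a b) (q : Path b c) :
    ofPath k p * ofPath k q = ofPath k (p.comp q) := by
  simp [mul_def, mulHom, mulPath]

theorem ofPath_mul_ofPath_of_ne {a b c d : V} (p : Path a b) (q : Path c d) (h : c ≠ b) :
    ofPath k p * ofPath k q = 0 := by
  simp [mul_def, mulHom, mulPath, h]

theorem mul_assoc_ofPath {a b c d e f : V} (p : Path a b) (q : Path c d) (r : Path e f) :
    ofPath k p * ofPath k q * ofPath k r = ofPath k p * (ofPath k q * ofPath k r) := by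
  by_cases h : c = b
  · subst h
    by_cases h' : e = d
    · subst h'
      simp only [ofPath_mul_ofPath, Path.comp_assoc]
    · rw [ofPath_mul_ofPath, ofPath_mul_ofPath_of_ne _ _ h', ofPath_mul_ofPath_of_ne _ _ h']
      exact (map_zero (mulHom _)).symm
  · by_cases h' : e = d
    · subst h'
      rw [ofPath_mul_ofPath q r, ofPath_mul_ofPath_of_ne _ _ h, ofPath_mul_ofPath_of_ne _ _ h]
      exact LinearMap.map_zero₂ mulHom _
    · rw [ofPath_mul_ofPath_of_ne _ _ h, ofPath_mul_ofPath_of_ne _ _ h']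
      exact (LinearMap.map_zero₂ mulHom _).trans (map_zero (mulHom _)).symm

/-- Induction along the basis of paths. -/
theorem path_induction {P : PathAlgebra k V → Prop} (zero : P 0)
    (add : ∀ x y, P x → P y → P (x + y))
    (path : ∀ (c : k) {a b : V} (p : Path a b), P (c • ofPath k p)) (x : PathAlgebra k V) :
    P x := by
  refine Finsupp.induction_linear (motive := P) x zero add ?_
  rintro ⟨a, b, p⟩ c
  have := path c p
  rwa [show c • ofPath k p = (Finsupp.single (⟨a, b, p⟩ : QPath V) c : QPath V →₀ k) from by
    show c • (Finsupp.single (⟨a, b, p⟩ : QPath V) (1 : k) : QPath V →₀ k) = _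
    simp] at this

noncomputable instance : NonUnitalRing (PathAlgebra k V) where
  left_distrib x y z := map_add (mulHom x) y z
  right_distrib x y z := LinearMap.map_add₂ mulHom x y z
  zero_mul x := LinearMap.map_zero₂ mulHom x
  mul_zero x := map_zero (mulHom x)
  mul_assoc x y z := by
    simp only [mul_def]
    refine path_induction (P := fun x => mulHom (mulHom x y) z = mulHom x (mulHom y z))
      (by simp) (fun x x' h h' => by simp only [map_add, LinearMap.add_apply, h, h']) (fun c a b p => ?_) x
    refine path_induction (P := fun y => mulHom (mulHom (c • ofPath k p) y) z
        = mulHom (c • ofPath k p) (mulHom y z))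
      (by simp) (fun x x' h h' => by simp only [map_add, LinearMap.add_apply, h, h']) (fun c' a' b' q => ?_) y
    refine path_induction (P := fun z => mulHom (mulHom (c • ofPath k p) (c' • ofPath k q)) z
        = mulHom (c • ofPath k p) (mulHom (c' • ofPath k q) z))
      (by simp) (fun x x' h h' => by simp only [map_add, h, h']) (fun c'' a'' b'' r => ?_) z
    have := mul_assoc_ofPath (k := k) p q r
    simp only [mul_def] at this
    simp [this, smul_smul, mul_comm, mul_left_comm]

theorem pa_smul_mul (c : k) (x y : PathAlgebra k V) : c • x * y = c • (x * y) :=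
  LinearMap.map_smul₂ mulHom c x y

theorem pa_mul_smul (c : k) (x y : PathAlgebra k V) : x * c • y = c • (x * y) :=
  map_smul (mulHom x) c y

theorem vertex_mul_ofPath {a b : V} (p : Path a b) : vertex k a * ofPath k p = ofPath k p := by
  simp [vertex, ofPath_mul_ofPath]

theorem ofPath_mul_vertex {a b : V} (p : Path a b) : ofPath k p * vertex k b = ofPath k p := by
  simp [vertex, ofPath_mul_ofPath]

section Fintype

variable [Fintype V]

noncomputable instance : One (PathAlgebra k V) := ⟨∑ a : V, vertex k a⟩

theorem one_def : (1 : PathAlgebra k V) = ∑ a : V, vertex k a := rfl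

noncomputable instance : Ring (PathAlgebra k V) where
  __ := (inferInstance : NonUnitalRing (PathAlgebra k V))
  one_mul x := by
    refine path_induction (P := fun x => 1 * x = x) (mul_zero _)
      (fun x y h h' => by rw [mul_add, h, h']) (fun c a b p => ?_) x
    rw [pa_mul_smul, one_def, Finset.sum_mul, Finset.sum_eq_single a, vertex_mul_ofPath]
    · exact fun v _ hv => ofPath_mul_ofPath_of_ne _ _ hv.symm
    · simp
  mul_one x := by
    refine path_induction (P := fun x => x * 1 = x) (zero_mul _)
      (fun x y h h' => by rw [add_mul, h, h']) (fun c a b p => ?_) x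
    rw [pa_smul_mul, one_def, Finset.mul_sum, Finset.sum_eq_single b, ofPath_mul_vertex]
    · exact fun v _ hv => ofPath_mul_ofPath_of_ne _ _ hv
    · simp

noncomputable instance : Algebra k (PathAlgebra k V) :=
  Algebra.ofModule pa_smul_mul pa_mul_smul

end Fintype

end PathAlgebra

open PathAlgebra

/-- An admissible two-sided ideal `I` of `kQ`: `J ^ m ⊆ I ⊆ J ^ 2` for some `m ≥ 2`, where `J` is
the ideal generated by the arrows, so that `J ^ m` is the span of the paths of length `≥ m`. -/
class IsAdmissible {k : Type u} [Field k] {V : Type u} [Quiver.{u} V] [Fintype V]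
    (I : Ideal (PathAlgebra k V)) : Prop extends I.IsTwoSided where
  le_sq : ∀ x ∈ I, ∀ p : QPath V, coeff x p ≠ 0 → 2 ≤ p.2.2.length
  pow_le : ∃ m : ℕ, 2 ≤ m ∧ ∀ (a b : V) (p : Path a b), m ≤ p.length → ofPath k p ∈ I

section BoundQuiver

variable {k : Type u} [Field k] {V : Type u} [Quiver.{u} V] [Fintype V]

theorem finite_paths [∀ a b : V, Finite (a ⟶ b)] (m : ℕ) :
    {p : QPath V | p.2.2.length < m}.Finite := by
  induction m with
  | zero => simp
  | succ m ih =>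
    have : Finite {p : QPath V | p.2.2.length < m} := ih
    let F : (V ⊕ (Σ (p : {p : QPath V | p.2.2.length < m}) (c : V), (p.1.2.1 ⟶ c))) → QPath V :=
      Sum.elim (fun a => ⟨a, a, Path.nil⟩) (fun x => ⟨x.1.1.1, x.2.1, x.1.1.2.2.cons x.2.2⟩)
    refine (Set.finite_range F).subset ?_
    rintro ⟨a, b, p⟩ hp
    cases p with
    | nil => exact ⟨Sum.inl a, rfl⟩
    | cons q f =>
      simp only [Set.mem_ofPred_eq, Path.length_cons] at hp
      exact ⟨Sum.inr ⟨⟨⟨a, _, q⟩, by simp only [Set.mem_ofPred_eq]; omega⟩, _, f⟩, rfl⟩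

/-- A bound quiver algebra of a finite quiver is finite dimensional. -/
instance finiteDimensional_boundQuiver [∀ a b : V, Finite (a ⟶ b)] (I : Ideal (PathAlgebra k V))
    [hI : IsAdmissible I] : Module.Finite k (PathAlgebra k V ⧸ I) := by
  obtain ⟨m, -, hm⟩ := hI.pow_le
  refine (Module.finite_def (R := k) (M := PathAlgebra k V ⧸ I)).2 ⟨((finite_paths (V := V) m).image
    (fun p => (Ideal.Quotient.mk I (ofPath k p.2.2)))).toFinset, ?_⟩
  rw [eq_top_iff]
  rintro x -
  obtain ⟨x, rfl⟩ := Ideal.Quotient.mk_surjective x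
  refine path_induction (P := fun x => Ideal.Quotient.mk I x ∈ Submodule.span k _) ?_ ?_ ?_ x
  · rw [map_zero]; exact zero_mem _
  · intro x y hx hy
    rw [map_add]; exact add_mem hx hy
  · intro c a b p
    have : Ideal.Quotient.mk I (c • ofPath k p) = c • Ideal.Quotient.mk I (ofPath k p) := rfl
    rw [this]
    refine Submodule.smul_mem _ c ?_
    by_cases hp : p.length < m
    · refine Submodule.subset_span ?_
      simp only [Set.Finite.coe_toFinset]
      exact ⟨⟨a, b, p⟩, hp, rfl⟩
    · rw [Ideal.Quotient.eq_zero_iff_mem.2 (hm a b p (not_lt.1 hp))]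
      exact zero_mem _

instance isArtinianRing_boundQuiver_op [∀ a b : V, Finite (a ⟶ b)] (I : Ideal (PathAlgebra k V))
    [IsAdmissible I] : IsArtinianRing (PathAlgebra k V ⧸ I)ᵐᵒᵖ :=
  have : Module.Finite k (PathAlgebra k V ⧸ I)ᵐᵒᵖ :=
    Module.Finite.equiv (MulOpposite.opLinearEquiv k)
  IsArtinianRing.of_finite k _

instance isNoetherianRing_boundQuiver_op [∀ a b : V, Finite (a ⟶ b)] (I : Ideal (PathAlgebra k V))
    [IsAdmissible I] : IsNoetherianRing (PathAlgebra k V ⧸ I)ᵐᵒᵖ := inferInstance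

end BoundQuiver

end PathAlg

/-! ### Gluing two quivers by arrows from the first to the second -/

section Gluing

open Quiver PathAlgebra

namespace PathAlgebra

variable {k : Type u} [Field k]

section Map

variable {V W : Type u} [Quiver.{u} V] [Quiver.{u} W]

/-- The linear map of path algebras induced by a morphism of quivers. -/
noncomputable def map (k : Type u) [Field k] (F : V ⥤q W) : PathAlgebra k V →ₗ[k] PathAlgebra k W :=
  extend (fun _ _ p => ofPath k (F.mapPath p))

theorem map_ofPath (F : V ⥤q W) {a b : V} (p : Path a b) :
    map k F (ofPath k p) = ofPath k (F.mapPath p) := extend_ofPath _ p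

/-- A morphism of quivers that is injective on vertices induces a multiplicative map. -/
theorem map_mul_of_injective (F : V ⥤q W) (hF : Function.Injective F.obj) (x y : PathAlgebra k V) :
    map k F (x * y) = map k F x * map k F y := by
  refine path_induction (P := fun x => map k F (x * y) = map k F x * map k F y) (by simp)
    (fun x x' h h' => by simp only [add_mul, map_add, h, h']) (fun c a b p => ?_) x
  refine path_induction (P := fun y => map k F (c • ofPath k p * y)
    = map k F (c • ofPath k p) * map k F y) (by simp)
    (fun x x' h h' => by simp only [mul_add, map_add, h, h']) (fun c' a' b' q => ?_) y
  simp only [pa_smul_mul, pa_mul_smul, map_smul, map_ofPath]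
  by_cases h : a' = b
  · subst h
    rw [ofPath_mul_ofPath, ofPath_mul_ofPath, map_ofPath, Prefunctor.mapPath_comp]
  · rw [ofPath_mul_ofPath_of_ne _ _ h, ofPath_mul_ofPath_of_ne _ _ (fun h' => h (hF h')), map_zero]

end Map

section Lift

variable {V : Type u} [Quiver.{u} V] [Fintype V] {S : Type u} [Ring S] [Algebra k S]

/-- The image of a path under an assignment on vertices and arrows. -/
def evalPath (e : V → S) (f : ∀ a b : V, (a ⟶ b) → S) {a : V} : ∀ {b : V}, Path a b → S
  | _, Path.nil => e a
  | _, Path.cons p g => evalPath e f p * f _ _ g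

/-- Algebra maps out of a path algebra: images of the vertices (a complete family of
orthogonal idempotents) and of the arrows. -/
noncomputable def lift (e : V → S) (f : ∀ a b : V, (a ⟶ b) → S)
    (idem : ∀ a, e a * e a = e a) (orth : ∀ a b, a ≠ b → e a * e b = 0) (sum : ∑ a, e a = 1)
    (right : ∀ a b (g : a ⟶ b), f a b g * e b = f a b g) : PathAlgebra k V →ₐ[k] S := by
  have hl : ∀ {a b : V} (p : Path a b), e a * evalPath e f p = evalPath e f p := by
    intro a b p
    induction p with
    | nil => exact idem a
    | cons p g ih => rw [evalPath, ← mul_assoc, ih]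
  have hr : ∀ {a b : V} (p : Path a b), evalPath e f p * e b = evalPath e f p := by
    intro a b p
    cases p with
    | nil => exact idem a
    | cons p g => rw [evalPath, mul_assoc, right]
  have hc : ∀ {a b c : V} (p : Path a b) (q : Path b c),
      evalPath e f (p.comp q) = evalPath e f p * evalPath e f q := by
    intro a b c p q
    induction q with
    | nil => exact (hr p).symm
    | cons q g ih => rw [Path.comp_cons, evalPath, evalPath, ih, mul_assoc]
  refine AlgHom.ofLinearMap (extend (fun _ _ p => evalPath e f p)) ?_ ?_
  · rw [one_def, map_sum, ← sum]
    exact Finset.sum_congr rfl (fun a _ => extend_ofPath _ _)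
  · intro x y
    refine path_induction (P := fun x => extend (fun _ _ p => evalPath e f p) (x * y)
      = extend (fun _ _ p => evalPath e f p) x * extend (fun _ _ p => evalPath e f p) y) (by simp)
      (fun x x' h h' => by simp only [add_mul, map_add, h, h']) (fun c a b p => ?_) x
    refine path_induction (P := fun y => extend (fun _ _ p => evalPath e f p) (c • ofPath k p * y)
      = extend (fun _ _ p => evalPath e f p) (c • ofPath k p)
        * extend (fun _ _ p => evalPath e f p) y) (by simp)
      (fun x x' h h' => by simp only [mul_add, map_add, h, h']) (fun c' a' b' q => ?_) y
    simp only [map_smul, extend_ofPath, smul_mul_assoc, mul_smul_comm]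
    congr 2
    by_cases h : a' = b
    · subst h
      rw [ofPath_mul_ofPath, extend_ofPath, hc]
    · rw [ofPath_mul_ofPath_of_ne _ _ h, map_zero, ← hr p, ← hl q, mul_assoc, ← mul_assoc (e b),
        orth b a' (Ne.symm h), zero_mul, mul_zero]

theorem lift_ofPath (e : V → S) (f : ∀ a b : V, (a ⟶ b) → S) (idem orth sum right)
    {a b : V} (p : Path a b) :
    lift (k := k) e f idem orth sum right (ofPath k p) = evalPath e f p :=
  extend_ofPath _ p

end Lift

end PathAlgebra

/-- The vertices of the glued quiver: the disjoint union of the vertices of `Q_A` and `Q_B`. The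
family `J` gives the new arrows: `J a b` is the set of the `α_j` with source `a` and target `b`. -/
inductive Glue (VA VB : Type u) (J : VA → VB → Type u) : Type u
  | inl (a : VA)
  | inr (b : VB)

/-- The vertices of the glued quiver as a disjoint union. -/
def Glue.equivSum (VA VB : Type u) (J : VA → VB → Type u) : VA ⊕ VB ≃ Glue VA VB J where
  toFun := Sum.elim Glue.inl Glue.inr
  invFun x := match x with
    | Glue.inl a => Sum.inl a
    | Glue.inr b => Sum.inr b
  left_inv := by rintro (a | b) <;> rfl
  right_inv := by rintro (a | b) <;> rfl

theorem Glue.inl_injective {VA VB : Type u} {J : VA → VB → Type u} :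
    Function.Injective (Glue.inl : VA → Glue VA VB J) := fun _ _ h => Glue.inl.inj h

theorem Glue.inr_injective {VA VB : Type u} {J : VA → VB → Type u} :
    Function.Injective (Glue.inr : VB → Glue VA VB J) := fun _ _ h => Glue.inr.inj h

section

variable (VA VB : Type u) [Quiver.{u} VA] [Quiver.{u} VB] (J : VA → VB → Type u)

/-- The arrows of the glued quiver: the arrows of `Q_A`, those of `Q_B`, and the `α_j`. -/
instance Glue.quiver : Quiver.{u} (Glue VA VB J) where
  Hom x y := match x, y with
    | Glue.inl a, Glue.inl a' => a ⟶ a'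
    | Glue.inr b, Glue.inr b' => b ⟶ b'
    | Glue.inl a, Glue.inr b => J a b
    | Glue.inr _, Glue.inl _ => PEmpty

instance Glue.fintype [Fintype VA] [Fintype VB] : Fintype (Glue VA VB J) :=
  Fintype.ofEquiv _ (Glue.equivSum VA VB J)

instance Glue.finite_hom [∀ a a' : VA, Finite (a ⟶ a')] [∀ b b' : VB, Finite (b ⟶ b')]
    [∀ a b, Finite (J a b)] (x y : Glue VA VB J) : Finite (x ⟶ y) :=
  match x, y with
  | Glue.inl a, Glue.inl a' => inferInstanceAs (Finite (a ⟶ a'))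
  | Glue.inr b, Glue.inr b' => inferInstanceAs (Finite (b ⟶ b'))
  | Glue.inl a, Glue.inr b => inferInstanceAs (Finite (J a b))
  | Glue.inr _, Glue.inl _ => inferInstanceAs (Finite PEmpty)

/-- The inclusion of `Q_A`. -/
def Glue.inA : VA ⥤q Glue VA VB J where
  obj := Glue.inl
  map f := f

/-- The inclusion of `Q_B`. -/
def Glue.inB : VB ⥤q Glue VA VB J where
  obj := Glue.inr
  map f := f

end

section

variable {k : Type u} [Field k] {VA VB : Type u} [Quiver.{u} VA] [Quiver.{u} VB]
  {J : VA → VB → Type u}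

/-- The arrow `α_j`. -/
def Glue.cross {a : VA} {b : VB} (j : J a b) :
    (Glue.inA VA VB J).obj a ⟶ (Glue.inB VA VB J).obj b := j

/-- Images of the arrows of the glued quiver under the projection to `kQ_A`. -/
noncomputable def Glue.arrowA : ∀ x y : Glue VA VB J, (x ⟶ y) → PathAlgebra k VA
  | Glue.inl _, Glue.inl _, f => arrow k f
  | Glue.inr _, _, _ => 0
  | Glue.inl _, Glue.inr _, _ => 0

/-- Images of the arrows of the glued quiver under the projection to `kQ_B`. -/
noncomputable def Glue.arrowB : ∀ x y : Glue VA VB J, (x ⟶ y) → PathAlgebra k VB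
  | Glue.inr _, Glue.inr _, f => arrow k f
  | Glue.inl _, _, _ => 0
  | Glue.inr _, Glue.inl _, _ => 0

/-- Images of the vertices of the glued quiver under the projection to `kQ_A`. -/
noncomputable def Glue.vertexA : Glue VA VB J → PathAlgebra k VA
  | Glue.inl a => vertex k a
  | Glue.inr _ => 0

/-- Images of the vertices of the glued quiver under the projection to `kQ_B`. -/
noncomputable def Glue.vertexB : Glue VA VB J → PathAlgebra k VB
  | Glue.inl _ => 0
  | Glue.inr b => vertex k b

variable [Fintype VA] [Fintype VB]

variable (k VA VB J) in
/-- The algebra map `kQ_C → kQ_A` that kills the vertices of `Q_B` and the arrows outside `Q_A`. -/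
noncomputable def Glue.projA : PathAlgebra k (Glue VA VB J) →ₐ[k] PathAlgebra k VA :=
  lift Glue.vertexA Glue.arrowA
    (by
      rintro (a | b)
      · exact vertex_mul_ofPath _
      · exact mul_zero _)
    (by
      rintro (a | b) (a' | b') h
      · exact ofPath_mul_ofPath_of_ne _ _ (fun h' => h (by rw [h']))
      · exact mul_zero _
      · exact zero_mul _
      · exact mul_zero _)
    (by
      rw [← Equiv.sum_comp (Glue.equivSum VA VB J), Fintype.sum_sum_type]
      simp [Glue.vertexA, Glue.equivSum, one_def])
    (by
      rintro (a | b) (a' | b') g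
      · exact ofPath_mul_vertex _
      · exact mul_zero _
      · exact zero_mul _
      · exact mul_zero _)

variable (k VA VB J) in
/-- The algebra map `kQ_C → kQ_B` that kills the vertices of `Q_A` and the arrows outside `Q_B`. -/
noncomputable def Glue.projB : PathAlgebra k (Glue VA VB J) →ₐ[k] PathAlgebra k VB :=
  lift Glue.vertexB Glue.arrowB
    (by
      rintro (a | b)
      · exact mul_zero _
      · exact vertex_mul_ofPath _)
    (by
      rintro (a | b) (a' | b') h
      · exact mul_zero _
      · exact zero_mul _
      · exact mul_zero _
      · exact ofPath_mul_ofPath_of_ne _ _ (fun h' => h (by rw [h'])))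
    (by
      rw [← Equiv.sum_comp (Glue.equivSum VA VB J), Fintype.sum_sum_type]
      simp [Glue.vertexB, Glue.equivSum, one_def])
    (by
      rintro (a | b) (a' | b') g
      · exact mul_zero _
      · exact zero_mul _
      · exact mul_zero _
      · exact ofPath_mul_vertex _)

variable (k VA VB J) in
/-- The idempotent of the vertices of `Q_A` in `kQ_C`. -/
noncomputable def Glue.eA : PathAlgebra k (Glue VA VB J) :=
  PathAlgebra.map k (Glue.inA VA VB J) 1

variable (k VA VB J) in
/-- The idempotent of the vertices of `Q_B` in `kQ_C`. -/
noncomputable def Glue.eB : PathAlgebra k (Glue VA VB J) :=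
  PathAlgebra.map k (Glue.inB VA VB J) 1

theorem Glue.eA_eq :
    Glue.eA k VA VB J = ∑ a : VA, vertex k (V := Glue VA VB J) (Glue.inl a) := by
  rw [Glue.eA, one_def, map_sum]
  exact Finset.sum_congr rfl (fun a _ => map_ofPath _ _)

theorem Glue.eB_eq :
    Glue.eB k VA VB J = ∑ b : VB, vertex k (V := Glue VA VB J) (Glue.inr b) := by
  rw [Glue.eB, one_def, map_sum]
  exact Finset.sum_congr rfl (fun a _ => map_ofPath _ _)

theorem Glue.ofPath_mul_eA {x : Glue VA VB J} {a : VA} (p : Path x (Glue.inl a : Glue VA VB J)) :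
    ofPath k p * Glue.eA k VA VB J = ofPath k p := by
  rw [Glue.eA_eq, Finset.mul_sum, Finset.sum_eq_single a, ofPath_mul_vertex]
  · exact fun v _ hv => ofPath_mul_ofPath_of_ne _ _ (fun h => hv (Glue.inl_injective h))
  · simp

theorem Glue.ofPath_mul_eA' {x : Glue VA VB J} {b : VB} (p : Path x (Glue.inr b : Glue VA VB J)) :
    ofPath k p * Glue.eA k VA VB J = 0 := by
  rw [Glue.eA_eq, Finset.mul_sum]
  exact Finset.sum_eq_zero (fun v _ => ofPath_mul_ofPath_of_ne _ _ (fun h => by cases h))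

theorem Glue.ofPath_mul_eB {x : Glue VA VB J} {b : VB} (p : Path x (Glue.inr b : Glue VA VB J)) :
    ofPath k p * Glue.eB k VA VB J = ofPath k p := by
  rw [Glue.eB_eq, Finset.mul_sum, Finset.sum_eq_single b, ofPath_mul_vertex]
  · exact fun v _ hv => ofPath_mul_ofPath_of_ne _ _ (fun h => hv (Glue.inr_injective h))
  · simp

theorem Glue.ofPath_mul_eB' {x : Glue VA VB J} {a : VA} (p : Path x (Glue.inl a : Glue VA VB J)) :
    ofPath k p * Glue.eB k VA VB J = 0 := by
  rw [Glue.eB_eq, Finset.mul_sum]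
  exact Finset.sum_eq_zero (fun v _ => ofPath_mul_ofPath_of_ne _ _ (fun h => by cases h))

theorem Glue.eA_mul_vertex_inr (b : VB) :
    Glue.eA k VA VB J * vertex k (Glue.inr b : Glue VA VB J) = 0 := by
  rw [Glue.eA_eq, Finset.sum_mul]
  exact Finset.sum_eq_zero (fun v _ => ofPath_mul_ofPath_of_ne _ _ (fun h => by cases h))

theorem Glue.eA_mul_vertex_inl (a : VA) :
    Glue.eA k VA VB J * vertex k (Glue.inl a : Glue VA VB J) = vertex k (Glue.inl a : Glue VA VB J) := by
  rw [Glue.eA_eq, Finset.sum_mul, Finset.sum_eq_single a]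
  · exact ofPath_mul_vertex _
  · exact fun v _ hv => ofPath_mul_ofPath_of_ne _ _ (fun h => hv (Glue.inl_injective h).symm)
  · simp

theorem Glue.eB_mul_vertex_inr (b : VB) :
    Glue.eB k VA VB J * vertex k (Glue.inr b : Glue VA VB J) = vertex k (Glue.inr b : Glue VA VB J) := by
  rw [Glue.eB_eq, Finset.sum_mul, Finset.sum_eq_single b]
  · exact ofPath_mul_vertex _
  · exact fun v _ hv => ofPath_mul_ofPath_of_ne _ _ (fun h => hv (Glue.inr_injective h).symm)
  · simp

theorem ofPath_cons {V : Type u} [Quiver.{u} V] {a b c : V} (p : Path a b) (f : b ⟶ c) :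
    ofPath k (p.cons f) = ofPath k p * arrow k f := (ofPath_mul_ofPath p f.toPath).symm

/-- No path of the glued quiver leads from `Q_B` to `Q_A`. -/
theorem Glue.eB_mul_inl {x : Glue VA VB J} : ∀ {y : Glue VA VB J} (p : Path x y) (a : VA),
    y = Glue.inl a → Glue.eB k VA VB J * ofPath k p = 0
  | _, Path.nil, a, h => by
    subst h
    rw [Glue.eB_eq, Finset.sum_mul]
    exact Finset.sum_eq_zero (fun v _ => ofPath_mul_ofPath_of_ne _ _ (fun h => by cases h))
  | _, Path.cons (b := Glue.inl a') p f, a, h => by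
    rw [ofPath_cons, ← mul_assoc, Glue.eB_mul_inl p a' rfl, zero_mul]
  | _, Path.cons (b := Glue.inr b) p f, a, h => by
    subst h
    exact f.elim

theorem Glue.map_projA (x : PathAlgebra k (Glue VA VB J)) :
    PathAlgebra.map k (Glue.inA VA VB J) (Glue.projA k VA VB J x)
      = Glue.eA k VA VB J * x * Glue.eA k VA VB J := by
  refine path_induction (P := fun x => PathAlgebra.map k (Glue.inA VA VB J)
    (Glue.projA k VA VB J x) = Glue.eA k VA VB J * x * Glue.eA k VA VB J) (by simp)
    (fun x y h h' => by simp only [map_add, h, h', mul_add, add_mul]) (fun c x y p => ?_) x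
  rw [map_smul, map_smul, mul_smul_comm, smul_mul_assoc]
  congr 1
  induction p with
  | nil =>
    rw [Glue.projA, lift_ofPath]
    obtain a | b := x
    · rw [mul_assoc, Glue.ofPath_mul_eA]
      exact (map_ofPath _ _).trans (Glue.eA_mul_vertex_inl a).symm
    · rw [mul_assoc, Glue.ofPath_mul_eA', mul_zero]
      exact map_zero _
  | @cons y z p f ih =>
    have hp : Glue.projA k VA VB J (ofPath k (p.cons f))
        = Glue.projA k VA VB J (ofPath k p) * Glue.arrowA y z f := by
      rw [Glue.projA, lift_ofPath, lift_ofPath, evalPath]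
    rw [hp, map_mul_of_injective _ (Glue.inl_injective), ih]
    match y, z, f with
    | Glue.inl a, Glue.inl a', f =>
      rw [mul_assoc _ (ofPath k (p.cons f)), Glue.ofPath_mul_eA, mul_assoc _ (ofPath k p),
        Glue.ofPath_mul_eA, ofPath_cons, ← mul_assoc]
      congr 1
      exact map_ofPath _ _
    | Glue.inl a, Glue.inr b, f =>
      rw [mul_assoc _ (ofPath k (p.cons f)), Glue.ofPath_mul_eA', mul_zero]
      exact (congrArg _ (map_zero _)).trans (mul_zero _)
    | Glue.inr b, Glue.inr b', f =>
      rw [mul_assoc _ (ofPath k (p.cons f)), Glue.ofPath_mul_eA', mul_zero]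
      exact (congrArg _ (map_zero _)).trans (mul_zero _)

theorem Glue.map_projB (x : PathAlgebra k (Glue VA VB J)) :
    PathAlgebra.map k (Glue.inB VA VB J) (Glue.projB k VA VB J x)
      = Glue.eB k VA VB J * x * Glue.eB k VA VB J := by
  refine path_induction (P := fun x => PathAlgebra.map k (Glue.inB VA VB J)
    (Glue.projB k VA VB J x) = Glue.eB k VA VB J * x * Glue.eB k VA VB J) (by simp)
    (fun x y h h' => by simp only [map_add, h, h', mul_add, add_mul]) (fun c x y p => ?_) x
  rw [map_smul, map_smul, mul_smul_comm, smul_mul_assoc]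
  congr 1
  induction p with
  | nil =>
    rw [Glue.projB, lift_ofPath]
    obtain a | b := x
    · rw [mul_assoc, Glue.ofPath_mul_eB', mul_zero]
      exact map_zero _
    · rw [mul_assoc, Glue.ofPath_mul_eB]
      exact (map_ofPath _ _).trans (Glue.eB_mul_vertex_inr b).symm
  | @cons y z p f ih =>
    have hp : Glue.projB k VA VB J (ofPath k (p.cons f))
        = Glue.projB k VA VB J (ofPath k p) * Glue.arrowB y z f := by
      rw [Glue.projB, lift_ofPath, lift_ofPath, evalPath]
    rw [hp, map_mul_of_injective _ (Glue.inr_injective), ih]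
    match y, z, f with
    | Glue.inl a, Glue.inl a', f =>
      rw [mul_assoc _ (ofPath k (p.cons f)), Glue.ofPath_mul_eB', mul_zero]
      exact (congrArg _ (map_zero _)).trans (mul_zero _)
    | Glue.inl a, Glue.inr b, f =>
      rw [ofPath_cons, ← mul_assoc (Glue.eB k VA VB J), Glue.eB_mul_inl p a rfl]
      simp
    | Glue.inr b, Glue.inr b', f =>
      rw [mul_assoc _ (ofPath k (p.cons f)), Glue.ofPath_mul_eB, mul_assoc _ (ofPath k p),
        Glue.ofPath_mul_eB, ofPath_cons, ← mul_assoc]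
      congr 1
      exact map_ofPath _ _

/-- `C = kQ_C/I_C` is glued from `A = kQ_A/I_A` and `B = kQ_B/I_B`: the ideal `I_C` meets `kQ_A` in
`I_A` and `kQ_B` in `I_B` (so that `A = e_A C e_A` and `B = e_B C e_B` are the diagonal blocks of the
triangular matrix algebra `C`), and it contains all products `α α_j` with `α` an arrow of `Q_A`. -/
structure IsGluing (IA : Ideal (PathAlgebra k VA)) (IB : Ideal (PathAlgebra k VB))
    (IC : Ideal (PathAlgebra k (Glue VA VB J))) : Prop where
  map_A : ∀ x ∈ IA, PathAlgebra.map k (Glue.inA VA VB J) x ∈ IC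
  map_B : ∀ x ∈ IB, PathAlgebra.map k (Glue.inB VA VB J) x ∈ IC
  corner_A : ∀ x, PathAlgebra.map k (Glue.inA VA VB J) x ∈ IC → x ∈ IA
  corner_B : ∀ x, PathAlgebra.map k (Glue.inB VA VB J) x ∈ IC → x ∈ IB
  arrow_mul_cross : ∀ (a a' : VA) (b : VB) (α : a ⟶ a') (j : J a' b),
    arrow k ((Glue.inA VA VB J).map α) * arrow k (Glue.cross j) ∈ IC

variable {IA : Ideal (PathAlgebra k VA)} {IB : Ideal (PathAlgebra k VB)}
  {IC : Ideal (PathAlgebra k (Glue VA VB J))} [IA.IsTwoSided] [IB.IsTwoSided] [IC.IsTwoSided]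

/-- The projection `C → A`. -/
noncomputable def IsGluing.toA (h : IsGluing IA IB IC) :
    (PathAlgebra k (Glue VA VB J) ⧸ IC) →+* (PathAlgebra k VA ⧸ IA) :=
  Ideal.Quotient.lift IC
    ((Ideal.Quotient.mk IA).comp (Glue.projA k VA VB J : _ →+* PathAlgebra k VA)) (by
      intro x hx
      refine Ideal.Quotient.eq_zero_iff_mem.2 (h.corner_A _ ?_)
      refine (Glue.map_projA x).symm ▸ ?_
      exact IC.mul_mem_right _ (IC.mul_mem_left _ hx))

/-- The projection `C → B`. -/
noncomputable def IsGluing.toB (h : IsGluing IA IB IC) :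
    (PathAlgebra k (Glue VA VB J) ⧸ IC) →+* (PathAlgebra k VB ⧸ IB) :=
  Ideal.Quotient.lift IC
    ((Ideal.Quotient.mk IB).comp (Glue.projB k VA VB J : _ →+* PathAlgebra k VB)) (by
      intro x hx
      refine Ideal.Quotient.eq_zero_iff_mem.2 (h.corner_B _ ?_)
      refine (Glue.map_projB x).symm ▸ ?_
      exact IC.mul_mem_right _ (IC.mul_mem_left _ hx))

/-- The inclusion `B → C` (with `1` going to `e_B`). -/
noncomputable def IsGluing.ofB (h : IsGluing IA IB IC) :
    (PathAlgebra k VB ⧸ IB) →ₙ+* (PathAlgebra k (Glue VA VB J) ⧸ IC) :=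
  let F : (PathAlgebra k VB ⧸ IB) →+ (PathAlgebra k (Glue VA VB J) ⧸ IC) :=
    QuotientAddGroup.lift (Submodule.toAddSubgroup IB)
      (((Ideal.Quotient.mk IC : PathAlgebra k (Glue VA VB J) →+* _) :
        PathAlgebra k (Glue VA VB J) →+ (PathAlgebra k (Glue VA VB J) ⧸ IC)).comp
        (PathAlgebra.map k (Glue.inB VA VB J)).toAddMonoidHom)
      (fun x hx => Ideal.Quotient.eq_zero_iff_mem.2 (h.map_B x hx))
  { F with
    map_mul' := by
      intro x y
      obtain ⟨x, rfl⟩ := Ideal.Quotient.mk_surjective x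
      obtain ⟨y, rfl⟩ := Ideal.Quotient.mk_surjective y
      exact (congrArg (Ideal.Quotient.mk IC)
        (map_mul_of_injective (Glue.inB VA VB J) Glue.inr_injective x y)).trans (map_mul _ _ _)
    map_zero' := F.map_zero }

end

/-- The right `S`-module `M e`, for a right `T`-module `M` and a (non-unital) inclusion of rings
`j : S → T` with `j 1 = e`. -/
def cornerCarrier {S T : Type u} [Ring S] [Ring T] (j : S →ₙ+* T) (M : ModuleCat.{u} Tᵐᵒᵖ) :
    AddSubgroup M where
  carrier := {x | MulOpposite.op (j 1) • x = x}
  zero_mem' := smul_zero _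
  add_mem' {x y} hx hy := (smul_add _ x y).trans (congrArg₂ _ hx hy)
  neg_mem' {x} hx := (smul_neg _ x).trans (congrArg _ hx)

instance cornerModule {S T : Type u} [Ring S] [Ring T] (j : S →ₙ+* T) (M : ModuleCat.{u} Tᵐᵒᵖ) :
    Module Sᵐᵒᵖ (cornerCarrier j M) where
  smul s x := ⟨MulOpposite.op (j s.unop) • x.1, by
    show MulOpposite.op (j 1) • MulOpposite.op (j s.unop) • x.1 = _
    rw [smul_smul, ← MulOpposite.op_mul, ← map_mul, mul_one]⟩
  one_smul x := Subtype.ext x.2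
  mul_smul s t x := Subtype.ext (by
    show MulOpposite.op (j (s * t).unop) • x.1
      = MulOpposite.op (j s.unop) • MulOpposite.op (j t.unop) • x.1
    rw [smul_smul, ← MulOpposite.op_mul, ← map_mul, MulOpposite.unop_mul])
  smul_zero s := Subtype.ext (smul_zero _)
  smul_add s x y := Subtype.ext (smul_add _ _ _)
  add_smul s t x := Subtype.ext (by
    show MulOpposite.op (j (s + t).unop) • x.1
      = MulOpposite.op (j s.unop) • x.1 + MulOpposite.op (j t.unop) • x.1
    rw [← add_smul, ← MulOpposite.op_add, ← map_add, MulOpposite.unop_add])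
  zero_smul x := Subtype.ext (by
    show MulOpposite.op (j (0 : Sᵐᵒᵖ).unop) • x.1 = 0
    rw [MulOpposite.unop_zero, map_zero, MulOpposite.op_zero, zero_smul])

section

variable {k : Type u} [Field k] {VA VB : Type u} [Quiver.{u} VA] [Quiver.{u} VB] [Fintype VA]
  [Fintype VB] {J : VA → VB → Type u} {IA : Ideal (PathAlgebra k VA)}
  {IB : Ideal (PathAlgebra k VB)} {IC : Ideal (PathAlgebra k (Glue VA VB J))}
  [IA.IsTwoSided] [IB.IsTwoSided] [IC.IsTwoSided]

/-- An `A`-module as a `C`-module: its representation of `Q_A`, extended by zero. -/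
noncomputable def IsGluing.inflA (h : IsGluing IA IB IC)
    (N : ModuleCat.{u} (PathAlgebra k VA ⧸ IA)ᵐᵒᵖ) :
    ModuleCat.{u} (PathAlgebra k (Glue VA VB J) ⧸ IC)ᵐᵒᵖ :=
  (ModuleCat.restrictScalars (RingHom.op h.toA)).obj N

/-- A `B`-module as a `C`-module: its representation of `Q_B`, extended by zero. -/
noncomputable def IsGluing.inflB (h : IsGluing IA IB IC)
    (N : ModuleCat.{u} (PathAlgebra k VB ⧸ IB)ᵐᵒᵖ) :
    ModuleCat.{u} (PathAlgebra k (Glue VA VB J) ⧸ IC)ᵐᵒᵖ :=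
  (ModuleCat.restrictScalars (RingHom.op h.toB)).obj N

/-- `Π_B(M) = M e_B`: the restriction to `Q_B` of the representation `M`. -/
noncomputable def IsGluing.PiB (h : IsGluing IA IB IC)
    (M : ModuleCat.{u} (PathAlgebra k (Glue VA VB J) ⧸ IC)ᵐᵒᵖ) :
    ModuleCat.{u} (PathAlgebra k VB ⧸ IB)ᵐᵒᵖ :=
  ModuleCat.of _ (cornerCarrier h.ofB M)

/-- A class of `B`-modules as a class of `C`-modules, closed under isomorphisms. -/
def IsGluing.inflClassB (h : IsGluing IA IB IC)
    (𝒟 : ModuleCat.{u} (PathAlgebra k VB ⧸ IB)ᵐᵒᵖ → Prop)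
    (M : ModuleCat.{u} (PathAlgebra k (Glue VA VB J) ⧸ IC)ᵐᵒᵖ) : Prop :=
  ∃ N, 𝒟 N ∧ Nonempty (M ≃ₗ[(PathAlgebra k (Glue VA VB J) ⧸ IC)ᵐᵒᵖ] h.inflB N)

/-- The orbit `Orb_{Ω_B}(Π_B(Ω_C(C₀)))`, up to isomorphism. -/
def IsGluing.orbit (h : IsGluing IA IB IC)
    (X : ModuleCat.{u} (PathAlgebra k VB ⧸ IB)ᵐᵒᵖ) : Prop :=
  ∃ C₀ K, IsSumOfSimples C₀ ∧ IsSyzygy K C₀ ∧ Orb (h.PiB K) X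

/-- The subgroup `𝒪 = ⟨add Orb_{Ω_B}(Π_B(Ω_C(C₀)))⟩` of `K₀(C)`. -/
noncomputable def IsGluing.orbitGroup (h : IsGluing IA IB IC) :
    AddSubgroup (K0 (PathAlgebra k (Glue VA VB J) ⧸ IC)ᵐᵒᵖ) :=
  K0.span (h.inflClassB (addClass h.orbit))

/-- `O` is a system of representatives of the isomorphism classes in
`I = {O ∈ ind C : [O] ∈ 𝒪}`. -/
structure IsGluing.IsRepSystem (h : IsGluing IA IB IC) {m : ℕ}
    (O : Fin m → ModuleCat.{u} (PathAlgebra k (Glue VA VB J) ⧸ IC)ᵐᵒᵖ) : Prop where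
  mem : ∀ i, CategoryTheory.Indecomposable (O i) ∧ ∃ hf, K0.mk (O i) hf ∈ h.orbitGroup
  irredundant : ∀ i i', Nonempty (O i ≃ₗ[(PathAlgebra k (Glue VA VB J) ⧸ IC)ᵐᵒᵖ] O i') → i = i'
  complete : ∀ X, CategoryTheory.Indecomposable X → (∃ hf, K0.mk X hf ∈ h.orbitGroup) →
    ∃ i, Nonempty (X ≃ₗ[(PathAlgebra k (Glue VA VB J) ⧸ IC)ᵐᵒᵖ] O i)

/-- The module `V ⊕ W ⊕ A ⊕ (⨁ᵢ Oᵢ)` over `C`, for a `B`-module `V` and an `A`-module `W`. -/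
noncomputable def IsGluing.litModule (h : IsGluing IA IB IC)
    (V : ModuleCat.{u} (PathAlgebra k VB ⧸ IB)ᵐᵒᵖ) (W : ModuleCat.{u} (PathAlgebra k VA ⧸ IA)ᵐᵒᵖ)
    {m : ℕ} (O : Fin m → ModuleCat.{u} (PathAlgebra k (Glue VA VB J) ⧸ IC)ᵐᵒᵖ) :
    ModuleCat.{u} (PathAlgebra k (Glue VA VB J) ⧸ IC)ᵐᵒᵖ :=
  ModuleCat.of _ (h.inflB V × h.inflA W × h.inflA (ModuleCat.of _ (PathAlgebra k VA ⧸ IA)) ×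
    (∀ i, O i))

end

end Gluing

end LIT

/-!
# Gluing an Igusa-Todorov algebra to a Lat-Igusa-Todorov algebra

Write `C` as a triangular algebra with diagonal blocks `A` and `B`. The relations `α α_j ∈ I_C` say
that the radical of `C` annihilates the off-diagonal block. The syzygy `K = Ω_C(M)` of any module
lies in the radical of a projective module, so no new arrow acts on it, and `K` is the direct sum of
an `A`-module and a `B`-module. The `A`-module is `Ω_A(M_A)`, and the `B`-module is `Π_B(K)`
(`IsSplitTriangular.syzygy_equiv`).

If `M` is an `A`-module, its projective cover `P` satisfies `Π_B(Ω_C M) = Π_B(P) = Π_B(rad P)`, and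
`rad P` is the syzygy of the top of `P`, which is a sum of simple modules. So `Π_B(Ω_C M)` is a sum of
summands of `Π_B(Ω_C C₀)` (`IsSplitTriangular.addClass_corner_syzygy`). By induction `Ω_C^n` of an
`A`-module `X` is `Ω_A^n(X) ⊕ Z` with `Z` in the additive closure of the orbit of `Π_B(Ω_C C₀)`
(`IsSplitTriangular.exists_nthSyzygy_res`), while `Ω_C` and `Ω_B` agree on `B`-modules, as projective
`B`-modules are projective over `C`. Hence `Ω_C^{n+1}(M) ≅ Ω_A^n(X) ⊕ Z ⊕ Ω_B^n(Y)` with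
`X = Ω_A(M_A)` and `Y = Π_B(Ω_C M)`. The first and the last term have the exact sequences given by
the hypotheses on `A` and `B`, and the indecomposable summands of `Z` have their classes in `𝒪`, so
that `Z` is a sum of modules from `I` (`IsSplitTriangular.isLIT`).

The class `𝒟` remains a `0`-Igusa-Todorov subcategory over `C` because `K₀(B) → K₀(C)` commutes with
`Ω̄` and is injective: base change along `C → B` is a left inverse (`IsZeroIT.res`).

The set `I` is finite because, for `X` indecomposable and not projective, the multiplicity of `X` in a
module is additive and vanishes on projective modules, hence is a homomorphism on `K₀`
(`exists_multHom`). It is not zero on `[X]`, so if `[X]` lies in a finitely generated subgroup, then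
`X` is a summand of one of the finitely many modules that occur in the generators; the projective `X`
are summands of the algebra (`exists_bound_of_fg`). The multiplicity is defined as the dimension of
`Hom(X, M)` modulo the morphisms that do not split, so its additivity needs no uniqueness of
decompositions, only that `X` has a local endomorphism ring.
-/

namespace LIT

open CategoryTheory

/-! ### Direct summands and additive closures -/

section Summands

variable {R : Type u} [Ring R]

/-- A retract is a direct summand, with complement the kernel of the retraction. -/
theorem IsSummand.of_retract {X M : ModuleCat.{u} R} (i : X →ₗ[R] M) (r : M →ₗ[R] X)
    (h : ∀ x, r (i x) = x) : IsSummand X M := by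
  refine ⟨ModuleCat.of R (LinearMap.ker r), ⟨?_⟩⟩
  exact
    { toFun := fun x => i x.1 + x.2.1
      map_add' := fun x y => by
        show i (x.1 + y.1) + (x.2.1 + y.2.1) = _
        rw [map_add]; abel
      map_smul' := fun c x => by
        show i (c • x.1) + c • x.2.1 = c • (i x.1 + x.2.1)
        rw [map_smul, smul_add]
      invFun := fun m => (r m, ⟨m - i (r m), by simp [h]⟩)
      left_inv := fun x => by
        have hx : r x.2.1 = 0 := x.2.2
        refine Prod.ext ?_ (Subtype.ext ?_) <;> simp [h, hx]
      right_inv := fun m => by simp }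

theorem isSummand_iff {X M : ModuleCat.{u} R} :
    IsSummand X M ↔ ∃ (i : X →ₗ[R] M) (r : M →ₗ[R] X), ∀ x, r (i x) = x := by
  refine ⟨?_, fun ⟨i, r, h⟩ => .of_retract i r h⟩
  rintro ⟨Y, ⟨e⟩⟩
  exact ⟨e.toLinearMap ∘ₗ LinearMap.inl R X Y, LinearMap.fst R X Y ∘ₗ e.symm.toLinearMap,
    fun x => by simp⟩

theorem IsSummand.trans {X M N : ModuleCat.{u} R} (h : IsSummand X M) (h' : IsSummand M N) :
    IsSummand X N := by
  obtain ⟨i, r, hr⟩ := isSummand_iff.1 h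
  obtain ⟨i', r', hr'⟩ := isSummand_iff.1 h'
  exact .of_retract (i' ∘ₗ i) (r ∘ₗ r') fun x => by simp [hr, hr']

theorem IsSummand.of_equiv {X M : ModuleCat.{u} R} (e : X ≃ₗ[R] M) : IsSummand X M :=
  .of_retract e.toLinearMap e.symm.toLinearMap fun x => by simp

theorem IsSummand.refl (X : ModuleCat.{u} R) : IsSummand X X := .of_equiv (.refl R X)

theorem IsSummand.prod_left (X Y : ModuleCat.{u} R) : IsSummand X (ModuleCat.of R (X × Y)) :=
  ⟨Y, ⟨.refl R _⟩⟩

theorem IsSummand.prod_right (X Y : ModuleCat.{u} R) : IsSummand Y (ModuleCat.of R (X × Y)) :=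
  ⟨X, ⟨.prodComm R _ _⟩⟩

theorem IsSummand.pi {ι : Type} [DecidableEq ι] (S : ι → ModuleCat.{u} R) (i : ι) :
    IsSummand (S i) (ModuleCat.of R (∀ i, S i)) :=
  .of_retract (LinearMap.single R (fun i => S i) i) (LinearMap.proj i) fun x => by simp

theorem IsSummand.finite {X M : ModuleCat.{u} R} (h : IsSummand X M) [Module.Finite R M] :
    Module.Finite R X := by
  obtain ⟨i, r, hr⟩ := isSummand_iff.1 h
  exact Module.Finite.of_surjective r fun x => ⟨i x, hr x⟩

/-- The index type of the decomposition in `addClass` may be any finite type. -/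
theorem addClass_of_pi {𝒞 : ModuleCat.{u} R → Prop} {ι : Type} [Finite ι]
    (S : ι → ModuleCat.{u} R) (hS : ∀ i, ∃ M, 𝒞 M ∧ IsSummand (S i) M)
    {X : ModuleCat.{u} R} (e : X ≃ₗ[R] (∀ i, S i)) : addClass 𝒞 X := by
  obtain ⟨m, ⟨f⟩⟩ := Finite.exists_equiv_fin ι
  exact ⟨m, fun i => S (f.symm i), fun i => hS _,
    ⟨e.trans (LinearEquiv.piCongrLeft R (fun i => S i) f.symm).symm⟩⟩

theorem addClass.of_equiv {𝒞 : ModuleCat.{u} R → Prop} {X Y : ModuleCat.{u} R}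
    (h : addClass 𝒞 X) (e : Y ≃ₗ[R] X) : addClass 𝒞 Y := by
  obtain ⟨m, S, hS, ⟨f⟩⟩ := h
  exact ⟨m, S, hS, ⟨e.trans f⟩⟩

theorem addClass_of_subsingleton {𝒞 : ModuleCat.{u} R → Prop} {X : ModuleCat.{u} R}
    [Subsingleton X] : addClass 𝒞 X :=
  ⟨0, Fin.elim0, fun i => i.elim0, ⟨0⟩⟩

theorem addClass_of_isSummand {𝒞 : ModuleCat.{u} R → Prop} {X M : ModuleCat.{u} R} (hM : 𝒞 M)
    (h : IsSummand X M) : addClass 𝒞 X :=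
  ⟨1, fun _ => X, fun _ => ⟨M, hM, h⟩, ⟨(LinearEquiv.funUnique (Fin 1) R X).symm⟩⟩

theorem addClass.prod {𝒞 : ModuleCat.{u} R → Prop} {X Y : ModuleCat.{u} R}
    (hX : addClass 𝒞 X) (hY : addClass 𝒞 Y) : addClass 𝒞 (ModuleCat.of R (X × Y)) := by
  obtain ⟨m, S, hS, ⟨e⟩⟩ := hX
  obtain ⟨n, T, hT, ⟨f⟩⟩ := hY
  refine addClass_of_pi (ι := Fin m ⊕ Fin n) (Sum.elim S T) (by rintro (i | i) <;> simp [hS, hT]) ?_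
  exact (e.prodCongr f).trans
    (LinearEquiv.sumPiEquivProdPi R _ _ (fun i => (Sum.elim S T i : ModuleCat R))).symm

theorem addClass.mono {𝒞 𝒞' : ModuleCat.{u} R → Prop} {X : ModuleCat.{u} R}
    (hX : addClass 𝒞 X) (h : ∀ M, 𝒞 M → ∃ M', 𝒞' M' ∧ IsSummand M M') : addClass 𝒞' X := by
  obtain ⟨m, S, hS, e⟩ := hX
  refine ⟨m, S, fun i => ?_, e⟩
  obtain ⟨M, hM, hi⟩ := hS i
  obtain ⟨M', hM', hi'⟩ := h M hM
  exact ⟨M', hM', hi.trans hi'⟩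

theorem addClass.finite {𝒞 : ModuleCat.{u} R → Prop} (hf : ∀ M, 𝒞 M → Module.Finite R M)
    {X : ModuleCat.{u} R} (h : addClass 𝒞 X) : Module.Finite R X := by
  obtain ⟨m, S, hS, ⟨e⟩⟩ := h
  have : ∀ i, Module.Finite R (S i) := fun i => by
    obtain ⟨M, hM, hi⟩ := hS i
    have := hf M hM
    exact hi.finite
  exact Module.Finite.equiv e.symm

end Summands

/-! ### Projective covers and syzygies -/

section Covers

variable {R : Type u} [Ring R]

/-- In a finitely generated module, a submodule is superfluous exactly if it is contained in the
radical. -/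
theorem superfluous_iff_le_jacobson {P : Type u} [AddCommGroup P] [Module R P] [Module.Finite R P]
    (K : Submodule R P) : (∀ N : Submodule R P, N ⊔ K = ⊤ → N = ⊤) ↔ K ≤ Module.jacobson R P := by
  constructor
  · intro h
    refine le_sInf fun m (hm : IsCoatom m) => ?_
    by_contra hK
    exact hm.1 (h m (hm.2 _ (left_lt_sup.2 hK)))
  · intro h N hN
    by_contra hN'
    obtain ⟨m, hm, hNm⟩ := (eq_top_or_exists_le_coatom N).resolve_left hN'
    exact hm.1 (top_le_iff.1 (hN ▸ sup_le hNm (h.trans (sInf_le hm))))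

theorem isProjectiveCover_iff {P M : ModuleCat.{u} R} (f : P →ₗ[R] M) :
    IsProjectiveCover f ↔ Module.Finite R P ∧ Module.Projective R P ∧ Function.Surjective f ∧
      LinearMap.ker f ≤ Module.jacobson R P := by
  refine and_congr_right fun h => and_congr_right fun _ => and_congr_right fun _ => ?_
  exact superfluous_iff_le_jacobson _

theorem IsProjectiveCover.ker_le {P M : ModuleCat.{u} R} {f : P →ₗ[R] M}
    (h : IsProjectiveCover f) : LinearMap.ker f ≤ Module.jacobson R P :=
  ((isProjectiveCover_iff f).1 h).2.2.2

theorem IsProjectiveCover.comp_equiv {P M M' : ModuleCat.{u} R} {f : P →ₗ[R] M}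
    (h : IsProjectiveCover f) (e : M ≃ₗ[R] M') :
    IsProjectiveCover (M := M') (e.toLinearMap ∘ₗ f) := by
  obtain ⟨h₁, h₂, h₃, h₄⟩ := h
  exact ⟨h₁, h₂, e.surjective.comp h₃, by rwa [LinearEquiv.ker_comp]⟩

/-- Over an Artinian ring projective covers exist: among the submodules of a free module that
surject onto `M`, a minimal one is projective. -/
theorem exists_isProjectiveCover [IsArtinianRing R] (M : ModuleCat.{u} R) [Module.Finite R M] :
    ∃ (P : ModuleCat.{u} R) (f : P →ₗ[R] M), IsProjectiveCover f := by
  obtain ⟨m, f, hf⟩ := Module.Finite.exists_fin' R M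
  obtain ⟨N, hN, hmin⟩ := WellFounded.has_min
    (wellFounded_lt (α := Submodule R (Fin m → R)))
    {N | N ⊔ LinearMap.ker f = ⊤} ⟨⊤, by simp⟩
  have hN : N ⊔ LinearMap.ker f = ⊤ := hN
  have hmin' : ∀ N' ≤ N, N' ⊔ LinearMap.ker f = ⊤ → N' = N := fun N' h h' =>
    by_contra fun hne => hmin N' h' (lt_of_le_of_ne h hne)
  have surj : ∀ N' : Submodule R (Fin m → R),
      N' ⊔ LinearMap.ker f = ⊤ ↔ Function.Surjective (f.domRestrict N') := by
    intro N'
    constructor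
    · intro h y
      obtain ⟨x, rfl⟩ := hf y
      obtain ⟨a, ha, b, hb, hab⟩ := Submodule.mem_sup.1 (h ▸ Submodule.mem_top : x ∈ _)
      exact ⟨⟨a, ha⟩, by simp [← hab, LinearMap.mem_ker.1 hb]⟩
    · intro h
      refine eq_top_iff.2 fun x _ => ?_
      obtain ⟨a, ha⟩ := h (f x)
      refine Submodule.mem_sup.2 ⟨a, a.2, x - a, ?_, by abel⟩
      simpa [sub_eq_zero] using ha.symm
  obtain ⟨g, hg⟩ := Module.projective_lifting_property (f.domRestrict N) f ((surj N).1 hN)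
  have hg' : ∀ x, f (g x) = f x := fun x => LinearMap.congr_fun hg x
  -- The endomorphism `g` of `N` commutes with the surjection to `M`, so its image is `N`.
  have hgs : Function.Surjective (g.domRestrict N) := by
    have h₁ : (LinearMap.range (g.domRestrict N)).map N.subtype = N := by
      refine hmin' _ (Submodule.map_subtype_le _ _) ((surj _).2 fun y => ?_)
      obtain ⟨a, ha⟩ := (surj N).1 hN y
      refine ⟨⟨g a, ⟨g a, ⟨a, rfl⟩, rfl⟩⟩, ?_⟩
      exact (hg' a).trans ha
    intro y
    have hy : (y : Fin m → R) ∈ (LinearMap.range (g.domRestrict N)).map N.subtype := by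
      rw [h₁]; exact y.2
    obtain ⟨z, ⟨x, rfl⟩, hz⟩ := hy
    exact ⟨x, Subtype.ext hz⟩
  have : IsNoetherian R N := inferInstance
  let e : N ≃ₗ[R] N := LinearEquiv.ofBijective (g.domRestrict N)
    ⟨IsNoetherian.injective_of_surjective_endomorphism _ hgs, hgs⟩
  have hproj : Module.Projective R N := by
    refine Module.Projective.of_split N.subtype (e.symm.toLinearMap ∘ₗ g) ?_
    ext x : 1
    exact e.symm_apply_apply x
  refine ⟨ModuleCat.of R N, f.domRestrict N, inferInstanceAs (Module.Finite R N), hproj,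
    (surj N).1 hN, fun N' hN' => ?_⟩
  have h₂ : Submodule.map N.subtype N' = N := by
    refine hmin' _ (Submodule.map_subtype_le _ _) ((surj _).2 fun y => ?_)
    obtain ⟨a, ha⟩ := (surj N).1 hN y
    obtain ⟨b, hb, c, hc, hbc⟩ := Submodule.mem_sup.1 (hN' ▸ Submodule.mem_top : a ∈ _)
    refine ⟨⟨b, ⟨b, hb, rfl⟩⟩, ?_⟩
    rw [← ha, ← hbc, map_add, LinearMap.mem_ker.1 hc, add_zero]
    rfl
  refine eq_top_iff.2 fun x _ => ?_
  have hx : (x : Fin m → R) ∈ Submodule.map N.subtype N' := by rw [h₂]; exact x.2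
  obtain ⟨y, hy, hyx⟩ := hx
  rwa [← Subtype.ext hyx]

/-- Projective covers of isomorphic modules have isomorphic kernels. -/
theorem IsProjectiveCover.ker_equiv {P Q M : ModuleCat.{u} R} {f : P →ₗ[R] M} {g : Q →ₗ[R] M}
    (hf : IsProjectiveCover f) (hg : IsProjectiveCover g) :
    Nonempty (LinearMap.ker f ≃ₗ[R] LinearMap.ker g) := by
  obtain ⟨-, pP, sf, hf⟩ := hf
  obtain ⟨-, pQ, sg, hg⟩ := hg
  obtain ⟨a, ha⟩ := Module.projective_lifting_property g f sg
  have ha' : ∀ x, g (a x) = f x := fun x => LinearMap.congr_fun ha x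
  have hsurj : Function.Surjective a := by
    refine LinearMap.range_eq_top.1 (hg _ (eq_top_iff.2 fun x _ => ?_))
    obtain ⟨p, hp⟩ := sf (g x)
    refine Submodule.mem_sup.2 ⟨a p, ⟨p, rfl⟩, x - a p, ?_, by abel⟩
    simp [ha', hp]
  obtain ⟨b, hb⟩ := Module.projective_lifting_property a LinearMap.id hsurj
  have hb' : ∀ x, a (b x) = x := fun x => LinearMap.congr_fun hb x
  have hbs : LinearMap.range b = ⊤ := by
    refine hf _ (eq_top_iff.2 fun x _ => ?_)
    refine Submodule.mem_sup.2 ⟨b (a x), ⟨a x, rfl⟩, x - b (a x), ?_, by abel⟩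
    rw [LinearMap.mem_ker, map_sub, ← ha', ← ha', hb', sub_self]
  have hinj : Function.Injective a := by
    intro x y hxy
    obtain ⟨x, rfl⟩ := LinearMap.range_eq_top.1 hbs x
    obtain ⟨y, rfl⟩ := LinearMap.range_eq_top.1 hbs y
    rw [hb', hb'] at hxy
    rw [hxy]
  let e : P ≃ₗ[R] Q := LinearEquiv.ofBijective a ⟨hinj, hsurj⟩
  refine ⟨e.ofSubmodules _ _ ?_⟩
  ext x
  simp only [Submodule.mem_map, LinearMap.mem_ker]
  constructor
  · rintro ⟨y, hy, rfl⟩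
    exact (ha' y).trans hy
  · intro hx
    obtain ⟨y, rfl⟩ := hsurj x
    exact ⟨y, (ha' y).symm.trans hx, rfl⟩

theorem IsSyzygy.congr {K K' M M' : ModuleCat.{u} R} (h : IsSyzygy K M) (e : K' ≃ₗ[R] K)
    (e' : M ≃ₗ[R] M') : IsSyzygy K' M' := by
  obtain ⟨P, f, hf, ⟨i⟩⟩ := h
  exact ⟨P, e'.toLinearMap ∘ₗ f, hf.comp_equiv e',
    ⟨(e.trans i).trans (LinearEquiv.ofEq _ _ (LinearEquiv.ker_comp e' f).symm)⟩⟩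

theorem IsSyzygy.unique {K K' M M' : ModuleCat.{u} R} (h : IsSyzygy K M) (h' : IsSyzygy K' M')
    (e : M ≃ₗ[R] M') : Nonempty (K ≃ₗ[R] K') := by
  obtain ⟨P, f, hf, ⟨i⟩⟩ := h.congr (.refl R _) e
  obtain ⟨Q, g, hg, ⟨j⟩⟩ := h'
  obtain ⟨k⟩ := hf.ker_equiv hg
  exact ⟨(i.trans k).trans j.symm⟩

theorem exists_isSyzygy [IsArtinianRing R] (M : ModuleCat.{u} R) [Module.Finite R M] :
    ∃ K, IsSyzygy K M := by
  obtain ⟨P, f, h⟩ := exists_isProjectiveCover M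
  exact ⟨ModuleCat.of R (LinearMap.ker f), P, f, h, ⟨.refl R _⟩⟩

theorem IsSyzygy.finite [IsNoetherianRing R] {K M : ModuleCat.{u} R} (h : IsSyzygy K M) :
    Module.Finite R K := by
  obtain ⟨P, f, hf, ⟨i⟩⟩ := h
  have := finite_ker f hf.1
  exact Module.Finite.equiv i.symm

theorem IsSyzygy.pi {ι : Type} [Finite ι] {K M : ι → ModuleCat.{u} R}
    (h : ∀ i, IsSyzygy (K i) (M i)) :
    IsSyzygy (ModuleCat.of R (∀ i, K i)) (ModuleCat.of R (∀ i, M i)) := by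
  classical
  have := Fintype.ofFinite ι
  choose P f hf e using h
  have h₁ : ∀ i, Module.Finite R (P i) := fun i => (hf i).1
  have h₂ : ∀ i, Module.Projective R (P i) := fun i => (hf i).2.1
  let F : (∀ i, P i) →ₗ[R] (∀ i, M i) := LinearMap.pi fun i => f i ∘ₗ LinearMap.proj i
  have hF : ∀ x i, F x i = f i (x i) := fun x i => rfl
  have hk : ∀ x, F x = 0 ↔ ∀ i, f i (x i) = 0 := fun x => funext_iff
  have hproj : Module.Projective R (∀ i, P i) :=
    Module.Projective.of_equiv (DFinsupp.linearEquivFunOnFintype (R := R) (M := fun i => P i))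
  let E : (∀ i, LinearMap.ker (f i)) ≃ₗ[R] LinearMap.ker F :=
    { toFun := fun x => ⟨fun i => x i, (hk _).2 fun i => (x i).2⟩
      map_add' := fun _ _ => rfl
      map_smul' := fun _ _ => rfl
      invFun := fun x i => ⟨x.1 i, (hk _).1 x.2 i⟩
      left_inv := fun _ => rfl
      right_inv := fun _ => rfl }
  refine ⟨ModuleCat.of R (∀ i, P i), F, ?_,
    ⟨(LinearEquiv.piCongrRight fun i => (e i).some).trans E⟩⟩
  refine (isProjectiveCover_iff _).2 ⟨inferInstanceAs (Module.Finite R (∀ i, P i)), hproj, ?_, ?_⟩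
  · intro y
    choose x hx using fun i => (hf i).2.2.1 (y i)
    exact ⟨x, funext hx⟩
  · intro x hx
    have hx : ∀ i, f i (x i) = 0 := (hk x).1 hx
    have : x = ∑ i, LinearMap.single R (fun i => P i) i (x i) :=
      (Finset.univ_sum_single x).symm
    rw [this]
    refine Submodule.sum_mem _ fun i _ => ?_
    exact Module.map_jacobson_le (LinearMap.single R (fun i => P i) i)
      ⟨x i, (hf i).ker_le (hx i), rfl⟩

theorem IsSyzygy.prod {K K' M M' : ModuleCat.{u} R} (h : IsSyzygy K M) (h' : IsSyzygy K' M') :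
    IsSyzygy (ModuleCat.of R (K × K')) (ModuleCat.of R (M × M')) := by
  obtain ⟨P, f, hf, ⟨i⟩⟩ := h
  obtain ⟨Q, g, hg, ⟨j⟩⟩ := h'
  obtain ⟨h₁, h₂, h₃, -⟩ := id hf
  obtain ⟨h₁', h₂', h₃', -⟩ := id hg
  let F : (P × Q) →ₗ[R] (M × M') := f.prodMap g
  have hk : ∀ x, F x = 0 ↔ f x.1 = 0 ∧ g x.2 = 0 := fun x => Prod.ext_iff
  let E : (LinearMap.ker f × LinearMap.ker g) ≃ₗ[R] LinearMap.ker F :=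
    { toFun := fun x => ⟨(x.1.1, x.2.1), (hk _).2 ⟨x.1.2, x.2.2⟩⟩
      map_add' := fun _ _ => rfl
      map_smul' := fun _ _ => rfl
      invFun := fun x => (⟨x.1.1, ((hk _).1 x.2).1⟩, ⟨x.1.2, ((hk _).1 x.2).2⟩)
      left_inv := fun _ => rfl
      right_inv := fun _ => rfl }
  refine ⟨ModuleCat.of R (P × Q), F, ?_, ⟨(i.prodCongr j).trans E⟩⟩
  refine (isProjectiveCover_iff _).2 ⟨inferInstanceAs (Module.Finite R (P × Q)),
    inferInstanceAs (Module.Projective R (P × Q)), h₃.prodMap h₃', ?_⟩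
  intro x hx
  have hx := (hk x).1 hx
  have : x = LinearMap.inl R P Q x.1 + LinearMap.inr R P Q x.2 := by simp
  rw [this]
  exact Submodule.add_mem _ (Module.map_jacobson_le _ ⟨x.1, hf.ker_le hx.1, rfl⟩)
    (Module.map_jacobson_le _ ⟨x.2, hg.ker_le hx.2, rfl⟩)

theorem IsNthSyzygy.congr {n : ℕ} {K K' M M' : ModuleCat.{u} R} (h : IsNthSyzygy n K M)
    (e : K' ≃ₗ[R] K) (e' : M ≃ₗ[R] M') : IsNthSyzygy n K' M' := by
  induction n generalizing M M' with
  | zero =>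
    obtain ⟨f⟩ := h
    exact ⟨(e.trans f).trans e'⟩
  | succ n ih =>
    obtain ⟨L, hL, h⟩ := h
    exact ⟨L, hL.congr (.refl R _) e', ih h (.refl R _)⟩

theorem IsNthSyzygy.prod {n : ℕ} {K K' M M' : ModuleCat.{u} R} (h : IsNthSyzygy n K M)
    (h' : IsNthSyzygy n K' M') :
    IsNthSyzygy n (ModuleCat.of R (K × K')) (ModuleCat.of R (M × M')) := by
  induction n generalizing M M' with
  | zero =>
    obtain ⟨f⟩ := h
    obtain ⟨f'⟩ := h'
    exact ⟨f.prodCongr f'⟩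
  | succ n ih =>
    obtain ⟨L, hL, h⟩ := h
    obtain ⟨L', hL', h'⟩ := h'
    exact ⟨_, hL.prod hL', ih h h'⟩

theorem IsNthSyzygy.succ_right {n : ℕ} {K L M : ModuleCat.{u} R} (h : IsNthSyzygy n L M)
    (h' : IsSyzygy K L) : IsNthSyzygy (n + 1) K M := by
  induction n generalizing M with
  | zero => exact ⟨K, h'.congr (.refl R _) h.some, ⟨.refl R _⟩⟩
  | succ n ih =>
    obtain ⟨L', hL', h⟩ := h
    exact ⟨L', hL', ih h⟩

theorem IsNthSyzygy.finite [IsNoetherianRing R] {n : ℕ} {K M : ModuleCat.{u} R}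
    (h : IsNthSyzygy n K M) (hM : Module.Finite R M) : Module.Finite R K := by
  induction n generalizing M with
  | zero => exact Module.Finite.equiv h.some.symm
  | succ n ih =>
    obtain ⟨L, hL, h⟩ := h
    exact ih h hL.finite

theorem exists_isNthSyzygy [IsArtinianRing R] (n : ℕ) (M : ModuleCat.{u} R) [Module.Finite R M] :
    ∃ K, IsNthSyzygy n K M := by
  induction n generalizing M with
  | zero => exact ⟨M, ⟨.refl R _⟩⟩
  | succ n ih =>
    obtain ⟨L, hL⟩ := exists_isSyzygy M
    have := hL.finite
    obtain ⟨K, hK⟩ := ih L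
    exact ⟨K, L, hL, hK⟩

variable [IsArtinianRing R]

/-- The syzygy of a direct summand is a direct summand of the syzygy. -/
theorem IsSummand.syzygy {X M K L : ModuleCat.{u} R} (h : IsSummand X M) (hK : IsSyzygy K X)
    (hL : IsSyzygy L M) [Module.Finite R M] : IsSummand K L := by
  obtain ⟨Y, ⟨e⟩⟩ := h
  have : Module.Finite R Y :=
    Module.Finite.of_surjective (LinearMap.snd R X Y ∘ₗ e.symm.toLinearMap)
      (Prod.snd_surjective.comp e.symm.surjective)
  obtain ⟨K', hK'⟩ := exists_isSyzygy Y
  obtain ⟨f⟩ := (hK.prod hK').unique hL e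
  exact ⟨K', ⟨f⟩⟩

/-- If a class of finitely generated modules is closed under syzygies, so is its additive
closure. -/
theorem addClass.syzygy {𝒞 : ModuleCat.{u} R → Prop} (hf : ∀ M, 𝒞 M → Module.Finite R M)
    (hΩ : ∀ M K, 𝒞 M → IsSyzygy K M → 𝒞 K) {X K : ModuleCat.{u} R} (hX : addClass 𝒞 X)
    (hK : IsSyzygy K X) : addClass 𝒞 K := by
  obtain ⟨m, S, hS, ⟨e⟩⟩ := hX
  have key : ∀ i, ∃ L, IsSyzygy L (S i) ∧ ∃ M, 𝒞 M ∧ IsSummand L M := fun i => by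
    obtain ⟨M, hM, hi⟩ := hS i
    have := hf M hM
    have := hi.finite
    obtain ⟨L, hL⟩ := exists_isSyzygy (S i)
    obtain ⟨N, hN⟩ := exists_isSyzygy M
    exact ⟨L, hL, N, hΩ M N hM hN, hi.syzygy hL hN⟩
  choose L hL hLs using key
  obtain ⟨f⟩ := hK.unique (IsSyzygy.pi hL) e
  exact ⟨m, L, hLs, ⟨f⟩⟩

theorem addClass.nthSyzygy {𝒞 : ModuleCat.{u} R → Prop} (hf : ∀ M, 𝒞 M → Module.Finite R M)
    (hΩ : ∀ M K, 𝒞 M → IsSyzygy K M → 𝒞 K) {n : ℕ} {X K : ModuleCat.{u} R} (hX : addClass 𝒞 X)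
    (hK : IsNthSyzygy n K X) : addClass 𝒞 K := by
  induction n generalizing X with
  | zero => exact hX.of_equiv hK.some
  | succ n ih =>
    obtain ⟨L, hL, hK⟩ := hK
    exact ih (hX.syzygy hf hΩ hL) hK

end Covers

/-! ### Indecomposable modules -/

section Indecomposable

variable {R : Type u} [Ring R]

theorem indecomposable_iff {X : ModuleCat.{u} R} :
    Indecomposable X ↔ Nontrivial X ∧
      ∀ Y Z : ModuleCat.{u} R, Nonempty (X ≃ₗ[R] (Y × Z)) → Subsingleton Y ∨ Subsingleton Z := by
  simp only [Indecomposable, ModuleCat.isZero_iff_subsingleton, not_subsingleton_iff_nontrivial]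
  refine and_congr_right fun _ => ⟨fun h Y Z ⟨e⟩ => ?_, fun h Y Z e => ?_⟩
  · exact h Y Z ((e.toModuleIso (X₁ := X) (X₂ := ModuleCat.of R (Y × Z))).trans
      (ModuleCat.biprodIsoProd Y Z).symm)
  · exact h Y Z ⟨(e.trans (ModuleCat.biprodIsoProd Y Z)).toLinearEquiv⟩

theorem indecomposable_congr {X Y : ModuleCat.{u} R} (e : X ≃ₗ[R] Y) (h : Indecomposable X) :
    Indecomposable Y := by
  rw [indecomposable_iff] at h ⊢
  obtain ⟨h₁, h₂⟩ := h
  exact ⟨e.symm.nontrivial, fun A B ⟨f⟩ => h₂ A B ⟨e.trans f⟩⟩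

/-- A nonzero direct summand of an indecomposable module is the whole module. -/
theorem IsSummand.equiv_of_indecomposable {X Y : ModuleCat.{u} R} (h : IsSummand X Y)
    (hX : Indecomposable X) (hY : Indecomposable Y) : Nonempty (X ≃ₗ[R] Y) := by
  obtain ⟨Z, ⟨e⟩⟩ := h
  have := (indecomposable_iff.1 hX).1
  have hZ := ((indecomposable_iff.1 hY).2 X Z ⟨e.symm⟩).resolve_left
    (not_subsingleton_iff_nontrivial.2 this)
  have : Unique Z := uniqueOfSubsingleton 0
  exact ⟨(LinearEquiv.prodUnique (M₂ := Z)).symm.trans e⟩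

/-- A module of finite length is a finite direct sum of indecomposable modules. -/
theorem exists_indecomposable_decomposition (X : ModuleCat.{u} R) [IsNoetherian R X]
    [IsArtinian R X] : ∃ (ι : Type) (_ : Finite ι) (S : ι → ModuleCat.{u} R),
      (∀ i, Indecomposable (S i)) ∧ Nonempty (X ≃ₗ[R] (∀ i, S i)) := by
  obtain ⟨n, hn⟩ := ENat.ne_top_iff_exists.1 (Module.length_ne_top (R := R) (M := X))
  induction n using Nat.strong_induction_on generalizing X with
  | _ n ih =>
  by_cases hX : Indecomposable X
  · exact ⟨Unit, inferInstance, fun _ => X, fun _ => hX, ⟨(LinearEquiv.funUnique Unit R X).symm⟩⟩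
  by_cases h0 : Subsingleton X
  · exact ⟨Empty, inferInstance, Empty.elim, fun i => i.elim, ⟨0⟩⟩
  simp only [indecomposable_iff, ← not_subsingleton_iff_nontrivial, h0, not_false_eq_true,
    true_and] at hX
  push Not at hX
  obtain ⟨Y, Z, ⟨e⟩, hY, hZ⟩ := hX
  have : IsNoetherian R (Y × Z) := isNoetherian_of_linearEquiv e
  have : IsArtinian R (Y × Z) := e.isArtinian_iff.1 inferInstance
  have : IsNoetherian R Y :=
    isNoetherian_of_surjective (LinearMap.fst R Y Z) (LinearMap.range_eq_top.2 LinearMap.fst_surjective)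
  have : IsNoetherian R Z :=
    isNoetherian_of_surjective (LinearMap.snd R Y Z) (LinearMap.range_eq_top.2 LinearMap.snd_surjective)
  have : IsArtinian R Y :=
    isArtinian_of_surjective (Y × Z) (LinearMap.fst R Y Z) LinearMap.fst_surjective
  have : IsArtinian R Z :=
    isArtinian_of_surjective (Y × Z) (LinearMap.snd R Y Z) LinearMap.snd_surjective
  obtain ⟨a, ha⟩ := ENat.ne_top_iff_exists.1 (Module.length_ne_top (R := R) (M := Y))
  obtain ⟨b, hb⟩ := ENat.ne_top_iff_exists.1 (Module.length_ne_top (R := R) (M := Z))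
  have hpa : 0 < a := by
    have := Module.length_pos (R := R) (M := Y)
    rw [← ha] at this
    exact_mod_cast this
  have hpb : 0 < b := by
    have := Module.length_pos (R := R) (M := Z)
    rw [← hb] at this
    exact_mod_cast this
  have hab : n = a + b := by
    have h := e.length_eq
    rw [Module.length_prod, ← hn, ← ha, ← hb] at h
    exact_mod_cast h
  obtain ⟨ι, hι, S, hS, ⟨f⟩⟩ := ih a (by omega) Y ha
  obtain ⟨κ, hκ, T, hT, ⟨g⟩⟩ := ih b (by omega) Z hb
  refine ⟨ι ⊕ κ, inferInstance, Sum.elim S T, by rintro (i | i) <;> simp [hS, hT], ⟨?_⟩⟩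
  exact (e.trans (f.prodCongr g)).trans
    (LinearEquiv.sumPiEquivProdPi R _ _ (fun i => (Sum.elim S T i : ModuleCat R))).symm

/-- By Fitting's lemma, the endomorphism ring of an indecomposable module of finite length is
local. -/
theorem isLocalRing_end {X : ModuleCat.{u} R} [IsNoetherian R X] [IsArtinian R X]
    (h : Indecomposable X) : IsLocalRing (Module.End R X) := by
  rw [indecomposable_iff] at h
  obtain ⟨h₁, h₂⟩ := h
  refine IsLocalRing.of_isUnit_or_isUnit_one_sub_self fun f => ?_
  obtain ⟨n, hn⟩ := Filter.eventually_atTop.1 f.eventually_isCompl_ker_pow_range_pow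
  have hc := hn (n + 1) (by omega)
  have e := Submodule.prodEquivOfIsCompl _ _ hc
  obtain hk | hr := h₂ (ModuleCat.of R (LinearMap.ker (f ^ (n + 1))))
    (ModuleCat.of R (LinearMap.range (f ^ (n + 1)))) ⟨e.symm⟩
  · left
    have hker : LinearMap.ker (f ^ (n + 1)) = ⊥ := (Submodule.subsingleton_iff_eq_bot).1 hk
    have hinj : Function.Injective f := by
      have := LinearMap.ker_eq_bot.1 hker
      rw [pow_succ] at this
      exact Function.Injective.of_comp this
    exact (Module.End.isUnit_iff f).2 ⟨hinj, IsArtinian.surjective_of_injective_endomorphism f hinj⟩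
  · right
    have hrange : LinearMap.range (f ^ (n + 1)) = ⊥ := (Submodule.subsingleton_iff_eq_bot).1 hr
    exact IsNilpotent.isUnit_one_sub ⟨n + 1, LinearMap.range_eq_bot.1 hrange⟩

theorem exists_isUnit_of_sum {E : Type*} [Semiring E] [IsLocalRing E] {ι : Type*} (s : Finset ι)
    (a : ι → E) (h : IsUnit (∑ i ∈ s, a i)) : ∃ i ∈ s, IsUnit (a i) := by
  classical
  induction s using Finset.induction_on with
  | empty => simp at h
  | insert j s hj ih =>
    rw [Finset.sum_insert hj] at h
    obtain h | h := IsLocalRing.isUnit_or_isUnit_of_isUnit_add h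
    · exact ⟨j, by simp, h⟩
    · obtain ⟨i, hi, h⟩ := ih h
      exact ⟨i, by simp [hi], h⟩

theorem isSummand_of_isUnit {X M : ModuleCat.{u} R} (f : X →ₗ[R] M) (g : M →ₗ[R] X)
    (h : IsUnit (g ∘ₗ f : Module.End R X)) : IsSummand X M := by
  obtain ⟨v, hv⟩ := h.exists_left_inv
  exact .of_retract f (v ∘ₗ g) fun x => LinearMap.congr_fun hv x

/-- A module with local endomorphism ring that is a summand of a finite direct sum is a summand of
one of the terms. -/
theorem IsSummand.of_pi {X : ModuleCat.{u} R} [IsLocalRing (Module.End R X)] {ι : Type} [Finite ι]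
    {S : ι → ModuleCat.{u} R} (h : IsSummand X (ModuleCat.of R (∀ i, S i))) :
    ∃ i, IsSummand X (S i) := by
  classical
  have := Fintype.ofFinite ι
  obtain ⟨f, g, hgf⟩ := isSummand_iff.1 h
  let F : X →ₗ[R] (∀ i, S i) := f
  let G : (∀ i, S i) →ₗ[R] X := g
  let a : ι → Module.End R X := fun i =>
    (G ∘ₗ LinearMap.single R (fun i => S i) i) ∘ₗ (LinearMap.proj i ∘ₗ F)
  have ha : ∑ i, a i = 1 := by
    ext x
    have : F x = ∑ i, LinearMap.single R (fun i => S i) i (F x i) :=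
      (Finset.univ_sum_single (F x)).symm
    rw [LinearMap.sum_apply, Module.End.one_apply]
    conv_rhs => rw [← hgf x, show g (f x) = G (F x) from rfl, this, map_sum]
    rfl
  obtain ⟨i, -, hi⟩ := exists_isUnit_of_sum Finset.univ a (ha ▸ isUnit_one)
  exact ⟨i, isSummand_of_isUnit _ _ hi⟩

/-- A predicate on modules satisfied by finitely many isomorphism classes has a finite irredundant
system of representatives. -/
theorem exists_irredundant_system (p : ModuleCat.{u} R → Prop)
    (hp : ∀ X Y : ModuleCat.{u} R, Nonempty (X ≃ₗ[R] Y) → p X → p Y) {ι : Type} [Finite ι]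
    (S : ι → ModuleCat.{u} R) (hS : ∀ X : ModuleCat.{u} R, p X → ∃ i, Nonempty (X ≃ₗ[R] S i)) :
    ∃ (m : ℕ) (O : Fin m → ModuleCat.{u} R), (∀ i, p (O i)) ∧
      (∀ i j, Nonempty (O i ≃ₗ[R] O j) → i = j) ∧ ∀ X, p X → ∃ i, Nonempty (X ≃ₗ[R] O i) := by
  let s : Setoid {i // p (S i)} :=
    { r := fun i j => Nonempty (S i ≃ₗ[R] S j)
      iseqv := ⟨fun _ => ⟨.refl R _⟩, fun ⟨e⟩ => ⟨e.symm⟩, fun ⟨e⟩ ⟨f⟩ => ⟨e.trans f⟩⟩ }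
  obtain ⟨m, ⟨f⟩⟩ := Finite.exists_equiv_fin (Quotient s)
  refine ⟨m, fun i => S (f.symm i).out.1, fun i => (f.symm i).out.2, fun i j hij => ?_,
    fun X hX => ?_⟩
  · exact f.symm.injective (Quotient.out_equiv_out.1 hij)
  · obtain ⟨i, ⟨e⟩⟩ := hS X hX
    let q : Quotient s := Quotient.mk s ⟨i, hp X _ ⟨e⟩ hX⟩
    obtain ⟨e'⟩ : Nonempty (S i ≃ₗ[R] S q.out.1) :=
      (Quotient.mk_out (s := s) (⟨i, hp X _ ⟨e⟩ hX⟩ : {i // p (S i)})).elim fun e => ⟨e.symm⟩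
    have e'' : S i ≃ₗ[R] S (f.symm (f q)).out.1 := by
      rw [f.symm_apply_apply]
      exact e'
    exact ⟨f q, ⟨e.trans e''⟩⟩

end Indecomposable

/-! ### Multiplicities of indecomposable modules -/

section Multiplicity

open scoped ModuleCat

variable (k : Type u) [Field k] {R : Type u} [Ring R] [Algebra k R]

/-- The morphisms `X → M` no composite of which with a morphism `M → X` is invertible; `X` has a
local endomorphism ring. -/
def radHom (X M : ModuleCat.{u} R) [IsLocalRing (Module.End R X)] : Submodule k (X →ₗ[R] M) where
  carrier := {f | ∀ g : M →ₗ[R] X, ¬ IsUnit (g ∘ₗ f : Module.End R X)}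
  zero_mem' g h := by
    rw [LinearMap.comp_zero] at h
    exact not_isUnit_zero h
  add_mem' {f f'} hf hf' g h := by
    rw [LinearMap.comp_add] at h
    exact (IsLocalRing.isUnit_or_isUnit_of_isUnit_add h).elim (hf g) (hf' g)
  smul_mem' c f hf g h := by
    refine hf (c • g) ?_
    convert h using 1
    ext x
    simp only [LinearMap.comp_apply, LinearMap.smul_apply]
    exact (LinearMap.map_smul_of_tower g c (f x)).symm

/-- The multiplicity of `X` in `M`, up to the constant factor `dim End(X)/rad End(X)`. -/
noncomputable def mult (X M : ModuleCat.{u} R) [IsLocalRing (Module.End R X)] : ℕ :=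
  Module.finrank k ((X →ₗ[R] M) ⧸ radHom k X M)

variable {k} [Module.Finite k R]

theorem finite_hom (X M : ModuleCat.{u} R) [Module.Finite R X] [Module.Finite R M] :
    Module.Finite k (X →ₗ[R] M) := by
  obtain ⟨n, p, hp⟩ := Module.Finite.exists_fin' R X
  have : Module.Finite k M := Module.Finite.trans R M
  let F : (X →ₗ[R] M) →ₗ[k] (Fin n → M) :=
    { toFun := fun f i => f (p (Pi.single i 1))
      map_add' := fun _ _ => rfl
      map_smul' := fun _ _ => rfl }
  refine Module.Finite.of_injective F fun f g hfg => ?_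
  have : f ∘ₗ p = g ∘ₗ p := by
    refine LinearMap.pi_ext' fun i => LinearMap.ext_ring ?_
    exact congrFun hfg i
  exact LinearMap.ext fun x => by
    obtain ⟨y, rfl⟩ := hp x
    exact LinearMap.congr_fun this y

theorem mult_add {X M M' M'' : ModuleCat.{u} R} [IsLocalRing (Module.End R X)]
    [Module.Finite R X] [Module.Finite R M'] [Module.Finite R M''] (e : M ≃ₗ[R] (M' × M'')) :
    mult k X M = mult k X M' + mult k X M'' := by
  have := finite_hom (k := k) X M'
  have := finite_hom (k := k) X M''
  let p' : M →ₗ[R] M' := LinearMap.fst R M' M'' ∘ₗ e.toLinearMap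
  let p'' : M →ₗ[R] M'' := LinearMap.snd R M' M'' ∘ₗ e.toLinearMap
  let i' : M' →ₗ[R] M := e.symm.toLinearMap ∘ₗ LinearMap.inl R M' M''
  let i'' : M'' →ₗ[R] M := e.symm.toLinearMap ∘ₗ LinearMap.inr R M' M''
  have hsum : ∀ m, i' (p' m) + i'' (p'' m) = m := fun m => by
    simp only [i', i'', p', p'', LinearMap.comp_apply, ← map_add]
    simp
  have h₁ : ∀ m, p' (i' m) = m := fun m => by simp [i', p']
  have h₂ : ∀ m, p'' (i'' m) = m := fun m => by simp [i'', p'']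
  have h₃ : ∀ m, p' (i'' m) = 0 := fun m => by simp [i'', p']
  have h₄ : ∀ m, p'' (i' m) = 0 := fun m => by simp [i', p'']
  let F : (X →ₗ[R] M) →ₗ[k] (((X →ₗ[R] M') ⧸ radHom k X M') × ((X →ₗ[R] M'') ⧸ radHom k X M'')) :=
    { toFun := fun f => (Submodule.Quotient.mk (p' ∘ₗ f), Submodule.Quotient.mk (p'' ∘ₗ f))
      map_add' := fun f g => by
        rw [LinearMap.comp_add, LinearMap.comp_add]
        rfl
      map_smul' := fun c f => by
        have h : ∀ {N : ModuleCat.{u} R} (p : M →ₗ[R] N), p ∘ₗ (c • f) = c • (p ∘ₗ f) :=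
          fun p => LinearMap.ext fun x => LinearMap.map_smul_of_tower p c (f x)
        rw [h, h]
        rfl }
  have hF : Function.Surjective F := by
    rintro ⟨a, b⟩
    obtain ⟨a, rfl⟩ := Submodule.Quotient.mk_surjective _ a
    obtain ⟨b, rfl⟩ := Submodule.Quotient.mk_surjective _ b
    refine ⟨i' ∘ₗ a + i'' ∘ₗ b, Prod.ext ?_ ?_⟩
    · exact congrArg (Submodule.Quotient.mk (p := radHom k X M'))
        (LinearMap.ext fun x => by simp [h₁, h₃])
    · exact congrArg (Submodule.Quotient.mk (p := radHom k X M''))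
        (LinearMap.ext fun x => by simp [h₂, h₄])
  have hker : LinearMap.ker F = radHom k X M := by
    ext f
    rw [LinearMap.mem_ker]
    refine Prod.ext_iff.trans ?_
    refine (and_congr (Submodule.Quotient.mk_eq_zero _) (Submodule.Quotient.mk_eq_zero _)).trans ?_
    constructor
    · rintro ⟨hf', hf''⟩ g hg
      have : (g ∘ₗ f : Module.End R X)
          = (g ∘ₗ i') ∘ₗ (p' ∘ₗ f) + (g ∘ₗ i'') ∘ₗ (p'' ∘ₗ f) := by
        ext x
        simp only [LinearMap.comp_apply, LinearMap.add_apply, ← map_add, hsum]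
      rw [this] at hg
      exact (IsLocalRing.isUnit_or_isUnit_of_isUnit_add hg).elim (hf' _) (hf'' _)
    · exact fun hf => ⟨fun g hg => hf (g ∘ₗ p') hg, fun g hg => hf (g ∘ₗ p'') hg⟩
  rw [mult, ← hker, (F.quotKerEquivOfSurjective hF).finrank_eq, Module.finrank_prod]
  rfl

theorem mult_eq_zero_iff {X M : ModuleCat.{u} R} [IsLocalRing (Module.End R X)]
    [Module.Finite R X] [Module.Finite R M] : mult k X M = 0 ↔ ¬ IsSummand X M := by
  have := finite_hom (k := k) X M
  rw [mult, Module.finrank_zero_iff, Submodule.Quotient.subsingleton_iff]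
  constructor
  · intro h hs
    obtain ⟨i, r, hir⟩ := isSummand_iff.1 hs
    have hi : i ∈ radHom k X M := h ▸ Submodule.mem_top
    refine hi r ?_
    rw [show (r ∘ₗ i : Module.End R X) = 1 from LinearMap.ext hir]
    exact isUnit_one
  · intro h
    exact eq_top_iff.2 fun f _ g hg => h (isSummand_of_isUnit f g hg)

/-- For a non-projective module `X` with local endomorphism ring, the multiplicity of `X` is a
homomorphism on `K₀`. -/
theorem exists_multHom (X : ModuleCat.{u} R) [IsLocalRing (Module.End R X)] [Module.Finite R X]
    (hX : ¬ Module.Projective R X) :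
    ∃ μ : K0 R →+ ℤ, ∀ (M : ModuleCat.{u} R) (hM : Module.Finite R M), μ (K0.mk M hM) = mult k X M := by
  refine ⟨QuotientAddGroup.lift _
    (FreeAbelianGroup.lift fun M : FGMod R => (mult k X M.1 : ℤ)) ?_, fun M hM => ?_⟩
  · rw [AddSubgroup.closure_le]
    intro x hx
    rw [SetLike.mem_coe, AddMonoidHom.mem_ker]
    cases hx with
    | sum M M' M'' e =>
      have := M'.2
      have := M''.2
      simp only [map_sub, FreeAbelianGroup.lift_apply_of]
      rw [mult_add e]
      push_cast
      ring
    | proj P h =>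
      have := P.2
      rw [FreeAbelianGroup.lift_apply_of, Nat.cast_eq_zero, mult_eq_zero_iff]
      intro hs
      obtain ⟨i, r, hir⟩ := isSummand_iff.1 hs
      exact hX (Module.Projective.of_split i r (LinearMap.ext hir))
  · exact FreeAbelianGroup.lift_apply_of _ _

end Multiplicity

/-! ### Indecomposable modules with class in a finitely generated subgroup -/

section FinitelyGenerated

variable {R : Type u} [Ring R]

/-- For every class `x` in `K₀` there is a module `N` such that a module `X` is a summand of `N`
whenever some homomorphism `μ` on `K₀` detects it: `μ x ≠ 0`, and `μ [M] ≠ 0` only if `X` is a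
summand of `M`. In the application `μ` is the multiplicity of `X`. -/
theorem exists_bound_of_class (x : K0 R) :
    ∃ N : ModuleCat.{u} R, Module.Finite R N ∧ ∀ (μ : K0 R →+ ℤ), μ x ≠ 0 →
      ∀ X : ModuleCat.{u} R, (∀ (M : ModuleCat.{u} R) (hM : Module.Finite R M), μ (K0.mk M hM) ≠ 0 → IsSummand X M) →
        IsSummand X N := by
  obtain ⟨x, rfl⟩ := QuotientAddGroup.mk_surjective x
  induction x using FreeAbelianGroup.induction_on with
  | zero =>
    exact ⟨ModuleCat.of R PUnit.{u + 1}, inferInstanceAs (Module.Finite R PUnit.{u + 1}), fun μ hμ =>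
      absurd (map_zero μ) hμ⟩
  | of M => exact ⟨M.1, M.2, fun μ hμ X h => h M.1 M.2 hμ⟩
  | neg M ih =>
    obtain ⟨N, hN, h⟩ := ih
    refine ⟨N, hN, fun μ hμ => h μ ?_⟩
    rwa [QuotientAddGroup.mk_neg, map_neg, neg_ne_zero] at hμ
  | add x y hx hy =>
    obtain ⟨N, hN, h⟩ := hx
    obtain ⟨N', hN', h'⟩ := hy
    refine ⟨ModuleCat.of R (N × N'), inferInstanceAs (Module.Finite R (N × N')),
      fun μ hμ X hX => ?_⟩
    rw [QuotientAddGroup.mk_add, map_add] at hμ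
    by_cases h0 : μ (QuotientAddGroup.mk x) = 0
    · rw [h0, zero_add] at hμ
      exact (h' μ hμ X hX).trans (.prod_right N N')
    · exact (h μ h0 X hX).trans (.prod_left N N')

/-- If a subgroup of `K₀` is finitely generated, all indecomposable modules whose class lies in it
are summands of one module. -/
theorem exists_bound_of_fg (k : Type u) [Field k] [Algebra k R] [Module.Finite k R]
    {H : AddSubgroup (K0 R)} (hH : H.FG) :
    ∃ N : ModuleCat.{u} R, Module.Finite R N ∧ ∀ X : ModuleCat.{u} R, Indecomposable X →
      (∃ hf, K0.mk X hf ∈ H) → IsSummand X N := by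
  have : IsArtinianRing R := .of_finite k R
  obtain ⟨s, rfl⟩ := hH
  choose N hN h using exists_bound_of_class (R := R)
  obtain ⟨m, ⟨f⟩⟩ := Finite.exists_equiv_fin s
  let N' : Fin m → ModuleCat.{u} R := fun i => N (f.symm i)
  have hN' : ∀ i, Module.Finite R (N' i) := fun i => hN _
  refine ⟨ModuleCat.of R ((∀ i, N' i) × R), inferInstanceAs (Module.Finite R ((∀ i, N' i) × R)),
    fun X hX ⟨hf, hXs⟩ => ?_⟩
  have : IsArtinian R X := isArtinian_of_fg_of_artinian' 
  have := isLocalRing_end hX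
  by_cases hP : Module.Projective R X
  · -- a projective indecomposable module is a summand of `R`
    refine IsSummand.trans ?_ (.prod_right (ModuleCat.of R (∀ i, N' i)) (ModuleCat.of R R))
    obtain ⟨n, p, hp⟩ := Module.Finite.exists_fin' R X
    obtain ⟨g, hg⟩ := Module.projective_lifting_property p LinearMap.id hp
    have : IsSummand X (ModuleCat.of R (∀ i : Fin n, ModuleCat.of R R)) :=
      .of_retract g p (LinearMap.congr_fun hg)
    exact this.of_pi.choose_spec
  · obtain ⟨μ, hμ⟩ := exists_multHom (k := k) X hP
    have hμX : μ (K0.mk X hf) ≠ 0 := by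
      rw [hμ, Nat.cast_ne_zero, Ne, mult_eq_zero_iff, not_not]
      exact .refl X
    obtain ⟨x, hx, hx0⟩ : ∃ x ∈ s, μ x ≠ 0 := by
      by_contra! hcon
      exact hμX ((AddSubgroup.closure_le μ.ker).2 hcon hXs)
    refine (h x μ hx0 X fun M hM hM0 => ?_).trans
      ((?_ : IsSummand _ (ModuleCat.of R (∀ i, N' i))).trans (.prod_left _ (ModuleCat.of R R)))
    · rw [hμ, Nat.cast_ne_zero, Ne, mult_eq_zero_iff, not_not] at hM0
      exact hM0
    · have := IsSummand.pi N' (f ⟨x, hx⟩)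
      simpa only [N', Equiv.symm_apply_apply] using this

/-- Only finitely many isomorphism classes of indecomposable modules have their class in a given
finitely generated subgroup of `K₀`. -/
theorem exists_finite_system_of_fg (k : Type u) [Field k] [Algebra k R] [Module.Finite k R]
    {H : AddSubgroup (K0 R)} (hH : H.FG) :
    ∃ (m : ℕ) (O : Fin m → ModuleCat.{u} R),
      (∀ i, Indecomposable (O i) ∧ ∃ hf, K0.mk (O i) hf ∈ H) ∧
      (∀ i j, Nonempty (O i ≃ₗ[R] O j) → i = j) ∧
      ∀ X, Indecomposable X → (∃ hf, K0.mk X hf ∈ H) → ∃ i, Nonempty (X ≃ₗ[R] O i) := by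
  have : IsArtinianRing R := .of_finite k R
  obtain ⟨N, hN, h⟩ := exists_bound_of_fg k hH
  have : IsArtinian R N := isArtinian_of_fg_of_artinian'
  obtain ⟨ι, _, S, hS, ⟨e⟩⟩ := exists_indecomposable_decomposition N
  obtain ⟨m, O, h₁, h₂, h₃⟩ := exists_irredundant_system
    (fun X => Indecomposable X ∧ ∃ hf, K0.mk X hf ∈ H)
    (by
      rintro X Y ⟨e⟩ ⟨h₁, hf, h₂⟩
      have hf' := Module.Finite.equiv e
      exact ⟨indecomposable_congr e h₁, hf', (K0.mk_congr hf hf' e) ▸ h₂⟩) S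
    (by
      rintro X ⟨h₁, hf, h₂⟩
      have : IsArtinian R X := isArtinian_of_fg_of_artinian'
      have := isLocalRing_end h₁
      obtain ⟨i, hi⟩ := ((h X h₁ ⟨hf, h₂⟩).trans
        (.of_equiv (M := ModuleCat.of R (∀ i, S i)) e)).of_pi
      exact ⟨i, hi.equiv_of_indecomposable h₁ (hS i)⟩)
  exact ⟨m, O, h₁, h₂, fun X hX hf => h₃ X ⟨hX, hf⟩⟩

end FinitelyGenerated

/-! ### Change of rings along a surjection -/

section ChangeOfRings

variable {R S : Type u} [Ring R] [Ring S] (φ : R →+* S)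

/-- An `S`-module as an `R`-module, along `φ : R → S`. -/
noncomputable abbrev res (N : ModuleCat.{u} S) : ModuleCat.{u} R :=
  (ModuleCat.restrictScalars φ).obj N

/-- The identity of `N`, as a semilinear map. -/
noncomputable def resMap (N : ModuleCat.{u} S) : res φ N →ₛₗ[φ] N where
  toFun x := x
  map_add' _ _ := rfl
  map_smul' _ _ := rfl

theorem resMap_bijective (N : ModuleCat.{u} S) : Function.Bijective (resMap φ N) :=
  Function.bijective_id

/-- A semilinear map to `N` as a linear map to `res φ N`. -/
noncomputable def toRes {M : ModuleCat.{u} R} {N : ModuleCat.{u} S} (q : M →ₛₗ[φ] N) : M →ₗ[R] res φ N where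
  toFun x := q x
  map_add' := q.map_add
  map_smul' := q.map_smulₛₗ

/-- An `S`-linear map as an `R`-linear map. -/
noncomputable def resHom {N N' : ModuleCat.{u} S} (f : N →ₗ[S] N') : res φ N →ₗ[R] res φ N' :=
  toRes φ (f.comp (resMap φ N))

variable {φ}

theorem res_smul_eq_zero {N : ModuleCat.{u} S} {r : R} (hr : φ r = 0) (x : res φ N) : r • x = 0 :=
  (congrArg (· • resMap φ N x) hr).trans (zero_smul S _)

/-- A bijective semilinear map identifies its source with the restriction of its target. -/
noncomputable def equivRes {M : ModuleCat.{u} R} {N : ModuleCat.{u} S} (q : M →ₛₗ[φ] N)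
    (hq : Function.Bijective q) : M ≃ₗ[R] res φ N :=
  LinearEquiv.ofBijective (toRes φ q) hq

theorem res_congr {N N' : ModuleCat.{u} S} (e : N ≃ₗ[S] N') :
    Nonempty (res φ N ≃ₗ[R] res φ N') :=
  ⟨LinearEquiv.ofBijective (resHom φ e.toLinearMap) e.bijective⟩

theorem res_prod (N N' : ModuleCat.{u} S) :
    Nonempty (res φ (ModuleCat.of S (N × N')) ≃ₗ[R] (res φ N × res φ N')) :=
  ⟨{ toFun := fun x => x
     map_add' := fun _ _ => rfl
     map_smul' := fun _ _ => rfl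
     invFun := fun x => x
     left_inv := fun _ => rfl
     right_inv := fun _ => rfl }⟩

theorem res_pi {ι : Type} (N : ι → ModuleCat.{u} S) :
    Nonempty (res φ (ModuleCat.of S (∀ i, N i)) ≃ₗ[R] (∀ i, res φ (N i))) :=
  ⟨{ toFun := fun x => x
     map_add' := fun _ _ => rfl
     map_smul' := fun _ _ => rfl
     invFun := fun x => x
     left_inv := fun _ => rfl
     right_inv := fun _ => rfl }⟩

theorem IsSummand.res {X M : ModuleCat.{u} S} (h : IsSummand X M) :
    IsSummand (res φ X) (res φ M) := by
  obtain ⟨i, r, hr⟩ := isSummand_iff.1 h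
  exact .of_retract (resHom φ i) (resHom φ r) hr

theorem addClass.res {𝒞 : ModuleCat.{u} S → Prop} {𝒞' : ModuleCat.{u} R → Prop}
    (h𝒞 : ∀ M, 𝒞 M → ∃ M', 𝒞' M' ∧ IsSummand (res φ M) M') {X : ModuleCat.{u} S}
    (hX : addClass 𝒞 X) : addClass 𝒞' (res φ X) := by
  obtain ⟨m, T, hT, ⟨e⟩⟩ := hX
  obtain ⟨f⟩ := res_congr (φ := φ) (N' := ModuleCat.of S (∀ i, T i)) e
  obtain ⟨g⟩ := res_pi (φ := φ) T
  refine ⟨m, fun i => LIT.res φ (T i), fun i => ?_, ⟨f.trans g⟩⟩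
  obtain ⟨M, hM, hi⟩ := hT i
  obtain ⟨M', hM', hs⟩ := h𝒞 M hM
  exact ⟨M', hM', hi.res.trans hs⟩

/-- The kernel of `M → S ⊗ M`, for `φ : R → S` surjective: the submodule generated by
`(ker φ) M`. -/
def kerSpan (φ : R →+* S) (M : Type u) [AddCommGroup M] [Module R M] : Submodule R M :=
  Submodule.span R {x | ∃ (r : R) (m : M), φ r = 0 ∧ r • m = x}

theorem eq_zero_of_mem_kerSpan {M : Type u} [AddCommGroup M] [Module R M] {N : Type u}
    [AddCommGroup N] [Module S N] (q : M →ₛₗ[φ] N) {m : M} (hm : m ∈ kerSpan φ M) : q m = 0 := by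
  induction hm using Submodule.span_induction with
  | mem x hx =>
    obtain ⟨r, m, hr, rfl⟩ := hx
    rw [map_smulₛₗ, hr, zero_smul]
  | zero => exact map_zero q
  | add x y _ _ hx hy => rw [map_add, hx, hy, add_zero]
  | smul r x _ hx => rw [map_smulₛₗ, hx, smul_zero]

theorem map_kerSpan_le {M M' : Type u} [AddCommGroup M] [Module R M] [AddCommGroup M'] [Module R M']
    (f : M →ₗ[R] M') : (kerSpan φ M).map f ≤ kerSpan φ M' := by
  rw [kerSpan, Submodule.map_span_le]
  rintro _ ⟨r, m, hr, rfl⟩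
  exact Submodule.subset_span ⟨r, f m, hr, (map_smul f r m).symm⟩

theorem kerSpan_le_map {M M' : Type u} [AddCommGroup M] [Module R M] [AddCommGroup M'] [Module R M']
    (f : M →ₗ[R] M') (hf : Function.Surjective f) : kerSpan φ M' ≤ (kerSpan φ M).map f := by
  refine Submodule.span_le.2 ?_
  rintro _ ⟨r, m, hr, rfl⟩
  obtain ⟨m, rfl⟩ := hf m
  exact ⟨r • m, Submodule.subset_span ⟨r, m, hr, rfl⟩, map_smul f r m⟩

/-- A linear map that kills the kernel of a surjective semilinear map factors through it. -/
theorem exists_factor {M : Type u} [AddCommGroup M] [Module R M] {N N' : ModuleCat.{u} S}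
    (hφ : Function.Surjective φ) (q : M →ₛₗ[φ] N) (hq : Function.Surjective q) (g : M →ₛₗ[φ] N')
    (h : ∀ m, q m = 0 → g m = 0) : ∃ f : N →ₗ[S] N', ∀ m, f (q m) = g m := by
  have key : ∀ m m', q m = q m' → g m = g m' := fun m m' hm => by
    rw [← sub_eq_zero, ← map_sub]
    exact h _ (by rw [map_sub, hm, sub_self])
  choose s hs using hq
  refine ⟨
    { toFun := fun n => g (s n)
      map_add' := fun n n' => by
        rw [← map_add]
        exact key _ _ (by rw [map_add, hs, hs, hs])
      map_smul' := fun c n => by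
        obtain ⟨r, rfl⟩ := hφ c
        rw [RingHom.id_apply, ← map_smulₛₗ]
        exact key _ _ (by rw [map_smulₛₗ, hs, hs]) }, fun m => key _ _ (hs _)⟩

/-- The target of a surjective semilinear map is determined by the kernel. -/
theorem equiv_of_surjective {M : Type u} [AddCommGroup M] [Module R M] {N N' : ModuleCat.{u} S}
    (hφ : Function.Surjective φ) (q : M →ₛₗ[φ] N) (hq : Function.Surjective q) (q' : M →ₛₗ[φ] N')
    (hq' : Function.Surjective q') (h : ∀ m, q m = 0 ↔ q' m = 0) : Nonempty (N ≃ₗ[S] N') := by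
  obtain ⟨f, hf⟩ := exists_factor hφ q hq q' fun m => (h m).1
  obtain ⟨g, hg⟩ := exists_factor hφ q' hq' q fun m => (h m).2
  refine ⟨LinearEquiv.ofLinearMap f g (LinearMap.ext fun x => ?_) (LinearMap.ext fun x => ?_)⟩
  · obtain ⟨m, rfl⟩ := hq' x
    simp [hf, hg]
  · obtain ⟨m, rfl⟩ := hq x
    simp [hf, hg]

/-- Restriction along a surjection is full. -/
theorem exists_eq_resHom (hφ : Function.Surjective φ) {N N' : ModuleCat.{u} S}
    (g : res φ N →ₗ[R] res φ N') : ∃ f : N →ₗ[S] N', g = resHom φ f := by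
  obtain ⟨f, hf⟩ := exists_factor hφ (resMap φ N) (resMap_bijective φ N).2
    ((resMap φ N').comp g) fun m hm => by
      rw [show m = 0 from hm, map_zero]
  exact ⟨f, LinearMap.ext fun x => (hf x).symm⟩

theorem equiv_of_res_equiv (hφ : Function.Surjective φ) {N N' : ModuleCat.{u} S}
    (e : res φ N ≃ₗ[R] res φ N') : Nonempty (N ≃ₗ[S] N') :=
  equiv_of_surjective hφ (resMap φ N) (resMap_bijective φ N).2
    ((resMap φ N').comp e.toLinearMap) e.surjective fun m =>
      (LinearEquiv.map_eq_zero_iff e (x := m)).symm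

/-- The quotient by a submodule containing `(ker φ) M` is an `S`-module. -/
theorem exists_quotient (hφ : Function.Surjective φ) (M : Type u) [AddCommGroup M] [Module R M]
    (L : Submodule R M) (hL : ∀ r, φ r = 0 → ∀ m : M, r • m ∈ L) :
    ∃ (N : ModuleCat.{u} S) (q : M →ₛₗ[φ] N), Function.Surjective q ∧ ∀ m, q m = 0 ↔ m ∈ L := by
  choose s hs using hφ
  have key : ∀ r r', φ r = φ r' → ∀ x : M ⧸ L, r • x = r' • x := fun r r' h x => by
    obtain ⟨m, rfl⟩ := Submodule.Quotient.mk_surjective _ x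
    rw [← Submodule.Quotient.mk_smul, ← Submodule.Quotient.mk_smul, Submodule.Quotient.eq,
      ← sub_smul]
    exact hL _ (by rw [map_sub, h, sub_self]) m
  let inst : Module S (M ⧸ L) :=
    { smul := fun c x => s c • x
      one_smul := fun x => (key (s 1) 1 (by rw [hs, map_one]) x).trans (one_smul R x)
      mul_smul := fun c d x =>
        (key (s (c * d)) (s c * s d) (by rw [hs, map_mul, hs, hs]) x).trans (mul_smul _ _ x)
      smul_zero := fun c => smul_zero (s c)
      smul_add := fun c => smul_add (s c)
      add_smul := fun c d x =>
        (key (s (c + d)) (s c + s d) (by rw [hs, map_add, hs, hs]) x).trans (add_smul _ _ x)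
      zero_smul := fun x => (key (s 0) 0 (by rw [hs, map_zero]) x).trans (zero_smul R x) }
  refine ⟨ModuleCat.of S (M ⧸ L),
    { toFun := fun m => (Submodule.Quotient.mk m : M ⧸ L)
      map_add' := fun _ _ => rfl
      map_smul' := fun r m => key r (s (φ r)) (hs (φ r)).symm (Submodule.Quotient.mk m : M ⧸ L) },
    Submodule.Quotient.mk_surjective L, fun m => Submodule.Quotient.mk_eq_zero L⟩

/-- A module killed by the kernel of `φ` is an `S`-module. -/
theorem exists_equiv_res (hφ : Function.Surjective φ) (M : ModuleCat.{u} R)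
    (h : ∀ r, φ r = 0 → ∀ m : M, r • m = 0) :
    ∃ N : ModuleCat.{u} S, Nonempty (M ≃ₗ[R] res φ N) := by
  obtain ⟨N, q, hq, hk⟩ := exists_quotient hφ M ⊥ (by simpa using h)
  exact ⟨N, ⟨equivRes q ⟨(injective_iff_map_eq_zero q).2 fun m hm => by simpa using (hk m).1 hm, hq⟩⟩⟩

theorem IsSummand.exists_of_res (hφ : Function.Surjective φ) {X : ModuleCat.{u} R}
    {N : ModuleCat.{u} S} (h : IsSummand X (LIT.res φ N)) :
    ∃ X' : ModuleCat.{u} S, Nonempty (X ≃ₗ[R] LIT.res φ X') ∧ IsSummand X' N := by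
  obtain ⟨i, r, hir⟩ := isSummand_iff.1 h
  obtain ⟨X', ⟨e⟩⟩ := exists_equiv_res hφ X fun c hc x => by
    rw [← hir (c • x), map_smul, res_smul_eq_zero hc, map_zero]
  obtain ⟨i', hi'⟩ := exists_eq_resHom hφ (i ∘ₗ e.symm.toLinearMap)
  obtain ⟨r', hr'⟩ := exists_eq_resHom hφ (e.toLinearMap ∘ₗ r)
  refine ⟨X', ⟨e⟩, .of_retract i' r' fun x => ?_⟩
  have h₁ : resHom φ r' (resHom φ i' x) = (x : LIT.res φ X') := by
    rw [← hi', ← hr']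
    exact (congrArg e (hir _)).trans (e.apply_symm_apply x)
  exact h₁

theorem finite_res (hφ : Function.Surjective φ) (N : ModuleCat.{u} S) [Module.Finite S N] :
    Module.Finite R (res φ N) := by
  obtain ⟨n, p, hp⟩ := Module.Finite.exists_fin' S N
  let F : (Fin n → R) →ₗ[R] res φ N :=
    { toFun := fun v => p fun i => φ (v i)
      map_add' := fun v w => by
        refine Eq.trans ?_ (map_add p _ _)
        exact congrArg p (funext fun i => map_add φ _ _)
      map_smul' := fun r v => by
        refine Eq.trans ?_ (map_smul p (φ r) _)
        exact congrArg p (funext fun i => map_mul φ _ _) }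
  refine Module.Finite.of_surjective F fun y => ?_
  obtain ⟨v, hv⟩ := hp y
  choose w hw using fun i => hφ (v i)
  exact ⟨w, (congrArg p (funext hw)).trans hv⟩

theorem finite_of_semilinear (hφ : Function.Surjective φ) {M : ModuleCat.{u} R}
    {N : ModuleCat.{u} S} (q : M →ₛₗ[φ] N) (hq : Function.Surjective q) [Module.Finite R M] :
    Module.Finite S N :=
  have : RingHomSurjective φ := ⟨hφ⟩
  Module.Finite.of_surjective q hq

/-- The quotient of a projective module `P` by `(ker φ) P` is projective over `S`. -/
theorem projective_quotient {P : ModuleCat.{u} R} {P' : ModuleCat.{u} S}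
    (hφ : Function.Surjective φ) (q : P →ₛₗ[φ] P') (hq : Function.Surjective q)
    (hk : ∀ p, q p = 0 → p ∈ kerSpan φ P) [Module.Projective R P] : Module.Projective S P' := by
  refine Module.Projective.of_lifting_property'' fun f hf => ?_
  let F : ModuleCat.{u} S := ModuleCat.of S (P' →₀ S)
  obtain ⟨g, hg⟩ := Module.projective_lifting_property
    (resHom φ (N := F) f) (toRes φ q) hf
  obtain ⟨h, hh⟩ := exists_factor (N' := F) hφ q hq ((resMap φ F).comp g)
    fun p hp => eq_zero_of_mem_kerSpan _ (hk p hp)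
  refine ⟨h, LinearMap.ext fun x => ?_⟩
  obtain ⟨p, rfl⟩ := hq x
  rw [LinearMap.comp_apply, hh]
  exact LinearMap.congr_fun hg p

/-- The quotient of a projective cover `P → M` by `(ker φ) P → (ker φ) M` is a projective cover. -/
theorem IsProjectiveCover.quotient {P M : ModuleCat.{u} R} {P' M' : ModuleCat.{u} S}
    (hφ : Function.Surjective φ) {f : P →ₗ[R] M} (hf : IsProjectiveCover f) (qP : P →ₛₗ[φ] P')
    (hqP : Function.Surjective qP) (hkP : ∀ p, qP p = 0 → p ∈ kerSpan φ P) (qM : M →ₛₗ[φ] M')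
    (hqM : Function.Surjective qM) (hkM : ∀ m, qM m = 0 → m ∈ kerSpan φ M) (f' : P' →ₗ[S] M')
    (hf' : ∀ p, f' (qP p) = qM (f p)) :
    IsProjectiveCover f' ∧ ∀ x, f' x = 0 → ∃ p, f p = 0 ∧ qP p = x := by
  have lift : ∀ x, f' x = 0 → ∃ p, f p = 0 ∧ qP p = x := by
    intro x hx
    obtain ⟨p, rfl⟩ := hqP x
    rw [hf'] at hx
    obtain ⟨p', hp', hpp'⟩ := kerSpan_le_map f hf.2.2.1 (hkM _ hx)
    exact ⟨p - p', by rw [map_sub, hpp', sub_self],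
      by rw [map_sub, eq_zero_of_mem_kerSpan qP hp', sub_zero]⟩
  refine ⟨(isProjectiveCover_iff f').2 ⟨?_, ?_, ?_, ?_⟩, lift⟩
  · have := hf.1
    exact finite_of_semilinear hφ qP hqP
  · have := hf.2.1
    exact projective_quotient hφ qP hqP hkP
  · intro m
    obtain ⟨m, rfl⟩ := hqM m
    obtain ⟨p, rfl⟩ := hf.2.2.1 m
    exact ⟨qP p, hf' p⟩
  · intro x hx
    obtain ⟨p, hp, rfl⟩ := lift x hx
    have : RingHomSurjective φ := ⟨hφ⟩
    exact Module.le_comap_jacobson qP (hf.ker_le hp)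

/-! ### Restriction along a surjection that preserves projectivity -/

theorem projective_res (hS : Module.Projective R (res φ (ModuleCat.of S S))) (P : ModuleCat.{u} S)
    [Module.Finite S P] [Module.Projective S P] : Module.Projective R (res φ P) := by
  obtain ⟨n, p, hp⟩ := Module.Finite.exists_fin' S P
  obtain ⟨g, hg⟩ := Module.projective_lifting_property p LinearMap.id hp
  have hproj : Module.Projective R (Fin n → res φ (ModuleCat.of S S)) :=
    Module.Projective.of_equiv
      (DFinsupp.linearEquivFunOnFintype (R := R) (M := fun _ : Fin n => res φ (ModuleCat.of S S)))
  obtain ⟨e⟩ := res_pi (φ := φ) (fun _ : Fin n => ModuleCat.of S S)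
  let g' : P →ₗ[S] ModuleCat.of S (∀ _ : Fin n, ModuleCat.of S S) := g
  let p' : ModuleCat.of S (∀ _ : Fin n, ModuleCat.of S S) →ₗ[S] P := p
  refine Module.Projective.of_split (e.toLinearMap ∘ₗ resHom φ g')
    (resHom φ p' ∘ₗ e.symm.toLinearMap) (LinearMap.ext fun x => ?_)
  have : p' (g' (resMap φ P x)) = resMap φ P x := LinearMap.congr_fun hg (resMap φ P x)
  simp only [LinearMap.comp_apply, LinearEquiv.coe_coe, LinearEquiv.symm_apply_apply]
  exact this

/-- The kernel of a map is the same over `R` and over `S`. -/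
theorem ker_resHom {N N' : ModuleCat.{u} S} (f : N →ₗ[S] N') :
    Nonempty (res φ (ModuleCat.of S (LinearMap.ker f)) ≃ₗ[R] LinearMap.ker (resHom φ f)) :=
  ⟨{ toFun := fun x => ⟨x.1, x.2⟩
     map_add' := fun _ _ => rfl
     map_smul' := fun _ _ => rfl
     invFun := fun x => ⟨x.1, x.2⟩
     left_inv := fun _ => rfl
     right_inv := fun _ => rfl }⟩

theorem IsProjectiveCover.res (hφ : Function.Surjective φ)
    (hS : Module.Projective R (res φ (ModuleCat.of S S))) {P M : ModuleCat.{u} S} {f : P →ₗ[S] M}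
    (hf : IsProjectiveCover f) : IsProjectiveCover (resHom φ f) := by
  have := hf.1
  have := hf.2.1
  refine (isProjectiveCover_iff _).2 ⟨finite_res hφ P, projective_res hS P, hf.2.2.1, ?_⟩
  intro x hx
  have : RingHomSurjective φ := ⟨hφ⟩
  rw [← Module.comap_jacobson_of_bijective (f := resMap φ P) (resMap_bijective φ P)]
  exact hf.ker_le hx

theorem IsSyzygy.res (hφ : Function.Surjective φ)
    (hS : Module.Projective R (res φ (ModuleCat.of S S))) {K M : ModuleCat.{u} S}
    (h : IsSyzygy K M) : IsSyzygy (res φ K) (res φ M) := by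
  obtain ⟨P, f, hf, ⟨e⟩⟩ := h
  obtain ⟨e'⟩ := res_congr (φ := φ) (N' := ModuleCat.of S (LinearMap.ker f)) e
  obtain ⟨i⟩ := ker_resHom (φ := φ) f
  exact ⟨_, resHom φ f, hf.res hφ hS, ⟨e'.trans i⟩⟩

theorem IsNthSyzygy.res (hφ : Function.Surjective φ)
    (hS : Module.Projective R (res φ (ModuleCat.of S S))) {n : ℕ} {K M : ModuleCat.{u} S}
    (h : IsNthSyzygy n K M) : IsNthSyzygy n (res φ K) (res φ M) := by
  induction n generalizing M with
  | zero => exact res_congr h.some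
  | succ n ih =>
    obtain ⟨L, hL, h⟩ := h
    exact ⟨_, hL.res hφ hS, ih h⟩

theorem indecomposable_of_res {X : ModuleCat.{u} S} (h : Indecomposable (res φ X)) :
    Indecomposable X := by
  rw [indecomposable_iff] at h ⊢
  refine ⟨h.1, fun Y Z ⟨e⟩ => ?_⟩
  obtain ⟨f⟩ := res_congr (φ := φ) (N' := ModuleCat.of S (Y × Z)) e
  obtain ⟨g⟩ := res_prod (φ := φ) Y Z
  exact h.2 (res φ Y) (res φ Z) ⟨f.trans g⟩

/-! ### Change of rings on `K₀` -/

theorem exists_resK0 (hφ : Function.Surjective φ)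
    (hS : Module.Projective R (res φ (ModuleCat.of S S))) :
    ∃ ρ : K0 S →+ K0 R, ∀ (M : ModuleCat.{u} S) (hM : Module.Finite S M)
      (hM' : Module.Finite R (res φ M)), ρ (K0.mk M hM) = K0.mk (res φ M) hM' := by
  refine ⟨QuotientAddGroup.lift _ (FreeAbelianGroup.lift fun M : FGMod S =>
    have := M.2
    K0.mk (res φ M.1) (finite_res hφ M.1)) ?_, fun M hM _ => FreeAbelianGroup.lift_apply_of _ _⟩
  rw [AddSubgroup.closure_le]
  intro x hx
  rw [SetLike.mem_coe, AddMonoidHom.mem_ker]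
  cases hx with
  | sum M M' M'' e =>
    simp only [map_sub, FreeAbelianGroup.lift_apply_of]
    obtain ⟨f⟩ := res_congr (φ := φ) (N' := ModuleCat.of S (M'.1 × M''.1)) e
    obtain ⟨g⟩ := res_prod (φ := φ) M'.1 M''.1
    have := M'.2
    have := M''.2
    rw [K0.mk_eq_add _ (finite_res hφ M'.1) (finite_res hφ M''.1) (f.trans g)]
    abel
  | proj P h =>
    rw [FreeAbelianGroup.lift_apply_of]
    have := P.2
    exact K0.mk_projective _ (projective_res hS P.1)

/-- Base change `M ↦ M / (ker φ) M` gives a left inverse of the restriction on `K₀`. -/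
theorem exists_baseChangeK0 (hφ : Function.Surjective φ) :
    ∃ β : K0 R →+ K0 S, ∀ (M : ModuleCat.{u} S) (hM : Module.Finite S M)
      (hM' : Module.Finite R (res φ M)), β (K0.mk (res φ M) hM') = K0.mk M hM := by
  have key : ∀ M : ModuleCat.{u} R, ∃ (N : ModuleCat.{u} S) (q : M →ₛₗ[φ] N),
      Function.Surjective q ∧ ∀ m, q m = 0 ↔ m ∈ kerSpan φ M := fun M =>
    exists_quotient hφ M _ fun r hr m => Submodule.subset_span ⟨r, m, hr, rfl⟩
  choose F q hq hk using key
  have hF : ∀ M : FGMod R, Module.Finite S (F M.1) := fun M =>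
    have := M.2
    finite_of_semilinear hφ (q M.1) (hq M.1)
  refine ⟨QuotientAddGroup.lift _ (FreeAbelianGroup.lift fun M : FGMod R =>
    K0.mk (F M.1) (hF M)) ?_, fun M hM hM' =>
      (FreeAbelianGroup.lift_apply_of _ (⟨res φ M, hM'⟩ : FGMod R)).trans ?_⟩
  · rw [AddSubgroup.closure_le]
    intro x hx
    rw [SetLike.mem_coe, AddMonoidHom.mem_ker]
    cases hx with
    | sum M M' M'' e =>
      simp only [map_sub, FreeAbelianGroup.lift_apply_of]
      let Q : M.1 →ₛₗ[φ] ModuleCat.of S (F M'.1 × F M''.1) :=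
        { toFun := fun m => (q M'.1 (e m).1, q M''.1 (e m).2)
          map_add' := fun m m' => by
            rw [map_add, Prod.fst_add, Prod.snd_add, map_add, map_add]
            rfl
          map_smul' := fun r m => by
            rw [map_smul, Prod.smul_fst, Prod.smul_snd, map_smulₛₗ, map_smulₛₗ]
            rfl }
      have hQ : ∀ m, Q m = 0 ↔ q M'.1 (e m).1 = 0 ∧ q M''.1 (e m).2 = 0 := fun m => Prod.ext_iff
      obtain ⟨i⟩ := equiv_of_surjective hφ (q M.1) (hq M.1) Q
        (by
          rintro ⟨a, b⟩
          obtain ⟨a, rfl⟩ := hq _ a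
          obtain ⟨b, rfl⟩ := hq _ b
          refine ⟨e.symm (a, b), ?_⟩
          exact Prod.ext (by simp [Q]) (by simp [Q]))
        (by
          intro m
          rw [hQ, hk, hk, hk]
          constructor
          · intro hm
            exact ⟨map_kerSpan_le (LinearMap.fst R M'.1 M''.1 ∘ₗ e.toLinearMap) ⟨m, hm, rfl⟩,
              map_kerSpan_le (LinearMap.snd R M'.1 M''.1 ∘ₗ e.toLinearMap) ⟨m, hm, rfl⟩⟩
          · rintro ⟨h₁, h₂⟩
            have : m = (e.symm.toLinearMap ∘ₗ LinearMap.inl R M'.1 M''.1) (e m).1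
                + (e.symm.toLinearMap ∘ₗ LinearMap.inr R M'.1 M''.1) (e m).2 := by
              simp [← map_add]
            rw [this]
            exact add_mem (map_kerSpan_le _ ⟨_, h₁, rfl⟩) (map_kerSpan_le _ ⟨_, h₂, rfl⟩))
      rw [K0.mk_eq_add (hF M) (hF M') (hF M'') i]
      abel
    | proj P h =>
      rw [FreeAbelianGroup.lift_apply_of]
      exact K0.mk_projective _ (projective_quotient hφ (q P.1) (hq P.1) fun p => (hk P.1 p).1)
  · obtain ⟨i⟩ := equiv_of_surjective hφ (q (res φ M)) (hq _) (resMap φ M)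
      (resMap_bijective φ M).2 fun m => by
        rw [hk]
        refine ⟨eq_zero_of_mem_kerSpan (resMap φ M), fun hm => ?_⟩
        rw [show m = 0 from hm]
        exact zero_mem _
    exact K0.mk_congr _ _ i

theorem omegaBar_mk [IsNoetherianRing R] {P M : ModuleCat.{u} R} (f : P →ₗ[R] M)
    (hf : Function.Surjective f) (hP : Module.Finite R P) (pP : Module.Projective R P)
    (hM : Module.Finite R M) :
    omegaBar R (K0.mk M hM) = K0.mk (ModuleCat.of R (LinearMap.ker f)) (finite_ker f hP) := by
  rw [← omegaGen_eq ⟨M, hM⟩ f hf hP pP]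
  exact FreeAbelianGroup.lift_apply_of _ _

theorem K0.induction {x : K0 R} {p : K0 R → Prop}
    (mk : ∀ (M : ModuleCat.{u} R) (hM : Module.Finite R M), p (K0.mk M hM))
    (sub : ∀ x y, p x → p y → p (x - y)) : p x := by
  have zero : p 0 := by
    have h := mk (ModuleCat.of R PUnit.{u + 1}) (inferInstanceAs (Module.Finite R PUnit.{u + 1}))
    have h' := sub _ _ h h
    rwa [sub_self] at h'
  obtain ⟨x, rfl⟩ := QuotientAddGroup.mk_surjective x
  induction x using FreeAbelianGroup.induction_on with
  | zero => exact zero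
  | of M => exact mk M.1 M.2
  | neg M ih =>
    have := sub _ _ zero ih
    rwa [zero_sub] at this
  | add x y hx hy =>
    have := sub _ _ hx (sub _ _ zero hy)
    rwa [zero_sub, sub_neg_eq_add] at this

variable [IsNoetherianRing R] [IsNoetherianRing S]

theorem omegaBar_res (hφ : Function.Surjective φ)
    (hS : Module.Projective R (res φ (ModuleCat.of S S))) {ρ : K0 S →+ K0 R}
    (hρ : ∀ (M : ModuleCat.{u} S) (hM : Module.Finite S M) (hM' : Module.Finite R (res φ M)),
      ρ (K0.mk M hM) = K0.mk (res φ M) hM') (x : K0 S) :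
    omegaBar R (ρ x) = ρ (omegaBar S x) := by
  refine K0.induction (p := fun x => omegaBar R (ρ x) = ρ (omegaBar S x)) (fun M hM => ?_)
    fun x y hx hy => by rw [map_sub, map_sub, map_sub, map_sub, hx, hy]
  obtain ⟨n, f, hf⟩ := Module.Finite.exists_fin' S M
  let P : ModuleCat.{u} S := ModuleCat.of S (Fin n → S)
  have hP : Module.Finite S P := inferInstanceAs (Module.Finite S (Fin n → S))
  have pP : Module.Projective S P := inferInstanceAs (Module.Projective S (Fin n → S))
  let f' : P →ₗ[S] M := f
  have : Module.Finite S (ModuleCat.of S (LinearMap.ker f')) := finite_ker f' hP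
  rw [hρ M hM (finite_res hφ M), omegaBar_mk f' hf hP pP hM, hρ _ _ (finite_res hφ _),
    omegaBar_mk (resHom φ f') hf (finite_res hφ P) (projective_res hS P)]
  obtain ⟨i⟩ := ker_resHom (φ := φ) f'
  exact K0.mk_congr _ _ i.symm

/-! ### Transport of `0`-Igusa-Todorov subcategories -/

theorem phi_eq_zero_iff (M : ModuleCat.{u} R) : phi M = 0 ↔
    ∀ m : ℕ, Set.InjOn (omegaBar R) ((omegaBar R)^[m] '' (K0.addSpan M : Set (K0 R))) := by
  rw [phi]
  constructor
  · intro h m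
    have hne : {d : ℕ∞ | ∃ k : ℕ, d = k ∧ ∀ m : ℕ, k ≤ m →
        Set.InjOn (omegaBar R) ((omegaBar R)^[m] '' (K0.addSpan M : Set (K0 R)))}.Nonempty := by
      by_contra hcon
      rw [Set.not_nonempty_iff_eq_empty.1 hcon, sInf_empty] at h
      exact ENat.top_ne_zero h
    obtain ⟨k, hk, hinj⟩ := csInf_mem hne
    rw [h] at hk
    exact hinj m (by rw [show k = 0 by exact_mod_cast hk.symm]; exact Nat.zero_le m)
  · exact fun h => le_antisymm (sInf_le ⟨0, rfl, fun m _ => h m⟩) bot_le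

theorem phiDim_eq_zero_iff (𝒞 : ModuleCat.{u} R → Prop) :
    phiDim 𝒞 = 0 ↔ ∀ M, 𝒞 M → phi M = 0 := by
  simp only [phiDim, ← bot_eq_zero, iSup_eq_bot]

/-- The `R`-modules that come from a class of `S`-modules. -/
def resClass (φ : R →+* S) (𝒟 : ModuleCat.{u} S → Prop) (M : ModuleCat.{u} R) : Prop :=
  ∃ N, 𝒟 N ∧ Nonempty (M ≃ₗ[R] res φ N)

/-- Restriction does not change the vanishing of the Igusa-Todorov function, because it embeds
`K₀(S)` into `K₀(R)` compatibly with `Ω̄`. -/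
theorem phi_eq_zero_of_res (hφ : Function.Surjective φ)
    (hS : Module.Projective R (res φ (ModuleCat.of S S))) {M : ModuleCat.{u} R}
    {N : ModuleCat.{u} S} [Module.Finite S N] (e : M ≃ₗ[R] res φ N) (h : phi N = 0) :
    phi M = 0 := by
  rw [phi_eq_zero_iff] at h ⊢
  obtain ⟨ρ, hρ⟩ := exists_resK0 hφ hS
  obtain ⟨β, hβ⟩ := exists_baseChangeK0 hφ
  have hβρ : ∀ x, β (ρ x) = x := fun x =>
    K0.induction (p := fun x => β (ρ x) = x)
      (fun M hM => by rw [hρ M hM (finite_res hφ M), hβ])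
      fun x y hx hy => by rw [map_sub, map_sub, hx, hy]
  have hΩ := omegaBar_res hφ hS hρ
  have hΩ' : ∀ m x, (omegaBar R)^[m] (ρ x) = ρ ((omegaBar S)^[m] x) := fun m x => by
    induction m generalizing x with
    | zero => rfl
    | succ m ih => rw [Function.iterate_succ_apply, Function.iterate_succ_apply, hΩ, ih]
  have hspan : K0.addSpan M ≤ (K0.addSpan N).map ρ := by
    refine (AddSubgroup.closure_le _).2 ?_
    rintro _ ⟨X, hX, hind, hs, rfl⟩
    obtain ⟨X', ⟨f⟩, hs'⟩ := (hs.trans (.of_equiv e)).exists_of_res hφ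
    have := hs'.finite
    refine ⟨K0.mk X' this, AddSubgroup.subset_closure
      ⟨X', this, indecomposable_of_res (indecomposable_congr f hind), hs', rfl⟩, ?_⟩
    rw [hρ X' this (finite_res hφ X')]
    exact K0.mk_congr _ _ f.symm
  intro m
  have hsub : (omegaBar R)^[m] '' (K0.addSpan M : Set (K0 R)) ⊆
      ρ '' ((omegaBar S)^[m] '' (K0.addSpan N : Set (K0 S))) := by
    rintro _ ⟨x, hx, rfl⟩
    obtain ⟨y, hy, rfl⟩ := hspan hx
    exact ⟨_, ⟨y, hy, rfl⟩, (hΩ' m y).symm⟩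
  refine Set.InjOn.mono hsub ?_
  rintro _ ⟨x, hx, rfl⟩ _ ⟨y, hy, rfl⟩ hxy
  rw [hΩ, hΩ] at hxy
  rw [h m hx hy (by rw [← hβρ (omegaBar S x), hxy, hβρ])]

theorem IsZeroIT.res [IsArtinianRing S] (hφ : Function.Surjective φ)
    (hS : Module.Projective R (res φ (ModuleCat.of S S))) {𝒟 : ModuleCat.{u} S → Prop}
    (h : IsZeroIT 𝒟) : IsZeroIT (resClass φ 𝒟) where
  finite := by
    rintro X ⟨N, hN, ⟨e⟩⟩
    have := h.finite N hN
    have := finite_res hφ N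
    exact Module.Finite.equiv e.symm
  add_eq X := by
    refine ⟨fun hX => addClass_of_isSummand hX (.refl X), ?_⟩
    rintro ⟨m, T, hT, ⟨e⟩⟩
    have key : ∀ i, ∃ T' : ModuleCat.{u} S, Nonempty (T i ≃ₗ[R] LIT.res φ T') ∧
        ∃ N, 𝒟 N ∧ IsSummand T' N := fun i => by
      obtain ⟨M, ⟨N, hN, ⟨f⟩⟩, hs⟩ := hT i
      obtain ⟨T', f', hs'⟩ := (hs.trans (.of_equiv f)).exists_of_res hφ
      exact ⟨T', f', N, hN, hs'⟩
    choose T' f hT' using key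
    obtain ⟨g⟩ := res_pi (φ := φ) T'
    exact ⟨ModuleCat.of S (∀ i, T' i), (h.add_eq _).2 ⟨m, T', hT', ⟨.refl S _⟩⟩,
      ⟨e.trans ((LinearEquiv.piCongrRight fun i => (f i).some).trans g.symm)⟩⟩
  syzygy := by
    rintro X K ⟨N, hN, ⟨e⟩⟩ hK
    have := h.finite N hN
    obtain ⟨L, hL⟩ := exists_isSyzygy N
    exact ⟨L, h.syzygy N L hN hL, hK.unique (hL.res hφ hS) e⟩
  phiDim_eq := by
    have h' := h.phiDim_eq
    rw [phiDim_eq_zero_iff] at h' ⊢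
    rintro M ⟨N, hN, ⟨e⟩⟩
    have := h.finite N hN
    exact phi_eq_zero_of_res hφ hS e (h' N hN)

end ChangeOfRings

/-! ### Tops of modules and the sum of the simple modules -/

section Simples

variable {R : Type u} [Ring R]

/-- The top of a finitely generated module is a finite direct sum of simple modules. -/
theorem exists_top_decomposition [IsArtinianRing R] (P : ModuleCat.{u} R) [Module.Finite R P] :
    ∃ (n : ℕ) (S : Fin n → ModuleCat.{u} R), (∀ i, IsSimpleModule R (S i)) ∧
      Nonempty ((P ⧸ Module.jacobson R P) ≃ₗ[R] (∀ i, S i)) := by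
  have : IsArtinian R P := isArtinian_of_fg_of_artinian'
  have : IsSemisimpleModule R (P ⧸ Module.jacobson R P) :=
    (IsArtinian.isSemisimpleModule_iff_jacobson R _).2 (Module.jacobson_quotient_jacobson R P)
  obtain ⟨n, S, e, hS⟩ :=
    IsSemisimpleModule.exists_linearEquiv_fin_dfinsupp R (P ⧸ Module.jacobson R P)
  exact ⟨n, fun i => ModuleCat.of R (S i), hS, ⟨e.trans DFinsupp.linearEquivFunOnFintype⟩⟩

/-- The radical of a finitely generated projective module is the syzygy of its top. -/
theorem isSyzygy_jacobson (P : ModuleCat.{u} R) [Module.Finite R P] [Module.Projective R P] :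
    IsSyzygy (ModuleCat.of R (Module.jacobson R P))
      (ModuleCat.of R (P ⧸ Module.jacobson R P)) := by
  refine ⟨P, (Module.jacobson R P).mkQ, (isProjectiveCover_iff _).2 ⟨inferInstance, inferInstance,
    Submodule.mkQ_surjective _, ?_⟩, ⟨LinearEquiv.ofEq _ _ ?_⟩⟩
  · rw [Submodule.ker_mkQ]
  · rw [Submodule.ker_mkQ]

/-- Over an Artinian ring there are only finitely many simple modules: they are the summands of the
top of `R`. -/
theorem exists_isSumOfSimples [IsArtinianRing R] : ∃ C₀ : ModuleCat.{u} R, IsSumOfSimples C₀ := by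
  obtain ⟨n, S, hS, ⟨e⟩⟩ := exists_top_decomposition (ModuleCat.of R R)
  obtain ⟨m, O, h₁, h₂, h₃⟩ := exists_irredundant_system
    (fun X : ModuleCat.{u} R => IsSimpleModule R X) (fun X Y ⟨f⟩ hX => .congr f.symm) S
    (by
      intro X hX
      have := IsSimpleModule.nontrivial R X
      obtain ⟨x, hx⟩ := exists_ne (0 : X)
      let p : R →ₗ[R] X := LinearMap.toSpanSingleton R X x
      have hp : Module.jacobson R R ≤ LinearMap.ker p := IsSemisimpleModule.jacobson_le_ker R R R X p
      let q : (R ⧸ Module.jacobson R R) →ₗ[R] X := Submodule.liftQ _ p hp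
      have hq : q (Submodule.Quotient.mk 1) = x := one_smul R x
      have hex : ∃ i, (q ∘ₗ e.symm.toLinearMap) ∘ₗ LinearMap.single R (fun i => S i) i ≠ 0 := by
        by_contra! hcon
        have h0 : q ∘ₗ e.symm.toLinearMap = 0 :=
          LinearMap.pi_ext' fun i => (hcon i).trans (LinearMap.zero_comp _).symm
        refine hx ?_
        have := LinearMap.congr_fun h0 (e (Submodule.Quotient.mk 1))
        rw [LinearMap.comp_apply, LinearEquiv.coe_coe, e.symm_apply_apply, hq] at this
        exact this
      obtain ⟨i, hi⟩ := hex
      have := hS i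
      exact ⟨i, ⟨(LinearEquiv.ofBijective _ (LinearMap.bijective_of_ne_zero hi)).symm⟩⟩)
  exact ⟨ModuleCat.of R (∀ i, O i), m, O, h₁, h₂, h₃, ⟨.refl R _⟩⟩

theorem IsSumOfSimples.finite {C₀ : ModuleCat.{u} R} (h : IsSumOfSimples C₀) :
    Module.Finite R C₀ := by
  obtain ⟨m, S, hS, -, -, ⟨e⟩⟩ := h
  have : ∀ i, Module.Finite R (S i) := fun i =>
    have := hS i
    inferInstance
  exact Module.Finite.equiv e.symm

theorem IsSumOfSimples.isSummand {C₀ T : ModuleCat.{u} R} (h : IsSumOfSimples C₀)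
    (hT : IsSimpleModule R T) : IsSummand T C₀ := by
  obtain ⟨m, S, -, -, hS, ⟨e⟩⟩ := h
  obtain ⟨i, ⟨f⟩⟩ := hS T hT
  exact (IsSummand.of_equiv f).trans
    ((IsSummand.pi S i).trans (.of_equiv (X := ModuleCat.of R (∀ i, S i)) e.symm))

end Simples

/-! ### Resolutions by a module and a class -/

section LITSequence

variable {R : Type u} [Ring R]

/-- `K` has an exact sequence `0 → V₁ ⊕ D₁ → V₀ ⊕ D₀ → K → 0` with `V₀, V₁ ∈ add V` and
`D₀, D₁ ∈ 𝒟`. -/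
def HasLITSequence (V : ModuleCat.{u} R) (𝒟 : ModuleCat.{u} R → Prop) (K : ModuleCat.{u} R) :
    Prop :=
  ∃ V₀ V₁ D₀ D₁ : ModuleCat.{u} R,
    addClass (· = V) V₀ ∧ addClass (· = V) V₁ ∧ 𝒟 D₀ ∧ 𝒟 D₁ ∧
    ∃ (f : (V₁ × D₁) →ₗ[R] (V₀ × D₀)) (g : (V₀ × D₀) →ₗ[R] K),
      Function.Injective f ∧ Function.Exact f g ∧ Function.Surjective g

theorem HasLITSequence.of_exact {V : ModuleCat.{u} R} {𝒟 : ModuleCat.{u} R → Prop}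
    {K V₀ V₁ D₀ D₁ : ModuleCat.{u} R} (hV₀ : addClass (· = V) V₀) (hV₁ : addClass (· = V) V₁)
    (hD₀ : 𝒟 D₀) (hD₁ : 𝒟 D₁) {M₀ M₁ : Type u} [AddCommGroup M₀] [Module R M₀] [AddCommGroup M₁]
    [Module R M₁] (e₀ : M₀ ≃ₗ[R] (V₀ × D₀)) (e₁ : M₁ ≃ₗ[R] (V₁ × D₁)) (f : M₁ →ₗ[R] M₀)
    (g : M₀ →ₗ[R] K) (hf : Function.Injective f) (hfg : Function.Exact f g)
    (hg : Function.Surjective g) : HasLITSequence V 𝒟 K := by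
  refine ⟨V₀, V₁, D₀, D₁, hV₀, hV₁, hD₀, hD₁, (e₀.toLinearMap ∘ₗ f) ∘ₗ e₁.symm.toLinearMap,
    g ∘ₗ e₀.symm.toLinearMap, (e₀.injective.comp hf).comp e₁.symm.injective, fun x => ?_,
    hg.comp e₀.symm.surjective⟩
  refine (hfg (e₀.symm x)).trans ⟨?_, ?_⟩
  · rintro ⟨y, hy⟩
    exact ⟨e₁ y, by simp [hy]⟩
  · rintro ⟨y, rfl⟩
    exact ⟨e₁.symm y, by simp⟩

theorem HasLITSequence.mono {V V' : ModuleCat.{u} R} {𝒟 𝒟' : ModuleCat.{u} R → Prop}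
    {K : ModuleCat.{u} R} (h : HasLITSequence V 𝒟 K) (hV : IsSummand V V')
    (h𝒟 : ∀ D, 𝒟 D → 𝒟' D) : HasLITSequence V' 𝒟' K := by
  obtain ⟨V₀, V₁, D₀, D₁, hV₀, hV₁, hD₀, hD₁, h⟩ := h
  have hadd : ∀ X, addClass (· = V) X → addClass (· = V') X := fun X hX =>
    hX.mono (by rintro M rfl; exact ⟨V', rfl, hV⟩)
  exact ⟨V₀, V₁, D₀, D₁, hadd _ hV₀, hadd _ hV₁, h𝒟 _ hD₀, h𝒟 _ hD₁, h⟩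

theorem HasLITSequence.of_addClass {V : ModuleCat.{u} R} {𝒟 : ModuleCat.{u} R → Prop}
    {K : ModuleCat.{u} R} (hK : addClass (· = V) K) {Z : ModuleCat.{u} R} [Subsingleton Z]
    (hZ : 𝒟 Z) : HasLITSequence V 𝒟 K := by
  have : Unique Z := uniqueOfSubsingleton 0
  refine .of_exact (V₀ := K) (V₁ := Z) (D₀ := Z) (D₁ := Z) (M₀ := K) (M₁ := Z) hK
    addClass_of_subsingleton hZ hZ (LinearEquiv.prodUnique (M₂ := Z)).symm
    (LinearEquiv.prodUnique (M₂ := Z)).symm 0 LinearMap.id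
    (Function.injective_of_subsingleton _) (fun x => ?_) Function.surjective_id
  exact ⟨fun hx => ⟨0, by simpa using hx.symm⟩, by rintro ⟨y, rfl⟩; simp⟩

theorem HasLITSequence.prod {V : ModuleCat.{u} R} {𝒟 : ModuleCat.{u} R → Prop}
    (h𝒟 : ∀ D D', 𝒟 D → 𝒟 D' → 𝒟 (ModuleCat.of R (D × D'))) {K K' : ModuleCat.{u} R}
    (h : HasLITSequence V 𝒟 K) (h' : HasLITSequence V 𝒟 K') :
    HasLITSequence V 𝒟 (ModuleCat.of R (K × K')) := by
  obtain ⟨V₀, V₁, D₀, D₁, hV₀, hV₁, hD₀, hD₁, f, g, hf, hfg, hg⟩ := h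
  obtain ⟨V₀', V₁', D₀', D₁', hV₀', hV₁', hD₀', hD₁', f', g', hf', hfg', hg'⟩ := h'
  refine .of_exact (hV₀.prod hV₀') (hV₁.prod hV₁') (h𝒟 _ _ hD₀ hD₀') (h𝒟 _ _ hD₁ hD₁')
    (LinearEquiv.prodProdProdComm R V₀ D₀ V₀' D₀') (LinearEquiv.prodProdProdComm R V₁ D₁ V₁' D₁')
    (f.prodMap f') (g.prodMap g') (hf.prodMap hf') (fun x => ?_) (hg.prodMap hg')
  refine (Prod.ext_iff.trans (and_congr (hfg x.1) (hfg' x.2))).trans ⟨?_, ?_⟩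
  · rintro ⟨⟨y, hy⟩, y', hy'⟩
    exact ⟨(y, y'), Prod.ext hy hy'⟩
  · rintro ⟨y, rfl⟩
    exact ⟨⟨y.1, rfl⟩, y.2, rfl⟩

variable {S : Type u} [Ring S] {φ : R →+* S}

theorem HasLITSequence.res {V K : ModuleCat.{u} S} {𝒟 : ModuleCat.{u} S → Prop}
    (h : HasLITSequence V 𝒟 K) : HasLITSequence (res φ V) (resClass φ 𝒟) (LIT.res φ K) := by
  obtain ⟨V₀, V₁, D₀, D₁, hV₀, hV₁, hD₀, hD₁, f, g, hf, hfg, hg⟩ := h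
  have hadd : ∀ X, addClass (· = V) X → addClass (· = LIT.res φ V) (LIT.res φ X) := fun X hX =>
    hX.res (by rintro M rfl; exact ⟨_, rfl, .refl _⟩)
  obtain ⟨e₀⟩ := res_prod (φ := φ) V₀ D₀
  obtain ⟨e₁⟩ := res_prod (φ := φ) V₁ D₁
  exact .of_exact (hadd _ hV₀) (hadd _ hV₁) ⟨D₀, hD₀, ⟨.refl R _⟩⟩ ⟨D₁, hD₁, ⟨.refl R _⟩⟩ e₀ e₁
    (resHom φ (N := ModuleCat.of S (V₁ × D₁)) (N' := ModuleCat.of S (V₀ × D₀)) f)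
    (resHom φ (N := ModuleCat.of S (V₀ × D₀)) g) hf hfg hg

end LITSequence

/-! ### Triangular rings whose radical splits -/

/-- The ring `R` is triangular with diagonal blocks `S ≅ R/eR` and `T ≅ R/R(1-e) ≅ eRe`, and its
radical is annihilated from the left by the off-diagonal block `eR(1-e)`. -/
structure IsSplitTriangular {R S T : Type u} [Ring R] [Ring S] [Ring T] (φ : R →+* S) (ψ : R →+* T)
    (e : R) : Prop where
  surj_fst : Function.Surjective φ
  surj_snd : Function.Surjective ψ
  map_idem : φ e = 0
  mul_of_map_eq_zero : ∀ r, φ r = 0 → e * r = r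
  ker_snd : ∀ r, ψ r = 0 ↔ r * e = 0
  mul_jacobson : ∀ x ∈ Ring.jacobson R, ∀ r, e * r * (1 - e) * x = 0

section Triangular

variable {R S T : Type u} [Ring R] [Ring S] [Ring T] {φ : R →+* S} {ψ : R →+* T} {e : R}

namespace IsSplitTriangular

theorem idem (h : IsSplitTriangular φ ψ e) : e * e = e := h.mul_of_map_eq_zero e h.map_idem

theorem mul_mul_idem (h : IsSplitTriangular φ ψ e) (r : R) : e * (r * e) = r * e :=
  h.mul_of_map_eq_zero _ (by rw [map_mul, h.map_idem, mul_zero])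

/-- The submodule `eM`, that is, the largest submodule which is a `T`-module in the sense that it is
annihilated by `1 - e`. -/
def corner (h : IsSplitTriangular φ ψ e) (M : Type u) [AddCommGroup M] [Module R M] :
    Submodule R M where
  carrier := {x | e • x = x}
  zero_mem' := smul_zero e
  add_mem' {x y} hx hy := (smul_add e x y).trans (congrArg₂ _ hx hy)
  smul_mem' r x (hx : e • x = x) := by
    show e • r • x = r • x
    rw [← hx, smul_smul r, smul_smul e, h.mul_mul_idem]

variable (h : IsSplitTriangular φ ψ e)

theorem mem_corner {M : Type u} [AddCommGroup M] [Module R M] {x : M} :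
    x ∈ h.corner M ↔ e • x = x := Iff.rfl

theorem smul_mem_corner {M : Type u} [AddCommGroup M] [Module R M] (x : M) : e • x ∈ h.corner M := by
  rw [mem_corner, smul_smul, h.idem]

/-- `Y` is the `T`-module `eM`. -/
def IsCorner (h : IsSplitTriangular φ ψ e) (Y : ModuleCat.{u} T) (M : ModuleCat.{u} R) : Prop :=
  Nonempty (res ψ Y ≃ₗ[R] h.corner M)

theorem kerSpan_eq_corner (M : Type u) [AddCommGroup M] [Module R M] :
    kerSpan φ M = h.corner M := by
  refine le_antisymm (Submodule.span_le.2 ?_) fun x hx => ?_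
  · rintro _ ⟨r, m, hr, rfl⟩
    show e • r • m = r • m
    rw [smul_smul, h.mul_of_map_eq_zero r hr]
  · exact Submodule.subset_span ⟨e, x, h.map_idem, hx⟩

theorem exists_isCorner (M : ModuleCat.{u} R) : ∃ Y, h.IsCorner Y M := by
  obtain ⟨Y, ⟨f⟩⟩ := exists_equiv_res h.surj_snd (ModuleCat.of R (h.corner M)) fun r hr x => by
    have hx : e • x = x := Subtype.ext x.2
    rw [← hx, smul_smul, (h.ker_snd r).1 hr, zero_smul]
  exact ⟨Y, ⟨f.symm⟩⟩

/-- The map `eM → eM'` induced by `M → M'`. -/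
def cornerMap {M M' : Type u} [AddCommGroup M] [Module R M] [AddCommGroup M'] [Module R M']
    (f : M →ₗ[R] M') : h.corner M →ₗ[R] h.corner M' :=
  f.restrict fun x (hx : e • x = x) => show e • f x = f x by rw [← map_smul, hx]

theorem isSummand_corner {M M' : ModuleCat.{u} R} (hs : IsSummand M M') {Y Y' : ModuleCat.{u} T}
    (hY : h.IsCorner Y M) (hY' : h.IsCorner Y' M') : IsSummand Y Y' := by
  obtain ⟨i, r, hir⟩ := isSummand_iff.1 hs
  obtain ⟨f⟩ := hY
  obtain ⟨f'⟩ := hY'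
  have hs' : IsSummand (res ψ Y) (res ψ Y') := by
    refine .of_retract (f'.symm.toLinearMap ∘ₗ h.cornerMap i ∘ₗ f.toLinearMap)
      (f.symm.toLinearMap ∘ₗ h.cornerMap r ∘ₗ f'.toLinearMap) fun x => ?_
    have : h.cornerMap r (h.cornerMap i (f x)) = f x := Subtype.ext (hir _)
    simp [this]
  obtain ⟨X, ⟨g⟩, hX⟩ := hs'.exists_of_res h.surj_snd
  exact (IsSummand.of_equiv (equiv_of_res_equiv h.surj_snd g).some).trans hX

theorem isCorner_congr {M M' : ModuleCat.{u} R} (f : M ≃ₗ[R] M') {Y : ModuleCat.{u} T}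
    (hY : h.IsCorner Y M) : h.IsCorner Y M' := by
  obtain ⟨g⟩ := hY
  let E : h.corner M ≃ₗ[R] h.corner M' :=
    { h.cornerMap f.toLinearMap with
      invFun := h.cornerMap f.symm.toLinearMap
      left_inv := fun _ => Subtype.ext (f.symm_apply_apply _)
      right_inv := fun _ => Subtype.ext (f.apply_symm_apply _) }
  exact ⟨g.trans E⟩

theorem isCorner_unique {M : ModuleCat.{u} R} {Y Y' : ModuleCat.{u} T}
    (hY : h.IsCorner Y M) (hY' : h.IsCorner Y' M) : Nonempty (Y ≃ₗ[T] Y') :=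
  equiv_of_res_equiv h.surj_snd (hY.some.trans hY'.some.symm)

theorem isCorner_pi {ι : Type} {M : ι → ModuleCat.{u} R} {Y : ι → ModuleCat.{u} T}
    (hY : ∀ i, h.IsCorner (Y i) (M i)) :
    h.IsCorner (ModuleCat.of T (∀ i, Y i)) (ModuleCat.of R (∀ i, M i)) := by
  obtain ⟨f⟩ := res_pi (φ := ψ) Y
  let E : (∀ i, h.corner (M i)) ≃ₗ[R] h.corner (∀ i, M i) :=
    { toFun := fun x => ⟨fun i => (x i).1, funext fun i => (x i).2⟩
      map_add' := fun _ _ => rfl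
      map_smul' := fun _ _ => rfl
      invFun := fun x i => ⟨x.1 i, congrFun x.2 i⟩
      left_inv := fun _ => rfl
      right_inv := fun _ => rfl }
  exact ⟨(f.trans (LinearEquiv.piCongrRight fun i => (hY i).some)).trans E⟩

/-- The block `T ≅ Re` is projective over `R`. -/
theorem projective_snd (h : IsSplitTriangular φ ψ e) :
    Module.Projective R (res ψ (ModuleCat.of T T)) := by
  choose s hs using h.surj_snd
  have key : ∀ r r', ψ r = ψ r' → r * e = r' * e := fun r r' hr => by
    rw [← sub_eq_zero, ← sub_mul]
    exact (h.ker_snd _).1 (by rw [map_sub, hr, sub_self])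
  let i : res ψ (ModuleCat.of T T) →ₗ[R] R :=
    { toFun := fun t => s (resMap ψ (ModuleCat.of T T) t : T) * e
      map_add' := fun t t' => by
        rw [← add_mul]
        refine key _ _ ?_
        rw [map_add ψ, hs, hs, hs, map_add]
      map_smul' := fun r t => by
        rw [RingHom.id_apply, smul_eq_mul, ← mul_assoc]
        refine key _ _ ?_
        rw [map_mul ψ, hs, hs, map_smulₛₗ]
        rfl }
  let q : R →ₗ[R] res ψ (ModuleCat.of T T) :=
    toRes ψ (M := ModuleCat.of R R) (N := ModuleCat.of T T)
      { toFun := fun r => ψ r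
        map_add' := map_add ψ
        map_smul' := map_mul ψ }
  refine Module.Projective.of_split i q (LinearMap.ext fun t => ?_)
  have he : ψ e = 1 := by
    have : ψ (1 - e) = 0 := (h.ker_snd _).2 (by rw [sub_mul, one_mul, h.idem, sub_self])
    rw [map_sub, map_one, sub_eq_zero] at this
    exact this.symm
  have : ψ (s (resMap ψ (ModuleCat.of T T) t : T) * e) = resMap ψ (ModuleCat.of T T) t := by
    rw [map_mul, he, mul_one, hs]
  exact this

theorem smul_jacobson (h : IsSplitTriangular φ ψ e) {P : ModuleCat.{u} R} [Module.Projective R P]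
    {x : P} (hx : x ∈ Module.jacobson R P) (r : R) : e • r • (x - e • x) = 0 := by
  obtain ⟨s, hs⟩ := Module.projective_def'.1 (inferInstance : Module.Projective R P)
  have hinj : Function.Injective s := Function.LeftInverse.injective
    (g := Finsupp.linearCombination R id) (LinearMap.congr_fun hs)
  refine hinj (Finsupp.ext fun p => ?_)
  have hp : s x p ∈ Ring.jacobson R :=
    Module.map_jacobson_le (Finsupp.lapply p ∘ₗ s) ⟨x, hx, rfl⟩
  have := h.mul_jacobson _ hp r
  simp only [map_smul, map_sub, map_zero, Finsupp.smul_apply, Finsupp.sub_apply, Finsupp.zero_apply,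
    smul_eq_mul]
  rw [← this]
  noncomm_ring

/-- The syzygy of `M` is the direct sum of the syzygy of the `S`-module `M/eM` and a `T`-module. -/
theorem syzygy_equiv {M K : ModuleCat.{u} R} (hK : IsSyzygy K M) {N : ModuleCat.{u} S}
    (q : M →ₛₗ[φ] N) (hq : Function.Surjective q) (hk : ∀ m, q m = 0 → m ∈ h.corner M)
    {Y : ModuleCat.{u} T} (hY : h.IsCorner Y K) :
    ∃ X, IsSyzygy X N ∧ Nonempty (K ≃ₗ[R] (res φ X × res ψ Y)) := by
  obtain ⟨P, f, hf, ⟨i⟩⟩ := hK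
  have := hf.2.1
  obtain ⟨P', qP, hqP, hkP⟩ := exists_quotient h.surj_fst P (kerSpan φ P)
    fun r hr m => Submodule.subset_span ⟨r, m, hr, rfl⟩
  obtain ⟨f', hf'⟩ := exists_factor h.surj_fst qP hqP (q.comp f)
    fun m hm => eq_zero_of_mem_kerSpan _ ((hkP m).1 hm)
  obtain ⟨hcov, hlift⟩ := hf.quotient h.surj_fst qP hqP (fun p => (hkP p).1) q hq
    (fun m hm => by rw [h.kerSpan_eq_corner]; exact hk m hm) f' hf'
  refine ⟨ModuleCat.of S (LinearMap.ker f'), ⟨P', f', hcov, ⟨.refl S _⟩⟩, ?_⟩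
  let L : ModuleCat.{u} R := ModuleCat.of R (LinearMap.ker f)
  let a : L →ₛₗ[φ] ModuleCat.of S (LinearMap.ker f') :=
    { toFun := fun x => ⟨qP x.1, by
        rw [LinearMap.mem_ker, hf', LinearMap.comp_apply, LinearMap.mem_ker.1 x.2, map_zero]⟩
      map_add' := fun x y => Subtype.ext (map_add qP x.1 y.1)
      map_smul' := fun r x => Subtype.ext (map_smulₛₗ qP r x.1) }
  -- On the radical of `P`, multiplication by `e` is linear.
  let b : L →ₗ[R] h.corner L :=
    { toFun := fun x => ⟨e • x, h.smul_mem_corner x⟩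
      map_add' := fun x y => Subtype.ext (smul_add e x y)
      map_smul' := fun r x => by
        have h₁ := h.smul_jacobson (hf.ker_le x.2) r
        have h₂ : e • r • e • x.1 = r • e • x.1 := by
          rw [smul_smul r, smul_smul e, h.mul_mul_idem]
        rw [smul_sub, smul_sub, h₂, sub_eq_zero] at h₁
        exact Subtype.ext (Subtype.ext h₁) }
  have ha : ∀ x, a x = 0 ↔ e • x = x := fun x => by
    have h₁ : a x = 0 ↔ qP x.1 = 0 := Subtype.ext_iff
    rw [h₁, hkP, h.kerSpan_eq_corner, mem_corner]
    exact (Subtype.ext_iff (a1 := e • x) (a2 := x)).symm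
  have hae : ∀ x, a (e • x) = 0 := fun x => by
    rw [map_smulₛₗ, h.map_idem, zero_smul]
  let E : L →ₗ[R] (res φ (ModuleCat.of S (LinearMap.ker f')) × h.corner L) := (toRes φ a).prod b
  have hE : Function.Bijective E := by
    constructor
    · refine (injective_iff_map_eq_zero E).2 fun x hx => ?_
      have h₁ : a x = 0 := congrArg Prod.fst hx
      have h₂ : e • x = 0 := congrArg (Subtype.val ∘ Prod.snd) hx
      rw [← (ha x).1 h₁, h₂]
    · rintro ⟨y, z⟩
      obtain ⟨p, hp, hpy⟩ := hlift (resMap φ _ y).1 (resMap φ _ y).2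
      let x : L := ⟨p, hp⟩
      have hz : e • (z : L) = z := z.2
      refine ⟨x - e • x + z, Prod.ext ?_ (Subtype.ext ?_)⟩
      · have h₁ : a x = resMap φ _ y := Subtype.ext hpy
        have h₂ : a (z : L) = 0 := (ha _).2 hz
        have h₃ : a (x - e • x + z) = resMap φ _ y := by
          rw [map_add, map_sub, hae, h₂, sub_zero, add_zero, h₁]
        exact h₃
      · show e • (x - e • x + z) = (z : L)
        rw [smul_add, smul_sub, smul_smul, h.idem, sub_self, zero_add, hz]
  obtain ⟨g⟩ := h.isCorner_congr (M' := L) i hY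
  exact ⟨(i.trans (LinearEquiv.ofBijective E hE)).trans ((LinearEquiv.refl R _).prodCongr g.symm)⟩

variable [IsArtinianRing R]

/-- For an `S`-module `N`, the `T`-module `eΩ(N)` is the same as for the top of `N`, and thus a direct
sum of summands of the `T`-module `eΩ(C₀)`, with `C₀` the sum of the simple modules. -/
theorem addClass_corner_syzygy {C₀ K₀ : ModuleCat.{u} R} {Y₀ : ModuleCat.{u} T}
    (hC₀ : IsSumOfSimples C₀) (hK₀ : IsSyzygy K₀ C₀) (hY₀ : h.IsCorner Y₀ K₀)
    {N : ModuleCat.{u} S} {K : ModuleCat.{u} R} (hK : IsSyzygy K (res φ N)) {Y : ModuleCat.{u} T}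
    (hY : h.IsCorner Y K) : addClass (· = Y₀) Y := by
  obtain ⟨P, f, hf, ⟨i⟩⟩ := hK
  have := hf.1
  have := hf.2.1
  have hYP : h.IsCorner Y (ModuleCat.of R (Module.jacobson R P)) := by
    obtain ⟨g⟩ := h.isCorner_congr (M' := ModuleCat.of R (LinearMap.ker f)) i hY
    refine ⟨g.trans (LinearEquiv.ofBijective
      (h.cornerMap (Submodule.inclusion hf.ker_le)) ⟨fun x y hxy => ?_, fun y => ?_⟩)⟩
    · have : x.1.1 = y.1.1 := congrArg (fun z => z.1.1) hxy
      exact Subtype.ext (Subtype.ext this)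
    · have hy : e • y.1.1 = y.1.1 := congrArg Subtype.val y.2
      have hy' : f y.1.1 = 0 := by rw [← hy, map_smul, res_smul_eq_zero h.map_idem]
      exact ⟨⟨⟨y.1.1, hy'⟩, Subtype.ext hy⟩, rfl⟩
  obtain ⟨n, Q, hQ, ⟨g⟩⟩ := exists_top_decomposition P
  have := hC₀.finite
  have key : ∀ j, ∃ L, IsSyzygy L (Q j) ∧ IsSummand L K₀ := fun j => by
    have hs := hC₀.isSummand (hQ j)
    have := hs.finite
    obtain ⟨L, hL⟩ := exists_isSyzygy (Q j)
    exact ⟨L, hL, hs.syzygy hL hK₀⟩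
  choose L hL hLs using key
  choose Z hZ using fun j => h.exists_isCorner (L j)
  obtain ⟨g'⟩ := (isSyzygy_jacobson P).unique (IsSyzygy.pi hL) g
  obtain ⟨g''⟩ := h.isCorner_unique (h.isCorner_congr g' hYP) (h.isCorner_pi hZ)
  exact ⟨n, Z, fun j => ⟨Y₀, rfl, h.isSummand_corner (hLs j) (hZ j) hY₀⟩, ⟨g''⟩⟩

variable [IsArtinianRing S] [IsArtinianRing T]

/-- The `n`-th syzygy over `R` of an `S`-module is the sum of its `n`-th syzygy over `S` and of
a `T`-module in the additive closure of a class closed under syzygies that contains `eΩ(C₀)`. -/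
theorem exists_nthSyzygy_res {orb : ModuleCat.{u} T → Prop} (hfin : ∀ X, orb X → Module.Finite T X)
    (hΩ : ∀ X K, orb X → IsSyzygy K X → orb K) {C₀ K₀ : ModuleCat.{u} R} {Y₀ : ModuleCat.{u} T}
    (hC₀ : IsSumOfSimples C₀) (hK₀ : IsSyzygy K₀ C₀) (hY₀ : h.IsCorner Y₀ K₀) (hY₀' : orb Y₀)
    {n : ℕ} {X N : ModuleCat.{u} S} [Module.Finite S N] (hX : IsNthSyzygy n X N) :
    ∃ Z, addClass orb Z ∧ IsNthSyzygy n (ModuleCat.of R (res φ X × res ψ Z)) (res φ N) := by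
  induction n generalizing N with
  | zero =>
    let Z : ModuleCat.{u} T := ModuleCat.of T PUnit.{u + 1}
    have : Subsingleton Z := inferInstanceAs (Subsingleton PUnit.{u + 1})
    have : Subsingleton (res ψ Z) := inferInstanceAs (Subsingleton PUnit.{u + 1})
    have : Unique (res ψ Z) := uniqueOfSubsingleton 0
    obtain ⟨f⟩ := res_congr (φ := φ) hX.some
    exact ⟨Z, addClass_of_subsingleton, ⟨(LinearEquiv.prodUnique (M₂ := res ψ Z)).trans f⟩⟩
  | succ n ih =>
    obtain ⟨L, hL, hX⟩ := hX
    have := hL.finite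
    obtain ⟨Z, hZ, hZn⟩ := ih hX
    have := finite_res h.surj_fst N
    obtain ⟨K, hK⟩ := exists_isSyzygy (res φ N)
    obtain ⟨Y, hY⟩ := h.exists_isCorner K
    obtain ⟨L', hL', ⟨f⟩⟩ := h.syzygy_equiv hK (resMap φ N) (resMap_bijective φ N).2
      (fun m hm => by rw [show m = 0 from hm]; exact zero_mem _) hY
    have hYadd : addClass orb Y := (h.addClass_corner_syzygy hC₀ hK₀ hY₀ hK hY).mono
      (by rintro M rfl; exact ⟨M, hY₀', .refl _⟩)
    have := hYadd.finite hfin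
    obtain ⟨Y', hY'⟩ := exists_isNthSyzygy n Y
    obtain ⟨g⟩ := hL.unique hL' (.refl S _)
    obtain ⟨g'⟩ := res_congr (φ := φ) g
    obtain ⟨r⟩ := res_prod (φ := ψ) Z Y'
    refine ⟨ModuleCat.of T (Z × Y'), hZ.prod (hYadd.nthSyzygy hfin hΩ hY'), K, hK, ?_⟩
    refine (hZn.prod (hY'.res h.surj_snd h.projective_snd)).congr
      (((LinearEquiv.refl R _).prodCongr r).trans (LinearEquiv.prodAssoc R _ _ _).symm) ?_
    exact (g'.prodCongr (.refl R _)).trans f.symm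

/-- The Igusa-Todorov property of `S` and the Lat-Igusa-Todorov property of `T` combine to
one for `R`, if the `T`-modules in the additive closure of `orb` are in `add O`. -/
theorem isLIT {orb : ModuleCat.{u} T → Prop} (hfin : ∀ X, orb X → Module.Finite T X)
    (hΩ : ∀ X K, orb X → IsSyzygy K X → orb K)
    (horb : ∀ C₀ K₀, IsSumOfSimples C₀ → IsSyzygy K₀ C₀ → ∃ Y₀, h.IsCorner Y₀ K₀ ∧ orb Y₀)
    {n : ℕ} {W : ModuleCat.{u} S} (hW : IsITModule n W) {V : ModuleCat.{u} T}
    {𝒟 : ModuleCat.{u} T → Prop} (hV : IsLIT n V 𝒟) {U : ModuleCat.{u} R} (hU : Module.Finite R U)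
    (hUV : IsSummand (res ψ V) U) (hUW : IsSummand (res φ W) U)
    (hUO : ∀ Z, addClass orb Z → addClass (· = U) (res ψ Z)) : IsLIT (n + 1) U (resClass ψ 𝒟) where
  finite := hU
  zeroIT := hV.zeroIT.res h.surj_snd h.projective_snd
  exact_seq M hM := by
    obtain ⟨C₀, hC₀⟩ := exists_isSumOfSimples (R := R)
    have := hC₀.finite
    obtain ⟨K₀, hK₀⟩ := exists_isSyzygy C₀
    obtain ⟨Y₀, hY₀, hY₀'⟩ := horb C₀ K₀ hC₀ hK₀
    obtain ⟨K, hK⟩ := exists_isSyzygy M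
    have := hK.finite
    obtain ⟨N, q, hq, hk⟩ := exists_quotient h.surj_fst M (kerSpan φ M)
      fun r hr m => Submodule.subset_span ⟨r, m, hr, rfl⟩
    obtain ⟨Y, hY⟩ := h.exists_isCorner K
    obtain ⟨X, hX, ⟨f⟩⟩ := h.syzygy_equiv hK q hq
      (fun m hm => by rw [← h.kerSpan_eq_corner]; exact (hk m).1 hm) hY
    have hXf : Module.Finite S X := by
      refine finite_of_semilinear (M := K) h.surj_fst
        ((resMap φ X).comp (LinearMap.fst R _ _ ∘ₗ f.toLinearMap)) ?_
      exact (resMap_bijective φ X).2.comp (Prod.fst_surjective.comp f.surjective)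
    have hYf : Module.Finite T Y := by
      refine finite_of_semilinear (M := K) h.surj_snd
        ((resMap ψ Y).comp (LinearMap.snd R _ _ ∘ₗ f.toLinearMap)) ?_
      exact (resMap_bijective ψ Y).2.comp (Prod.snd_surjective.comp f.surjective)
    obtain ⟨KS, hKS, seqS⟩ : ∃ KS, IsNthSyzygy n KS X ∧
        HasLITSequence W (fun D => Subsingleton D) KS := by
      obtain ⟨KS, V₀, V₁, D₀, D₁, h₁, h₂⟩ := hW.exact_seq X hXf
      exact ⟨KS, h₁, V₀, V₁, D₀, D₁, h₂⟩
    obtain ⟨KT, hKT, seqT⟩ : ∃ KT, IsNthSyzygy n KT Y ∧ HasLITSequence V 𝒟 KT := by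
      obtain ⟨KT, V₀, V₁, D₀, D₁, h₁, h₂⟩ := hV.exact_seq Y hYf
      exact ⟨KT, h₁, V₀, V₁, D₀, D₁, h₂⟩
    obtain ⟨Z, hZ, hZn⟩ := h.exists_nthSyzygy_res hfin hΩ hC₀ hK₀ hY₀ hY₀' hKS
    have h𝒟 := (hV.zeroIT.res h.surj_snd h.projective_snd).add_eq
    have hzero : ∀ D : ModuleCat.{u} R, Subsingleton D → resClass ψ 𝒟 D := fun D hD =>
      (h𝒟 D).2 addClass_of_subsingleton
    have hprod : ∀ D D', resClass ψ 𝒟 D → resClass ψ 𝒟 D' →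
        resClass ψ 𝒟 (ModuleCat.of R (D × D')) := fun D D' hD hD' =>
      (h𝒟 _).2 (((h𝒟 D).1 hD).prod ((h𝒟 D').1 hD'))
    have s₁ : HasLITSequence U (resClass ψ 𝒟) (res φ KS) := seqS.res.mono hUW fun D hD => by
      obtain ⟨D', hD', ⟨g⟩⟩ := hD
      have : Subsingleton (res φ D') := hD'
      exact hzero D g.toEquiv.subsingleton
    have s₂ : HasLITSequence U (resClass ψ 𝒟) (res ψ KT) := seqT.res.mono hUV fun D hD => hD
    have s₃ : HasLITSequence U (resClass ψ 𝒟) (res ψ Z) :=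
      .of_addClass (Z := ModuleCat.of R PUnit.{u + 1}) (hUO Z hZ)
        (hzero _ (inferInstanceAs (Subsingleton PUnit.{u + 1})))
    obtain ⟨V₀, V₁, D₀, D₁, hs⟩ := (s₁.prod hprod s₃).prod hprod s₂
    refine ⟨_, V₀, V₁, D₀, D₁, ⟨K, hK, ?_⟩, hs⟩
    exact (hZn.prod (hKT.res h.surj_snd h.projective_snd)).congr (.refl R _) f.symm

end IsSplitTriangular

end Triangular

/-! ### The augmentations of a bound quiver algebra -/

section Augmentation

open Quiver PathAlgebra

variable {k : Type u} [Field k] {V : Type u} [Quiver.{u} V] [Fintype V]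

open Classical in
/-- The algebra map `kQ → k` that sends a path to `1` if it is the trivial path at `v` and to `0`
otherwise. -/
noncomputable def augmentation (k : Type u) [Field k] {V : Type u} [Quiver.{u} V] [Fintype V]
    (v : V) : PathAlgebra k V →ₐ[k] k :=
  lift (fun a => if a = v then 1 else 0) (fun _ _ _ => 0) (by simp) (by aesop) (by simp) (by simp)

theorem augmentation_ofPath_cons (v : V) {a b c : V} (p : Path a b) (f : b ⟶ c) :
    augmentation k v (ofPath k (p.cons f)) = 0 := by
  rw [augmentation, lift_ofPath, evalPath, mul_zero]

open Classical in
theorem augmentation_vertex (v a : V) :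
    augmentation k v (vertex k a) = if a = v then 1 else 0 := by
  rw [augmentation, vertex, lift_ofPath, evalPath]

theorem augmentation_eq_coeff (v : V) (x : PathAlgebra k V) :
    augmentation k v x = coeff x ⟨v, v, Path.nil⟩ := by
  classical
  refine path_induction (P := fun x => augmentation k v x = coeff x ⟨v, v, Path.nil⟩)
    (map_zero _) (fun x y hx hy => by rw [map_add, hx, hy]; rfl) (fun c a b p => ?_) x
  have hc : coeff (c • ofPath k p) ⟨v, v, Path.nil⟩ = c * coeff (ofPath k p) ⟨v, v, Path.nil⟩ := rfl
  have hs : coeff (ofPath k p) ⟨v, v, Path.nil⟩ =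
      if (⟨a, b, p⟩ : QPath V) = ⟨v, v, Path.nil⟩ then 1 else 0 := Finsupp.single_apply
  rw [map_smul, hc, smul_eq_mul, hs]
  congr 1
  cases p with
  | nil =>
    rw [show (ofPath k Path.nil : PathAlgebra k V) = vertex k a from rfl, augmentation_vertex]
    refine if_congr ⟨?_, ?_⟩ rfl rfl
    · rintro rfl
      rfl
    · intro h
      exact congrArg Sigma.fst h
  | cons q f =>
    rw [augmentation_ofPath_cons, if_neg]
    intro h
    have := congrArg (fun p : QPath V => p.2.2.length) h
    simp at this

variable (I : Ideal (PathAlgebra k V)) [hI : IsAdmissible I]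

theorem augmentation_eq_zero (v : V) {x : PathAlgebra k V} (hx : x ∈ I) :
    augmentation k v x = 0 := by
  rw [augmentation_eq_coeff]
  by_contra h
  exact absurd (hI.le_sq x hx _ h) (by simp)

/-- The radical of a bound quiver algebra is contained in the ideal of the arrows. -/
theorem augmentation_eq_zero_of_mem_jacobson (v : V) {x : PathAlgebra k V}
    (hx : MulOpposite.op (Ideal.Quotient.mk I x) ∈ Ring.jacobson (PathAlgebra k V ⧸ I)ᵐᵒᵖ) :
    augmentation k v x = 0 := by
  let ε : (PathAlgebra k V ⧸ I) →+* k :=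
    Ideal.Quotient.lift I (augmentation k v : PathAlgebra k V →+* k)
      fun x hx => augmentation_eq_zero I v hx
  have hsurj : Function.Surjective (RingHom.op ε) := fun c =>
    ⟨MulOpposite.op (Ideal.Quotient.mk I (algebraMap k _ c.unop)), by
      refine MulOpposite.unop_injective ?_
      exact (augmentation k v).commutes c.unop⟩
  have : RingHomSurjective (RingHom.op ε) := ⟨hsurj⟩
  have h := Ring.le_comap_jacobson (RingHom.op ε) hx
  rw [IsSemisimpleRing.jacobson_eq_bot] at h
  exact congrArg MulOpposite.unop ((Submodule.mem_bot _).1 (Ideal.mem_comap.1 h))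

end Augmentation

/-! ### The glued algebra is triangular with split radical -/

section Glued

open Quiver PathAlgebra

variable {k : Type u} [Field k] {VA VB : Type u} [Quiver.{u} VA] [Quiver.{u} VB]
  [Fintype VA] [Fintype VB] {J : VA → VB → Type u}

theorem Glue.eA_add_eB : Glue.eA k VA VB J + Glue.eB k VA VB J = 1 := by
  rw [Glue.eA_eq, Glue.eB_eq, one_def, ← Equiv.sum_comp (Glue.equivSum VA VB J),
    Fintype.sum_sum_type]
  rfl

theorem Glue.eB_mul_mul_eA (x : PathAlgebra k (Glue VA VB J)) :
    Glue.eB k VA VB J * x * Glue.eA k VA VB J = 0 := by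
  refine path_induction (P := fun x => Glue.eB k VA VB J * x * Glue.eA k VA VB J = 0) (by simp)
    (fun x y hx hy => by rw [mul_add, add_mul, hx, hy, add_zero]) (fun c a b p => ?_) x
  rw [mul_smul_comm, smul_mul_assoc]
  cases b with
  | inl b => rw [Glue.eB_mul_inl p b rfl, zero_mul, smul_zero]
  | inr b => rw [mul_assoc, Glue.ofPath_mul_eA', mul_zero, smul_zero]

variable {IA : Ideal (PathAlgebra k VA)} {IB : Ideal (PathAlgebra k VB)}
  {IC : Ideal (PathAlgebra k (Glue VA VB J))}

/-- A nontrivial path inside `Q_A` followed by a new arrow lies in `I_C`. -/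
theorem IsGluing.path_mul_cross [IC.IsTwoSided] (h : IsGluing IA IB IC) {x : Glue VA VB J} {a : VA}
    {b : VB} (p : Path x (Glue.inl a : Glue VA VB J)) (hp : 0 < p.length) (j : J a b) :
    ofPath k p * arrow k (Glue.cross j) ∈ IC := by
  match p, hp with
  | Path.cons (b := Glue.inl a') p f, _ =>
    rw [ofPath_cons, mul_assoc]
    exact IC.mul_mem_left _ (h.arrow_mul_cross a' a b f j)
  | Path.cons (b := Glue.inr _) p f, _ => exact f.elim

/-- A nontrivial path inside `Q_A` followed by a path from `Q_A` to `Q_B` lies in `I_C`. -/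
theorem IsGluing.path_mul_path [IC.IsTwoSided] (h : IsGluing IA IB IC) {x : Glue VA VB J} {a : VA}
    (p : Path x (Glue.inl a : Glue VA VB J)) (hp : 0 < p.length) :
    ∀ {y : Glue VA VB J} (q : Path (Glue.inl a : Glue VA VB J) y) (b : VB), y = Glue.inr b →
      ofPath k p * ofPath k q ∈ IC
  | _, Path.cons (b := Glue.inl a') q f, b, hy => by
    subst hy
    rw [ofPath_cons, ← mul_assoc, ofPath_mul_ofPath]
    exact h.path_mul_cross (p.comp q) (by rw [Path.length_comp]; omega) f
  | _, Path.cons (b := Glue.inr b') q f, b, hy => by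
    rw [ofPath_cons, ← mul_assoc]
    exact IC.mul_mem_right _ (h.path_mul_path p hp q b' rfl)

theorem IsGluing.cons_mul_mem [IC.IsTwoSided] (h : IsGluing IA IB IC) {x y z : Glue VA VB J}
    (p : Path x y) (f : y ⟶ z) (w : PathAlgebra k (Glue VA VB J)) :
    ofPath k (p.cons f) * (Glue.eA k VA VB J * w * Glue.eB k VA VB J) ∈ IC := by
  refine path_induction (P := fun w => ofPath k (p.cons f) *
    (Glue.eA k VA VB J * w * Glue.eB k VA VB J) ∈ IC) (by simp)
    (fun w w' hw hw' => by
      rw [mul_add, add_mul, mul_add]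
      exact add_mem hw hw') (fun c s t q => ?_) w
  rw [← mul_assoc, ← mul_assoc]
  obtain a | b := z
  · rw [Glue.ofPath_mul_eA, mul_smul_comm, smul_mul_assoc]
    refine Submodule.smul_of_tower_mem _ c ?_
    obtain a' | b' := t
    · rw [mul_assoc, Glue.ofPath_mul_eB', mul_zero]
      exact zero_mem _
    · rw [mul_assoc, Glue.ofPath_mul_eB]
      by_cases hs : s = Glue.inl a
      · subst hs
        exact h.path_mul_path _ (by simp) q b' rfl
      · rw [ofPath_mul_ofPath_of_ne _ _ hs]
        exact zero_mem _
  · rw [Glue.ofPath_mul_eA', zero_mul, zero_mul]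
    exact zero_mem _

/-- The ideal of the arrows annihilates the off-diagonal block of the glued algebra. -/
theorem IsGluing.mul_mem_of_augmentation [IC.IsTwoSided] (h : IsGluing IA IB IC)
    {x : PathAlgebra k (Glue VA VB J)} (hx : ∀ v, augmentation k v x = 0)
    (w : PathAlgebra k (Glue VA VB J)) :
    x * (Glue.eA k VA VB J * w * Glue.eB k VA VB J) ∈ IC := by
  classical
  have key : (x - ∑ v, augmentation k v x • vertex k v) *
      (Glue.eA k VA VB J * w * Glue.eB k VA VB J) ∈ IC := by
    refine path_induction (P := fun x => (x - ∑ v, augmentation k v x • vertex k v) *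
      (Glue.eA k VA VB J * w * Glue.eB k VA VB J) ∈ IC) (by simp)
      (fun x y hx hy => ?_) (fun c s t p => ?_) x
    · have := add_mem hx hy
      rw [← add_mul] at this
      convert this using 2
      simp only [map_add, add_smul, Finset.sum_add_distrib]
      abel
    · cases p with
      | nil =>
        have : ∑ v, augmentation k v (c • vertex k s) • vertex k v = c • vertex k s := by
          rw [Finset.sum_eq_single s]
          · rw [map_smul, augmentation_vertex, if_pos rfl, smul_eq_mul, mul_one]
          · intro v _ hv
            rw [map_smul, augmentation_vertex, if_neg (Ne.symm hv), smul_zero, zero_smul]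
          · simp
        rw [show (ofPath k Path.nil : PathAlgebra k (Glue VA VB J)) = vertex k s from rfl, this,
          sub_self, zero_mul]
        exact zero_mem _
      | cons p f =>
        simp only [map_smul, augmentation_ofPath_cons, smul_zero, zero_smul, Finset.sum_const_zero,
          sub_zero, smul_mul_assoc]
        exact Submodule.smul_of_tower_mem _ c (h.cons_mul_mem p f w)
  simpa [hx] using key

theorem IsGluing.ofB_toB [IB.IsTwoSided] [IC.IsTwoSided] (h : IsGluing IA IB IC) (c : PathAlgebra k (Glue VA VB J) ⧸ IC) :
    h.ofB (h.toB c) = h.ofB 1 * c := by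
  obtain ⟨x, rfl⟩ := Ideal.Quotient.mk_surjective c
  have h₁ : h.ofB (h.toB (Ideal.Quotient.mk IC x)) =
      Ideal.Quotient.mk IC (PathAlgebra.map k (Glue.inB VA VB J) (Glue.projB k VA VB J x)) := rfl
  have h₂ : h.ofB 1 = Ideal.Quotient.mk IC (Glue.eB k VA VB J) := rfl
  have h₃ : Glue.eB k VA VB J * x * Glue.eB k VA VB J = Glue.eB k VA VB J * x := by
    have := Glue.eB_mul_mul_eA x
    rw [← add_zero (_ * Glue.eB k VA VB J), ← this, ← mul_add, add_comm, Glue.eA_add_eB, mul_one]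
  rw [h₁, h₂, Glue.map_projB, h₃, map_mul]

variable [hIA : IsAdmissible IA] [hIB : IsAdmissible IB] [hIC : IsAdmissible IC]
  (h : IsGluing IA IB IC)

theorem IsGluing.isSplitTriangular :
    IsSplitTriangular (RingHom.op h.toA) (RingHom.op h.toB) (MulOpposite.op (h.ofB 1)) where
  surj_fst s := by
    obtain ⟨y, hy⟩ := Ideal.Quotient.mk_surjective s.unop
    refine ⟨MulOpposite.op (Ideal.Quotient.mk IC (PathAlgebra.map k (Glue.inA VA VB J) y)),
      MulOpposite.unop_injective ?_⟩
    refine Eq.trans (Ideal.Quotient.eq.2 (h.corner_A _ ?_)) hy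
    rw [map_sub]
    have : PathAlgebra.map k (Glue.inA VA VB J) (Glue.projA k VA VB J
        (PathAlgebra.map k (Glue.inA VA VB J) y)) = PathAlgebra.map k (Glue.inA VA VB J) y := by
      rw [Glue.map_projA, Glue.eA, ← map_mul_of_injective _ Glue.inl_injective, one_mul,
        ← map_mul_of_injective _ Glue.inl_injective, mul_one]
    exact (sub_eq_zero.2 this).symm ▸ zero_mem _
  surj_snd s := by
    obtain ⟨y, hy⟩ := Ideal.Quotient.mk_surjective s.unop
    refine ⟨MulOpposite.op (Ideal.Quotient.mk IC (PathAlgebra.map k (Glue.inB VA VB J) y)),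
      MulOpposite.unop_injective ?_⟩
    refine Eq.trans (Ideal.Quotient.eq.2 (h.corner_B _ ?_)) hy
    rw [map_sub]
    have : PathAlgebra.map k (Glue.inB VA VB J) (Glue.projB k VA VB J
        (PathAlgebra.map k (Glue.inB VA VB J) y)) = PathAlgebra.map k (Glue.inB VA VB J) y := by
      rw [Glue.map_projB, Glue.eB, ← map_mul_of_injective _ Glue.inr_injective, one_mul,
        ← map_mul_of_injective _ Glue.inr_injective, mul_one]
    exact (sub_eq_zero.2 this).symm ▸ zero_mem _
  map_idem := by
    refine MulOpposite.unop_injective ?_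
    refine Ideal.Quotient.eq_zero_iff_mem.2 (h.corner_A _ ?_)
    have : PathAlgebra.map k (Glue.inA VA VB J) (Glue.projA k VA VB J (Glue.eB k VA VB J)) = 0 := by
      rw [Glue.map_projA, Glue.eB_eq, Finset.mul_sum,
        Finset.sum_eq_zero (fun b _ => Glue.eA_mul_vertex_inr b), zero_mul]
    exact this.symm ▸ zero_mem _
  mul_of_map_eq_zero r hr := by
    obtain ⟨x, hx⟩ := Ideal.Quotient.mk_surjective r.unop
    have hr' : h.toA r.unop = 0 := congrArg MulOpposite.unop hr
    rw [← hx] at hr'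
    have hmem := h.map_A _ (Ideal.Quotient.eq_zero_iff_mem.1 hr')
    have hxA : PathAlgebra.map k (Glue.inA VA VB J) (Glue.projA k VA VB J x) =
        x * Glue.eA k VA VB J := by
      rw [Glue.map_projA, ← add_zero (_ * Glue.eA k VA VB J), ← Glue.eB_mul_mul_eA x, ← add_mul,
        ← add_mul, Glue.eA_add_eB, one_mul]
    have hxA' : x * Glue.eA k VA VB J ∈ IC := hxA ▸ hmem
    refine MulOpposite.unop_injective ?_
    show r.unop * h.ofB 1 = r.unop
    rw [← hx, show h.ofB 1 = Ideal.Quotient.mk IC (Glue.eB k VA VB J) from rfl, ← map_mul]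
    refine (Ideal.Quotient.eq.2 ?_).symm
    have : x - x * Glue.eB k VA VB J = x * Glue.eA k VA VB J := by
      rw [sub_eq_iff_eq_add, ← mul_add, Glue.eA_add_eB, mul_one]
    rwa [this]
  ker_snd r := by
    have hinj : ∀ y, h.ofB y = 0 → y = 0 := fun y hy => by
      obtain ⟨y, rfl⟩ := Ideal.Quotient.mk_surjective y
      exact Ideal.Quotient.eq_zero_iff_mem.2 (h.corner_B y (Ideal.Quotient.eq_zero_iff_mem.1 hy))
    have h₁ : RingHom.op h.toB r = 0 ↔ h.toB r.unop = 0 := MulOpposite.unop_inj.symm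
    have h₂ : r * MulOpposite.op (h.ofB 1) = 0 ↔ h.ofB 1 * r.unop = 0 := MulOpposite.unop_inj.symm
    rw [h₁, h₂, ← h.ofB_toB]
    exact ⟨fun h0 => by rw [h0, map_zero], hinj _⟩
  mul_jacobson x hx r := by
    obtain ⟨y, hy⟩ := Ideal.Quotient.mk_surjective x.unop
    obtain ⟨w, hw⟩ := Ideal.Quotient.mk_surjective r.unop
    have hxy : x = MulOpposite.op (Ideal.Quotient.mk IC y) := MulOpposite.unop_injective hy.symm
    rw [hxy] at hx
    have hmem := h.mul_mem_of_augmentation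
      (fun v => augmentation_eq_zero_of_mem_jacobson IC v hx) w
    refine MulOpposite.unop_injective ?_
    show x.unop * ((1 - h.ofB 1) * (r.unop * h.ofB 1)) = 0
    have he : (1 : PathAlgebra k (Glue VA VB J) ⧸ IC) - h.ofB 1 =
        Ideal.Quotient.mk IC (Glue.eA k VA VB J) := by
      rw [show h.ofB 1 = Ideal.Quotient.mk IC (Glue.eB k VA VB J) from rfl, sub_eq_iff_eq_add,
        ← map_add, Glue.eA_add_eB, map_one]
    rw [he, ← hy, ← hw, show h.ofB 1 = Ideal.Quotient.mk IC (Glue.eB k VA VB J) from rfl,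
      ← map_mul, ← map_mul, ← map_mul, ← mul_assoc (Glue.eA k VA VB J)]
    exact Ideal.Quotient.eq_zero_iff_mem.2 hmem

theorem IsGluing.isCorner_PiB (M : ModuleCat.{u} (PathAlgebra k (Glue VA VB J) ⧸ IC)ᵐᵒᵖ) :
    h.isSplitTriangular.IsCorner (h.PiB M) M := by
  let q : h.PiB M →+ h.isSplitTriangular.corner M :=
    { toFun := fun x => ⟨x.1, x.2⟩
      map_zero' := rfl
      map_add' := fun _ _ => rfl }
  refine ⟨(LinearEquiv.ofBijective
    { toFun := fun x => q (resMap (RingHom.op h.toB) _ x)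
      map_add' := fun _ _ => rfl
      map_smul' := fun r x => Subtype.ext ?_ } ⟨fun x y hxy => ?_, fun y => ⟨⟨y.1, y.2⟩, rfl⟩⟩)⟩
  · let x' : h.PiB M := resMap (RingHom.op h.toB) _ x
    show MulOpposite.op (h.ofB (h.toB r.unop)) • x'.1 = r • x'.1
    have hx : MulOpposite.op (h.ofB 1) • x'.1 = x'.1 := x'.2
    have h₁ : MulOpposite.op (h.ofB (h.toB r.unop)) = r * MulOpposite.op (h.ofB 1) := by
      rw [h.ofB_toB]
      rfl
    rw [h₁, mul_smul, hx]
  · exact Subtype.ext (congrArg Subtype.val hxy)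

end Glued

/-! ### Lat-Igusa-Todorov algebras from gluing -/

section Main

open PathAlgebra

variable {k : Type u} [Field k] {VA VB : Type u} [Quiver.{u} VA] [Quiver.{u} VB]
  [Fintype VA] [Fintype VB] {J : VA → VB → Type u} {IA : Ideal (PathAlgebra k VA)}
  {IB : Ideal (PathAlgebra k VB)} {IC : Ideal (PathAlgebra k (Glue VA VB J))}

theorem IsGluing.orbit_syzygy [IB.IsTwoSided] [IC.IsTwoSided] (h : IsGluing IA IB IC)
   {X K : ModuleCat.{u} (PathAlgebra k VB ⧸ IB)ᵐᵒᵖ} (hX : h.orbit X)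
    (hK : IsSyzygy K X) : h.orbit K := by
  obtain ⟨C₀, K₀, hC₀, hK₀, n, hn⟩ := hX
  exact ⟨C₀, K₀, hC₀, hK₀, n + 1, hn.succ_right hK⟩

variable [∀ a a' : VA, Finite (a ⟶ a')] [∀ b b' : VB, Finite (b ⟶ b')] [∀ a b, Finite (J a b)]
  [IsAdmissible IA] [IsAdmissible IB] [IsAdmissible IC] (h : IsGluing IA IB IC)

theorem IsGluing.orbit_finite {X : ModuleCat.{u} (PathAlgebra k VB ⧸ IB)ᵐᵒᵖ} (hX : h.orbit X) :
    Module.Finite (PathAlgebra k VB ⧸ IB)ᵐᵒᵖ X := by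
  obtain ⟨C₀, K, -, hK, n, hn⟩ := hX
  have := hK.finite
  obtain ⟨f⟩ := h.isCorner_PiB K
  have := isNoetherian_of_isNoetherianRing_of_finite (PathAlgebra k (Glue VA VB J) ⧸ IC)ᵐᵒᵖ K
  have := Module.Finite.equiv f.symm
  exact hn.finite (finite_of_semilinear h.isSplitTriangular.surj_snd (resMap _ (h.PiB K))
    (resMap_bijective _ _).2)

/-- The modules in the additive closure of the orbit are sums of the modules `Oᵢ`. -/
theorem IsGluing.addClass_of_orbit {m : ℕ}
    {O : Fin m → ModuleCat.{u} (PathAlgebra k (Glue VA VB J) ⧸ IC)ᵐᵒᵖ} (hO : h.IsRepSystem O)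
    {U : ModuleCat.{u} (PathAlgebra k (Glue VA VB J) ⧸ IC)ᵐᵒᵖ} (hU : ∀ i, IsSummand (O i) U)
    {Z : ModuleCat.{u} (PathAlgebra k VB ⧸ IB)ᵐᵒᵖ} (hZ : addClass h.orbit Z) :
    addClass (· = U) (h.inflB Z) := by
  have := hZ.finite fun X hX => h.orbit_finite hX
  have : Module.Finite (PathAlgebra k (Glue VA VB J) ⧸ IC)ᵐᵒᵖ (h.inflB Z) :=
    finite_res h.isSplitTriangular.surj_snd Z
  have : IsArtinian (PathAlgebra k (Glue VA VB J) ⧸ IC)ᵐᵒᵖ (h.inflB Z) :=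
    isArtinian_of_fg_of_artinian'
  have := isNoetherian_of_isNoetherianRing_of_finite
    (PathAlgebra k (Glue VA VB J) ⧸ IC)ᵐᵒᵖ (h.inflB Z)
  obtain ⟨ι, _, S, hS, ⟨e⟩⟩ := exists_indecomposable_decomposition (h.inflB Z)
  classical
  refine addClass_of_pi (𝒞 := (· = U)) S (fun i => ⟨U, rfl, ?_⟩) e
  have hs : IsSummand (S i) (h.inflB Z) := (IsSummand.pi S i).trans (.of_equiv e.symm)
  obtain ⟨j, ⟨f⟩⟩ := hO.complete (S i) (hS i) ⟨hs.finite, AddSubgroup.subset_closure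
    ⟨S i, hs.finite, ⟨h.inflB Z, ⟨Z, hZ, ⟨.refl _ _⟩⟩, hs⟩, rfl⟩⟩
  exact (IsSummand.of_equiv f).trans (hU j)

theorem IsGluing.isLIT_litModule {n : ℕ} {W : ModuleCat.{u} (PathAlgebra k VA ⧸ IA)ᵐᵒᵖ}
    {V : ModuleCat.{u} (PathAlgebra k VB ⧸ IB)ᵐᵒᵖ}
    {𝒟 : ModuleCat.{u} (PathAlgebra k VB ⧸ IB)ᵐᵒᵖ → Prop} (hW : IsITModule n W)
    (hV : IsLIT n V 𝒟) {m : ℕ}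
    {O : Fin m → ModuleCat.{u} (PathAlgebra k (Glue VA VB J) ⧸ IC)ᵐᵒᵖ} (hO : h.IsRepSystem O) :
    IsLIT (n + 1) (h.litModule V W O) (h.inflClassB 𝒟) := by
  have t := h.isSplitTriangular
  have := hV.finite
  have := hW.finite
  have fV : Module.Finite (PathAlgebra k (Glue VA VB J) ⧸ IC)ᵐᵒᵖ (h.inflB V) := finite_res t.surj_snd V
  have fW : Module.Finite (PathAlgebra k (Glue VA VB J) ⧸ IC)ᵐᵒᵖ (h.inflA W) := finite_res t.surj_fst W
  have : Module.Finite (PathAlgebra k VA ⧸ IA)ᵐᵒᵖ (PathAlgebra k VA ⧸ IA) :=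
    ⟨⟨{1}, eq_top_iff.2 fun a _ => by
      rw [Finset.coe_singleton, Submodule.mem_span_singleton]
      exact ⟨MulOpposite.op a, one_mul a⟩⟩⟩
  have fA : Module.Finite (PathAlgebra k (Glue VA VB J) ⧸ IC)ᵐᵒᵖ (h.inflA (ModuleCat.of _ (PathAlgebra k VA ⧸ IA))) :=
    finite_res t.surj_fst (ModuleCat.of (PathAlgebra k VA ⧸ IA)ᵐᵒᵖ (PathAlgebra k VA ⧸ IA))
  have fO : ∀ i, Module.Finite (PathAlgebra k (Glue VA VB J) ⧸ IC)ᵐᵒᵖ (O i) := fun i => (hO.mem i).2.choose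
  let U₁ := ModuleCat.of (PathAlgebra k (Glue VA VB J) ⧸ IC)ᵐᵒᵖ (∀ i, O i)
  let U₂ := ModuleCat.of (PathAlgebra k (Glue VA VB J) ⧸ IC)ᵐᵒᵖ
    (h.inflA (ModuleCat.of _ (PathAlgebra k VA ⧸ IA)) × U₁)
  let U₃ := ModuleCat.of (PathAlgebra k (Glue VA VB J) ⧸ IC)ᵐᵒᵖ (h.inflA W × U₂)
  have s₃ : IsSummand U₃ (h.litModule V W O) := .prod_right (h.inflB V) U₃
  have s₁ : IsSummand U₁ (h.litModule V W O) :=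
    ((IsSummand.prod_right _ U₁).trans (.prod_right (h.inflA W) U₂)).trans s₃
  refine t.isLIT (orb := h.orbit) (fun X => h.orbit_finite) (fun X K => h.orbit_syzygy)
    (fun C₀ K₀ hC₀ hK₀ => ⟨h.PiB K₀, h.isCorner_PiB K₀, C₀, K₀, hC₀, hK₀, 0, ⟨.refl _ _⟩⟩) hW hV
    (U := h.litModule V W O) ?_ (.prod_left (h.inflB V) U₃)
    ((IsSummand.prod_left (h.inflA W) U₂).trans s₃)
    (fun Z => h.addClass_of_orbit hO fun i => (IsSummand.pi O i).trans s₁)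
  exact inferInstanceAs (Module.Finite (PathAlgebra k (Glue VA VB J) ⧸ IC)ᵐᵒᵖ (h.inflB V × h.inflA W ×
    h.inflA (ModuleCat.of _ (PathAlgebra k VA ⧸ IA)) × (∀ i, O i)))

end Main

end LIT

open LIT LIT.PathAlgebra in
theorem proposition3p3 {k : Type u} [Field k]
    {VA VB : Type u} [Quiver.{u} VA] [Quiver.{u} VB] [Fintype VA] [Fintype VB]
    [∀ a a' : VA, Finite (a ⟶ a')] [∀ b b' : VB, Finite (b ⟶ b')]
    {J : VA → VB → Type u} [∀ a b, Finite (J a b)]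
    (IA : Ideal (PathAlgebra k VA)) (IB : Ideal (PathAlgebra k VB))
    (IC : Ideal (PathAlgebra k (Glue VA VB J)))
    [IsAdmissible IA] [IsAdmissible IB] [IsAdmissible IC]
    (h : IsGluing IA IB IC) (hO : h.orbitGroup.FG) (n : ℕ)
    (hA : IsITAlgebra (PathAlgebra k VA ⧸ IA)ᵐᵒᵖ n)
    (hB : IsLITAlgebra (PathAlgebra k VB ⧸ IB)ᵐᵒᵖ n) :
    IsLITAlgebra (PathAlgebra k (Glue VA VB J) ⧸ IC)ᵐᵒᵖ (n + 1) ∧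
    (∃ (m : ℕ) (O : Fin m → ModuleCat.{u} (PathAlgebra k (Glue VA VB J) ⧸ IC)ᵐᵒᵖ),
      h.IsRepSystem O) ∧
    ∀ (W : ModuleCat.{u} (PathAlgebra k VA ⧸ IA)ᵐᵒᵖ)
      (V : ModuleCat.{u} (PathAlgebra k VB ⧸ IB)ᵐᵒᵖ)
      (𝒟 : ModuleCat.{u} (PathAlgebra k VB ⧸ IB)ᵐᵒᵖ → Prop),
      IsITModule n W → IsLIT n V 𝒟 →
      ∀ (m : ℕ) (O : Fin m → ModuleCat.{u} (PathAlgebra k (Glue VA VB J) ⧸ IC)ᵐᵒᵖ),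
        h.IsRepSystem O → IsLIT (n + 1) (h.litModule V W O) (h.inflClassB 𝒟) := by
  have : Module.Finite k (PathAlgebra k (Glue VA VB J) ⧸ IC)ᵐᵒᵖ :=
    Module.Finite.equiv (MulOpposite.opLinearEquiv k)
  obtain ⟨m, O, h₁, h₂, h₃⟩ := exists_finite_system_of_fg k hO
  have hrep : h.IsRepSystem O := ⟨h₁, h₂, h₃⟩
  obtain ⟨W, hW⟩ := hA
  obtain ⟨V, 𝒟, hV⟩ := hB
  exact ⟨⟨_, _, h.isLIT_litModule hW hV hrep⟩, ⟨m, O, hrep⟩,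
    fun W V 𝒟 hW hV m O hO => h.isLIT_litModule hW hV hO⟩
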